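/- **Setting.** Let $n\in\mathbb N$, let $\Theta=\{\theta\in\mathbb R^{n\times n}:\rho(\theta)<1\}$ be the set of stable matrices ($\rho$ is the spectral radius), and let $S_w,Q\in\mathbb R^{n\times n}$ be symmetric positive definite. For each $\theta\in\Theta$ consider $x_{t+1}=\theta x_t+w_t$ with i.i.d. noise whose law has mean zero, covariance matrix $S_w$ and an everywhere positive density, and let $S_\theta$ be the covariance matrix of the invariant distribution of $x_t$. Put $$I(\theta',\theta)=\tfrac12\operatorname{tr}\big(S_w^{-1}(\theta'-\theta)S_\theta(\theta'-\theta)^{\mathsf T}\big)\qquad(\theta'\in\mathbb R^{n\times n},\ \theta\in\Theta).$$ A reverse $I$-projection $\mathcal P(\theta')$ of $\theta'$ is a minimizer of $I(\theta',\cdot)$ over $\Theta$. For $\delta>0$ let $\theta^\star_\delta=(I_n+2\delta S_wP_\delta)^{-1}\theta'$, where $P_\delta$ is the positive definite solution of $P=Q+\theta'^{\mathsf T}P(I_n+2\delta S_wP)^{-1}\theta'$. For $R\succ0$ let $\mathsf{dlqr}(A,B,Q,R)$ be the matrix $K$ such that, for every initial state $x_0$, the feedback $u_t=Kx_t$ minimizes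 $\sum_{t\ge0}(x_t^{\mathsf T}Qx_t+u_t^{\mathsf T}Ru_t)$ subject to $x_{t+1}=Ax_t+Bu_t$ over all input sequences $(u_t)$. Finally, $\|\cdot\|_2$ is the spectral norm. **Proposition (Computing the reverse $I$-projection).** Let $\theta'\notin\Theta$. 1. If $\theta'$ has no eigenvalue of modulus one, then $\theta'$ has exactly one reverse $I$-projection. 2. For every $\delta>0$ the Riccati equation above has exactly one positive definite solution, so $\theta^\star_\delta$ is well defined. There is a $p\ge1$ such that, for all $\delta>0$, $\theta^\star_\delta$ is stable, and such that for every reverse $I$-projection $\mathcal P(\theta')$ of $\theta'$ there is a constant $C$ with $\|\mathcal P(\theta')-\theta^\star_\delta\|_2\le C\delta^{p}$ for all $\delta>0$. 3. For every $\delta>0$ the gain $\mathsf{dlqr}(\theta',I_n,Q,(2\delta S_w)^{-1})$ exists and is unique, and $\theta^\star_\delta=\theta'+\mathsf{dlqr}(\theta',I_n,Q,(2\delta S_w)^{-1})$. 4. This gain and $\theta^\star_\delta$ can be computed to any accuracy in $O(n^3)$ time and $O(n^2)$ memory, in the following sense. There are a single program for a real random access machine (unit-cost $+,-,\times,/$ and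 comparisons on real memory cells; index registers for addresses and counters) and an absolute constant $C$ such that for all $n\ge1$, all $\theta'\in\mathbb R^{n\times n}$, all $S_w,Q\succ0$, $\delta>0$ and $\varepsilon\in(0,1]$ the following holds. On input $(n,\theta',Q,S_w,\delta,\varepsilon)$ the program outputs a matrix $K$ together with $\theta'+K$ such that $\|K-\mathsf{dlqr}(\theta',I_n,Q,(2\delta S_w)^{-1})\|_2\le\varepsilon$ and $\|(\theta'+K)-\theta^\star_\delta\|_2\le\varepsilon$. It performs at most $$C\,n^3\big(1+\log\kappa+\log(1+\log(1/\varepsilon))\big)$$ operations whenever $\kappa$ bounds $\|\theta'\|_2,\|Q\|_2,\|Q^{-1}\|_2,\|S_w\|_2,\|S_w^{-1}\|_2,\delta,\delta^{-1}$, and all memory addresses and all integers it uses are at most $Cn^2$. In particular, for fixed accuracy and conditioning the time is $O(n^3)$ and the memory is $O(n^2)$. -/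

import Mathlib

open MeasureTheory ProbabilityTheory
open scoped ENNReal

noncomputable section

namespace RevI

/-! ### Stable matrices and the stationary state covariance -/

/-- The spectral (operator) norm of a real square matrix, induced by the Euclidean norm. -/
def specNorm {n : ℕ} (M : Matrix (Fin n) (Fin n) ℝ) : ℝ :=
  ‖Matrix.toEuclideanCLM (n := Fin n) (𝕜 := ℝ) M‖

/-- The set of (asymptotically) stable matrices: all complex eigenvalues have modulus `< 1`. -/
def stableSet (n : ℕ) : Set (Matrix (Fin n) (Fin n) ℝ) :=
  {θ | spectralRadius ℂ (θ.map (algebraMap ℝ ℂ)) < 1}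

/-- A noise distribution on `ℝⁿ` with mean zero, (finite) covariance matrix `Sw` and an everywhere
positive probability density function. -/
structure IsNoiseLaw {n : ℕ} (Sw : Matrix (Fin n) (Fin n) ℝ) (μ : Measure (Fin n → ℝ)) : Prop where
  isProbabilityMeasure : IsProbabilityMeasure μ
  memLp_two : MemLp (fun w : Fin n → ℝ => w) 2 μ
  mean_zero : ∀ i, ∫ w, w i ∂μ = 0
  second_moment : ∀ i j, ∫ w, w i * w j ∂μ = Sw i j
  density : ∃ f : (Fin n → ℝ) → ℝ, Measurable f ∧ (∀ w, 0 < f w) ∧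
    μ = (volume : Measure (Fin n → ℝ)).withDensity (fun w => ENNReal.ofReal (f w))

/-- `ν` is an invariant distribution of `x_{t+1} = θ x_t + w_t`, where `w_t ∼ μ` is independent
of `x_t`. -/
def IsInvariantLaw {n : ℕ} (μ : Measure (Fin n → ℝ)) (θ : Matrix (Fin n) (Fin n) ℝ)
    (ν : Measure (Fin n → ℝ)) : Prop :=
  IsProbabilityMeasure ν ∧
    (ν.prod μ).map (fun q : (Fin n → ℝ) × (Fin n → ℝ) => θ.mulVec q.1 + q.2) = ν

open Classical in
/-- The invariant distribution `ν_θ` (junk value `0` if there is none). -/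
def invariantLaw {n : ℕ} (μ : Measure (Fin n → ℝ)) (θ : Matrix (Fin n) (Fin n) ℝ) :
    Measure (Fin n → ℝ) :=
  if h : ∃ ν, IsInvariantLaw μ θ ν then h.choose else 0

/-- The covariance matrix `S_θ` of the state under the stationary distribution. -/
def stationaryCov {n : ℕ} (μ : Measure (Fin n → ℝ)) (θ : Matrix (Fin n) (Fin n) ℝ) :
    Matrix (Fin n) (Fin n) ℝ :=
  Matrix.of fun i j =>
    covariance (fun x : Fin n → ℝ => x i) (fun x : Fin n → ℝ => x j) (invariantLaw μ θ)

/-- The discrepancy function `I(θ', θ) = ½ tr (S_w⁻¹ (θ' - θ) S_θ (θ' - θ)ᵀ)`. Here `noise θ` is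
the noise distribution under the model with system matrix `θ`. -/
def discrepancy {n : ℕ} (Sw : Matrix (Fin n) (Fin n) ℝ)
    (noise : Matrix (Fin n) (Fin n) ℝ → Measure (Fin n → ℝ))
    (θ' θ : Matrix (Fin n) (Fin n) ℝ) : ℝ :=
  (1 / 2) * (Sw⁻¹ * (θ' - θ) * stationaryCov (noise θ) θ * (θ' - θ).transpose).trace

/-- `P` is a reverse `I`-projection of `θ'`: a minimizer of `I(θ', ·)` over the stable matrices. -/
def IsReverseIProjection {n : ℕ} (Sw : Matrix (Fin n) (Fin n) ℝ)
    (noise : Matrix (Fin n) (Fin n) ℝ → Measure (Fin n → ℝ))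
    (θ' P : Matrix (Fin n) (Fin n) ℝ) : Prop :=
  P ∈ stableSet n ∧ IsMinOn (discrepancy Sw noise θ') (stableSet n) P

/-! ### The Riccati equation and the matrix `θ*_δ` -/

/-- `P` is a positive definite solution of `P = Q + θ'ᵀ P (I + 2 δ S_w P)⁻¹ θ'`. -/
def IsRiccatiSolution {n : ℕ} (Sw Q θ' : Matrix (Fin n) (Fin n) ℝ) (δ : ℝ)
    (P : Matrix (Fin n) (Fin n) ℝ) : Prop :=
  P.PosDef ∧ P = Q + θ'.transpose * P * (1 + (2 * δ) • (Sw * P))⁻¹ * θ'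

open Classical in
/-- The positive definite solution `P_δ` of the Riccati equation (junk value `0` if none). -/
def riccatiSolution {n : ℕ} (Sw Q θ' : Matrix (Fin n) (Fin n) ℝ) (δ : ℝ) :
    Matrix (Fin n) (Fin n) ℝ :=
  if h : ∃ P, IsRiccatiSolution Sw Q θ' δ P then h.choose else 0

/-- `θ*_δ = (I + 2 δ S_w P_δ)⁻¹ θ'`. -/
def thetaStar {n : ℕ} (Sw Q θ' : Matrix (Fin n) (Fin n) ℝ) (δ : ℝ) :
    Matrix (Fin n) (Fin n) ℝ :=
  (1 + (2 * δ) • (Sw * riccatiSolution Sw Q θ' δ))⁻¹ * θ'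

/-! ### The infinite-horizon deterministic LQR problem in discrete time -/

/-- The trajectory of `x_{t+1} = A x_t + B u_t`. -/
def trajectory {n m : ℕ} (A : Matrix (Fin n) (Fin n) ℝ) (B : Matrix (Fin n) (Fin m) ℝ)
    (x₀ : Fin n → ℝ) (u : ℕ → Fin m → ℝ) : ℕ → Fin n → ℝ
  | 0 => x₀
  | t + 1 => A.mulVec (trajectory A B x₀ u t) + B.mulVec (u t)

/-- The cost `∑ₜ (xₜᵀ Q xₜ + uₜᵀ R uₜ) ∈ [0, ∞]` of an input sequence `u`. -/
def lqrCost {n m : ℕ} (A : Matrix (Fin n) (Fin n) ℝ) (B : Matrix (Fin n) (Fin m) ℝ)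
    (Q : Matrix (Fin n) (Fin n) ℝ) (R : Matrix (Fin m) (Fin m) ℝ)
    (x₀ : Fin n → ℝ) (u : ℕ → Fin m → ℝ) : ℝ≥0∞ :=
  ∑' t, ENNReal.ofReal
    (dotProduct (trajectory A B x₀ u t) (Q.mulVec (trajectory A B x₀ u t)) +
      dotProduct (u t) (R.mulVec (u t)))

/-- The inputs generated by the linear feedback `u_t = K x_t`, i.e. `u_t = K (A + B K)^t x₀`. -/
def feedbackInput {n m : ℕ} (A : Matrix (Fin n) (Fin n) ℝ) (B : Matrix (Fin n) (Fin m) ℝ)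
    (K : Matrix (Fin m) (Fin n) ℝ) (x₀ : Fin n → ℝ) : ℕ → Fin m → ℝ :=
  fun t => K.mulVec (((A + B * K) ^ t).mulVec x₀)

/-- `K` is an optimal feedback gain: from every initial state, the feedback `u_t = K x_t` attains
the smallest cost among all input sequences. -/
def IsOptimalGain {n m : ℕ} (A : Matrix (Fin n) (Fin n) ℝ) (B : Matrix (Fin n) (Fin m) ℝ)
    (Q : Matrix (Fin n) (Fin n) ℝ) (R : Matrix (Fin m) (Fin m) ℝ)
    (K : Matrix (Fin m) (Fin n) ℝ) : Prop :=
  ∀ (x₀ : Fin n → ℝ) (u : ℕ → Fin m → ℝ),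
    lqrCost A B Q R x₀ (feedbackInput A B K x₀) ≤ lqrCost A B Q R x₀ u

open Classical in
/-- The optimal feedback gain (junk value `0` if there is none). -/
def dlqr {n m : ℕ} (A : Matrix (Fin n) (Fin n) ℝ) (B : Matrix (Fin n) (Fin m) ℝ)
    (Q : Matrix (Fin n) (Fin n) ℝ) (R : Matrix (Fin m) (Fin m) ℝ) :
    Matrix (Fin m) (Fin n) ℝ :=
  if h : ∃ K, IsOptimalGain A B Q R K then h.choose else 0

/-! ### A real random access machine with time and memory accounting

A machine has finitely many relevant index registers holding natural numbers (used as counters and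
addresses) and a memory of cells, each holding one real number. Programs are built from unit-cost
elementary operations; real arithmetic is restricted to `+`, `-`, `*`, `/` and comparisons. -/

structure RamState where
  idx : ℕ → ℕ
  mem : ℕ → ℝ

inductive IdxOp
  | add | sub | mul

def IdxOp.eval : IdxOp → ℕ → ℕ → ℕ
  | .add, a, b => a + b
  | .sub, a, b => a - b
  | .mul, a, b => a * b

inductive RealOp
  | add | sub | mul | div

def RealOp.eval : RealOp → ℝ → ℝ → ℝ
  | .add, a, b => a + b
  | .sub, a, b => a - b
  | .mul, a, b => a * b
  | .div, a, b => a / b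

/-- Programs. Real cells are addressed indirectly, through index registers: `[i]` denotes the
memory cell whose address is the content of the index register `i`. -/
inductive Prog
  /-- no operation -/
  | skip
  /-- register `i := c` -/
  | idxConst (i c : ℕ)
  /-- register `i := j op k` -/
  | idxOp (op : IdxOp) (i j k : ℕ)
  /-- cell `[i] := c` -/
  | realConst (i : ℕ) (c : ℤ)
  /-- cell `[i] := [j]` -/
  | realCopy (i j : ℕ)
  /-- cell `[i] := [j] op [k]` -/
  | realOp (op : RealOp) (i j k : ℕ)
  /-- sequential composition -/
  | seq (p q : Prog)
  /-- if register `i <` register `j` then `p` else `q` -/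
  | ifIdx (i j : ℕ) (p q : Prog)
  /-- if cell `[i] <` cell `[j]` then `p` else `q` -/
  | ifReal (i j : ℕ) (p q : Prog)
  /-- while register `i <` register `j` do `p` -/
  | whileIdx (i j : ℕ) (p : Prog)
  /-- while cell `[i] <` cell `[j]` do `p` -/
  | whileReal (i j : ℕ) (p : Prog)

/-- `Exec S p σ σ' t`: started in the state `σ`, the program `p` halts in the state `σ'` after
exactly `t` elementary operations and tests; it accesses only memory cells with addresses `< S`
and writes only numbers `≤ S` into index registers. There is no execution dividing by zero. -/
inductive Exec (S : ℕ) : Prog → RamState → RamState → ℕ → Prop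
  | skip (σ : RamState) : Exec S .skip σ σ 1
  | idxConst (σ : RamState) (i c : ℕ) (hc : c ≤ S) :
      Exec S (.idxConst i c) σ ⟨Function.update σ.idx i c, σ.mem⟩ 1
  | idxOp (σ : RamState) (op : IdxOp) (i j k : ℕ) (hc : op.eval (σ.idx j) (σ.idx k) ≤ S) :
      Exec S (.idxOp op i j k) σ
        ⟨Function.update σ.idx i (op.eval (σ.idx j) (σ.idx k)), σ.mem⟩ 1
  | realConst (σ : RamState) (i : ℕ) (c : ℤ) (hi : σ.idx i < S) :
      Exec S (.realConst i c) σ ⟨σ.idx, Function.update σ.mem (σ.idx i) (c : ℝ)⟩ 1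
  | realCopy (σ : RamState) (i j : ℕ) (hi : σ.idx i < S) (hj : σ.idx j < S) :
      Exec S (.realCopy i j) σ
        ⟨σ.idx, Function.update σ.mem (σ.idx i) (σ.mem (σ.idx j))⟩ 1
  | realOp (σ : RamState) (op : RealOp) (i j k : ℕ) (hi : σ.idx i < S) (hj : σ.idx j < S)
      (hk : σ.idx k < S) (hdiv : op = .div → σ.mem (σ.idx k) ≠ 0) :
      Exec S (.realOp op i j k) σ
        ⟨σ.idx, Function.update σ.mem (σ.idx i)
          (op.eval (σ.mem (σ.idx j)) (σ.mem (σ.idx k)))⟩ 1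
  | seq {p q : Prog} {σ₁ σ₂ σ₃ : RamState} {s t : ℕ}
      (hp : Exec S p σ₁ σ₂ s) (hq : Exec S q σ₂ σ₃ t) : Exec S (.seq p q) σ₁ σ₃ (s + t)
  | ifIdxTrue {i j : ℕ} {p q : Prog} {σ σ' : RamState} {t : ℕ}
      (h : σ.idx i < σ.idx j) (hp : Exec S p σ σ' t) : Exec S (.ifIdx i j p q) σ σ' (t + 1)
  | ifIdxFalse {i j : ℕ} {p q : Prog} {σ σ' : RamState} {t : ℕ}
      (h : ¬ σ.idx i < σ.idx j) (hq : Exec S q σ σ' t) : Exec S (.ifIdx i j p q) σ σ' (t + 1)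
  | ifRealTrue {i j : ℕ} {p q : Prog} {σ σ' : RamState} {t : ℕ}
      (hi : σ.idx i < S) (hj : σ.idx j < S)
      (h : σ.mem (σ.idx i) < σ.mem (σ.idx j)) (hp : Exec S p σ σ' t) :
      Exec S (.ifReal i j p q) σ σ' (t + 1)
  | ifRealFalse {i j : ℕ} {p q : Prog} {σ σ' : RamState} {t : ℕ}
      (hi : σ.idx i < S) (hj : σ.idx j < S)
      (h : ¬ σ.mem (σ.idx i) < σ.mem (σ.idx j)) (hq : Exec S q σ σ' t) :
      Exec S (.ifReal i j p q) σ σ' (t + 1)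
  | whileIdxTrue {i j : ℕ} {p : Prog} {σ₁ σ₂ σ₃ : RamState} {s t : ℕ}
      (h : σ₁.idx i < σ₁.idx j) (hp : Exec S p σ₁ σ₂ s)
      (hw : Exec S (.whileIdx i j p) σ₂ σ₃ t) : Exec S (.whileIdx i j p) σ₁ σ₃ (1 + s + t)
  | whileIdxFalse {i j : ℕ} {p : Prog} {σ : RamState}
      (h : ¬ σ.idx i < σ.idx j) : Exec S (.whileIdx i j p) σ σ 1
  | whileRealTrue {i j : ℕ} {p : Prog} {σ₁ σ₂ σ₃ : RamState} {s t : ℕ}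
      (hi : σ₁.idx i < S) (hj : σ₁.idx j < S)
      (h : σ₁.mem (σ₁.idx i) < σ₁.mem (σ₁.idx j)) (hp : Exec S p σ₁ σ₂ s)
      (hw : Exec S (.whileReal i j p) σ₂ σ₃ t) : Exec S (.whileReal i j p) σ₁ σ₃ (1 + s + t)
  | whileRealFalse {i j : ℕ} {p : Prog} {σ : RamState}
      (hi : σ.idx i < S) (hj : σ.idx j < S)
      (h : ¬ σ.mem (σ.idx i) < σ.mem (σ.idx j)) : Exec S (.whileReal i j p) σ σ 1

/-- The matrix `M` is stored row by row in the memory cells `base, base + 1, …`. -/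
def Stores {n : ℕ} (σ : RamState) (base : ℕ) (M : Matrix (Fin n) (Fin n) ℝ) : Prop :=
  ∀ i j : Fin n, σ.mem (base + i.val * n + j.val) = M i j

/-- Input convention: register `0` holds `n`, and the memory starts with `θ'`, `Q`, `S_w`, `δ` and
the accuracy `ε`. All other registers and cells may hold anything. -/
def IsInput {n : ℕ} (σ : RamState) (θ' Q Sw : Matrix (Fin n) (Fin n) ℝ) (δ ε : ℝ) : Prop :=
  σ.idx 0 = n ∧ Stores σ 0 θ' ∧ Stores σ (n ^ 2) Q ∧ Stores σ (2 * n ^ 2) Sw ∧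
    σ.mem (3 * n ^ 2) = δ ∧ σ.mem (3 * n ^ 2 + 1) = ε

/-- The problem data are bounded, together with their inverses, by `κ`. -/
def CondBound {n : ℕ} (κ : ℝ) (θ' Q Sw : Matrix (Fin n) (Fin n) ℝ) (δ : ℝ) : Prop :=
  specNorm θ' ≤ κ ∧ specNorm Q ≤ κ ∧ specNorm Q⁻¹ ≤ κ ∧ specNorm Sw ≤ κ ∧ specNorm Sw⁻¹ ≤ κ ∧
    δ ≤ κ ∧ δ⁻¹ ≤ κ

end RevI

end

/-!
Write `R = (2 δ S_w)⁻¹`, `A = θ'` and `Φ(P) = Q + Aᵀ P F_P` with `F_P = (R + P)⁻¹ R A`, and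
abbreviate `q_M(x) = xᵀ M x`. Everything rests on completing the square in the one-step problem
(`completion_of_squares`): `q_Q(x) + q_P(y) + q_R(y - A x) = q_{Φ(P)}(x) + q_{R + P}(y - F_P x)`.
It shows that `Φ` is monotone, that its iterates from `0` increase and stay below the value matrix
`Q + Aᵀ R A` of the controller which moves to the origin in one step (`deadbeat`), and hence that
the Riccati equation has a positive definite solution, whose closed loop `θ*_δ = F_P` is stable;
summed along a trajectory it gives the optimality and the uniqueness of the LQR gain `θ*_δ - A`.

For the reverse `I`-projection, the stationary covariance `S` of a stable `θ` is shown to solve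
`S = θ S θᵀ + S_w` (`stationaryCov_eq`). Completing the square under the trace then gives, for
every positive semidefinite solution `P` of the Riccati equation with `R = (2 S_w)⁻¹` and state
cost `Q`, `I(A, θ) = tr(P S_w) - tr(Q S) + tr((θ - F_P)ᵀ (R + P) (θ - F_P) S)` (`discrepancy_eq`).
The scaled solutions `δ P_δ` solve this equation with state cost `δ Q`; as `δ → 0` they decrease
to a solution `P₀` with state cost `0`, and `θ*_δ` tends to `F_{P₀}`. Comparing the values of `I`
shows that a reverse `I`-projection exists exactly if `F_{P₀}` is stable, and then equals
`F_{P₀}`. The matrix `F_{P₀}` is a limit of stable matrices; an eigenvector for an eigenvalue of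
modulus one would carry no control cost and thus be an eigenvector of `A` for the same eigenvalue,
so `F_{P₀}` is stable if `A` has no such eigenvalue. If `F_{P₀}` is stable, the sum of
`(F_{P₀}ᵀ)ᵗ Q F_{P₀}ᵗ` bounds `(δ P_δ - P₀) / δ`, which gives the linear rate.

The algorithm is structure-preserving doubling (`riccatiMap_doubling`): two steps of `Φ` for the
data `(a, G, H)` are one step for `(a Z, G + a W aᵀ, H + aᵀ H Z)` with `W = (G⁻¹ + H)⁻¹` and
`Z = W G⁻¹ a`, so `k` doublings yield the `2ᵏ`-th iterate of `Φ`. The resulting gain has a squared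
error in spectral norm of at most `c³ (1 - 1 / c) ^ 2ᵏ` as soon as `c I ≻ V`, `c R ≻ I` and
`c Q ≻ V`, where `V = Q + Aᵀ R A` (`specNorm_closedLoop_sub_le`). The program finds such a `c` by
doubling, and every `c` above a power of the condition bound will do (`CondBound.tests`). Then it
iterates until this error bound is below `ε²`. Both loops run logarithmically often
(`exists_iteration_bound`), and each pass consists of boundedly many matrix products and of
inversions of positive definite matrices by principal exchange steps, which also decide
definiteness by the signs of the pivots (`Swept.pivot_pos_iff`). Programs are verified by
Hoare-style total correctness rules with time bounds (`Run`) over states consisting of matrices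
and scalars.
-/

noncomputable section

namespace RevI

open Matrix Filter Topology

/-! ### Quadratic forms -/

/-- The quadratic form `x ↦ xᵀ M x`. -/
def qf {n : ℕ} (M : Matrix (Fin n) (Fin n) ℝ) (x : Fin n → ℝ) : ℝ := x ⬝ᵥ (M *ᵥ x)

section QuadraticForms

variable {n : ℕ} {M N : Matrix (Fin n) (Fin n) ℝ}

lemma dot_mulVec_comm (hM : M.IsSymm) (u v : Fin n → ℝ) : u ⬝ᵥ (M *ᵥ v) = v ⬝ᵥ (M *ᵥ u) := by
  rw [dotProduct_mulVec, ← mulVec_transpose, hM.eq, dotProduct_comm]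

lemma dot_transpose_mulVec (M : Matrix (Fin n) (Fin n) ℝ) (u v : Fin n → ℝ) :
    u ⬝ᵥ (Mᵀ *ᵥ v) = (M *ᵥ u) ⬝ᵥ v := by
  rw [mulVec_transpose, dotProduct_comm, ← dotProduct_mulVec, dotProduct_comm]

lemma qf_add (M N : Matrix (Fin n) (Fin n) ℝ) (x : Fin n → ℝ) :
    qf (M + N) x = qf M x + qf N x := by
  simp [qf, add_mulVec]

lemma qf_sub (M N : Matrix (Fin n) (Fin n) ℝ) (x : Fin n → ℝ) :
    qf (M - N) x = qf M x - qf N x := by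
  simp [qf, sub_mulVec]

lemma qf_smul (c : ℝ) (M : Matrix (Fin n) (Fin n) ℝ) (x : Fin n → ℝ) :
    qf (c • M) x = c * qf M x := by
  simp [qf, smul_mulVec]

lemma qf_smul_vec (c : ℝ) (M : Matrix (Fin n) (Fin n) ℝ) (x : Fin n → ℝ) :
    qf M (c • x) = c ^ 2 * qf M x := by
  simp [qf, mulVec_smul]; ring

lemma qf_neg (M : Matrix (Fin n) (Fin n) ℝ) (x : Fin n → ℝ) : qf M (-x) = qf M x := by
  simp [qf, mulVec_neg]

@[simp] lemma qf_zero (x : Fin n → ℝ) : qf 0 x = 0 := by simp [qf]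

@[simp] lemma qf_zero_vec (M : Matrix (Fin n) (Fin n) ℝ) : qf M 0 = 0 := by simp [qf]

lemma qf_one (x : Fin n → ℝ) : qf 1 x = x ⬝ᵥ x := by simp [qf]

lemma qf_conj (M B : Matrix (Fin n) (Fin n) ℝ) (x : Fin n → ℝ) :
    qf (Bᵀ * M * B) x = qf M (B *ᵥ x) := by
  unfold qf
  rw [← mulVec_mulVec, ← mulVec_mulVec, dot_transpose_mulVec]

lemma qf_add_vec (hM : M.IsSymm) (x y : Fin n → ℝ) :
    qf M (x + y) = qf M x + 2 * (x ⬝ᵥ (M *ᵥ y)) + qf M y := by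
  simp only [qf, mulVec_add, dotProduct_add, add_dotProduct]
  rw [dot_mulVec_comm hM y x]; ring

lemma qf_sub_vec (hM : M.IsSymm) (x y : Fin n → ℝ) :
    qf M (x - y) = qf M x - 2 * (x ⬝ᵥ (M *ᵥ y)) + qf M y := by
  simp only [qf, mulVec_sub, dotProduct_sub, sub_dotProduct]
  rw [dot_mulVec_comm hM y x]; ring

lemma _root_.Matrix.PosSemidef.symm' (h : M.PosSemidef) : M.IsSymm := by
  have := h.1; rwa [IsHermitian, conjTranspose_eq_transpose_of_trivial] at this

lemma _root_.Matrix.PosDef.symm' (h : M.PosDef) : M.IsSymm := h.posSemidef.symm'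

lemma posSemidef_iff_qf : M.PosSemidef ↔ M.IsSymm ∧ ∀ x, 0 ≤ qf M x := by
  rw [posSemidef_iff_dotProduct_mulVec, IsHermitian, conjTranspose_eq_transpose_of_trivial]
  simp [qf, IsSymm]

lemma posDef_iff_qf : M.PosDef ↔ M.IsSymm ∧ ∀ x, x ≠ 0 → 0 < qf M x := by
  rw [posDef_iff_dotProduct_mulVec, IsHermitian, conjTranspose_eq_transpose_of_trivial]
  simp [qf, IsSymm]

lemma qf_nonneg (h : M.PosSemidef) (x : Fin n → ℝ) : 0 ≤ qf M x := (posSemidef_iff_qf.1 h).2 x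

lemma qf_pos (h : M.PosDef) {x : Fin n → ℝ} (hx : x ≠ 0) : 0 < qf M x :=
  (posDef_iff_qf.1 h).2 x hx

lemma eq_zero_of_qf_nonpos (h : M.PosDef) {x : Fin n → ℝ} (hx : qf M x ≤ 0) : x = 0 := by
  by_contra h0
  exact absurd (qf_pos h h0) (not_lt.2 hx)

/-- Polarization: the entries of a symmetric matrix in terms of its quadratic form. -/
lemma entry_eq_qf (hM : M.IsSymm) (i j : Fin n) :
    M i j = (qf M (Pi.single i 1 + Pi.single j 1) - qf M (Pi.single i 1)
      - qf M (Pi.single j 1)) / 2 := by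
  rw [qf_add_vec hM]
  have : M i j = Pi.single i 1 ⬝ᵥ (M *ᵥ Pi.single j 1) := by simp
  rw [this]; ring

lemma eq_of_qf_eq (hM : M.IsSymm) (hN : N.IsSymm) (h : ∀ x, qf M x = qf N x) : M = N := by
  ext i j
  rw [entry_eq_qf hM, entry_eq_qf hN, h, h, h]

lemma continuous_qf (x : Fin n → ℝ) :
    Continuous fun M : Matrix (Fin n) (Fin n) ℝ => qf M x := by
  unfold qf; fun_prop

lemma IsSymm_conj {n : ℕ} {M : Matrix (Fin n) (Fin n) ℝ} (hM : M.IsSymm)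
    (B : Matrix (Fin n) (Fin n) ℝ) : (Bᵀ * M * B).IsSymm := by
  simp [IsSymm, transpose_mul, hM.eq, Matrix.mul_assoc]

lemma dot_self_nonneg (x : Fin n → ℝ) : 0 ≤ x ⬝ᵥ x := by
  simpa using dotProduct_star_self_nonneg x

/-- Cauchy-Schwarz for a positive semidefinite form. -/
lemma sq_dot_mulVec_le (h : M.PosSemidef) (x y : Fin n → ℝ) :
    (x ⬝ᵥ (M *ᵥ y)) ^ 2 ≤ qf M x * qf M y := by
  have key : ∀ t : ℝ, 0 ≤ qf M y * (t * t) + (2 * (x ⬝ᵥ (M *ᵥ y))) * t + qf M x := by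
    intro t
    have := qf_nonneg h (x + t • y)
    rw [qf_add_vec h.symm', qf_smul_vec, mulVec_smul, dotProduct_smul, smul_eq_mul] at this
    linarith
  have := discrim_le_zero key
  unfold discrim at this
  nlinarith

lemma sq_dot_le (x y : Fin n → ℝ) : (x ⬝ᵥ y) ^ 2 ≤ (x ⬝ᵥ x) * (y ⬝ᵥ y) := by
  simpa [qf_one] using sq_dot_mulVec_le (PosSemidef.one (n := Fin n) (R := ℝ)) x y

lemma isUnit_det_of_posDef (h : M.PosDef) : IsUnit M.det :=
  (isUnit_iff_isUnit_det M).1 h.isUnit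

end QuadraticForms

/-! ### One step of dynamic programming -/

section Riccati

variable {n : ℕ} {A R Q P X Y : Matrix (Fin n) (Fin n) ℝ}

/-- The closed-loop matrix `(R + P)⁻¹ R A` that minimizes the one-step cost
`yᵀ P y + (y - A x)ᵀ R (y - A x)` over the next state `y`. -/
def closedLoop (A R P : Matrix (Fin n) (Fin n) ℝ) : Matrix (Fin n) (Fin n) ℝ :=
  (R + P)⁻¹ * (R * A)

/-- The Riccati map: the value matrix of the one-step problem with terminal value matrix `P`. -/
def riccatiMap (A R Q P : Matrix (Fin n) (Fin n) ℝ) : Matrix (Fin n) (Fin n) ℝ :=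
  Q + Aᵀ * P * closedLoop A R P

lemma mul_closedLoop (hR : R.PosDef) (hP : P.PosSemidef) :
    (R + P) * closedLoop A R P = R * A := by
  rw [closedLoop, ← Matrix.mul_assoc,
    mul_nonsing_inv _ (isUnit_det_of_posDef (hR.add_posSemidef hP)), Matrix.one_mul]

lemma isSymm_riccatiMap (hR : R.PosDef) (hQ : Q.IsSymm) (hP : P.PosSemidef) :
    (riccatiMap A R Q P).IsSymm := by
  have h1 := mul_closedLoop (A := A) hR hP
  set F := closedLoop A R P with hF
  -- `P F = R (A - F)` turns `Aᵀ P F` into `Aᵀ R A - Fᵀ (R + P) F`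
  have h2 : Aᵀ * P * F = Aᵀ * R * A - Fᵀ * (R + P) * F := by
    have h3 : Fᵀ * (R + P) = Aᵀ * R := by
      have := congrArg transpose h1
      simpa [transpose_mul, hR.symm'.eq, hP.symm'.eq] using this
    rw [h3, Matrix.mul_assoc, Matrix.mul_assoc, Matrix.mul_assoc, ← h1]
    noncomm_ring
  rw [riccatiMap, ← hF, h2]
  refine hQ.add ((IsSymm_conj hR.symm' A).sub (IsSymm_conj ?_ F))
  exact hR.symm'.add hP.symm'

/-- Completion of squares: the one-step cost of moving from `x` to `y` is the optimal one plus a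
penalty for deviating from the closed loop. -/
lemma completion_of_squares (hR : R.PosDef) (hP : P.PosSemidef) (Q : Matrix (Fin n) (Fin n) ℝ)
    (x y : Fin n → ℝ) :
    qf Q x + qf P y + qf R (y - A *ᵥ x) =
      qf (riccatiMap A R Q P) x + qf (R + P) (y - closedLoop A R P *ᵥ x) := by
  have h1 := mul_closedLoop (A := A) hR hP
  set F := closedLoop A R P with hF
  have h2 : (R + P) *ᵥ (F *ᵥ x) = R *ᵥ (A *ᵥ x) := by
    rw [mulVec_mulVec, h1, mulVec_mulVec]
  rw [riccatiMap, ← hF, qf_add, qf_sub_vec hR.symm', qf_sub_vec (hR.symm'.add hP.symm'), h2,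
    qf_add R P y]
  have h3 : qf (R + P) (F *ᵥ x) = (F *ᵥ x) ⬝ᵥ (R *ᵥ (A *ᵥ x)) := by rw [qf, h2]
  have h4 : qf (Aᵀ * P * F) x = (A *ᵥ x) ⬝ᵥ (P *ᵥ (F *ᵥ x)) := by
    rw [qf, ← mulVec_mulVec, ← mulVec_mulVec, dot_transpose_mulVec]
  have h5 : qf R (A *ᵥ x) = (A *ᵥ x) ⬝ᵥ (P *ᵥ (F *ᵥ x)) + (F *ᵥ x) ⬝ᵥ (R *ᵥ (A *ᵥ x)) := by
    have h6 := congrArg (fun v => (A *ᵥ x) ⬝ᵥ v) h2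
    simp only [add_mulVec, dotProduct_add] at h6
    rw [qf, ← h6, dot_mulVec_comm hR.symm' (F *ᵥ x)]
    ring
  rw [h3, h4, h5]; ring

lemma riccatiMap_le (hR : R.PosDef) (hP : P.PosSemidef) (Q : Matrix (Fin n) (Fin n) ℝ)
    (x y : Fin n → ℝ) :
    qf (riccatiMap A R Q P) x ≤ qf Q x + qf P y + qf R (y - A *ᵥ x) := by
  rw [completion_of_squares hR hP]
  linarith [qf_nonneg (hR.add_posSemidef hP).posSemidef (y - closedLoop A R P *ᵥ x)]

lemma riccatiMap_eq (hR : R.PosDef) (hP : P.PosSemidef) (Q : Matrix (Fin n) (Fin n) ℝ)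
    (x : Fin n → ℝ) :
    qf (riccatiMap A R Q P) x = qf Q x + qf P (closedLoop A R P *ᵥ x) +
      qf R (closedLoop A R P *ᵥ x - A *ᵥ x) := by
  rw [completion_of_squares hR hP, sub_self, qf_zero_vec, add_zero]

lemma posSemidef_riccatiMap (hR : R.PosDef) (hQ : Q.PosSemidef) (hP : P.PosSemidef) :
    (riccatiMap A R Q P).PosSemidef := by
  refine posSemidef_iff_qf.2 ⟨isSymm_riccatiMap hR hQ.symm' hP, fun x => ?_⟩
  rw [riccatiMap_eq hR hP]
  have := qf_nonneg hQ x
  have := qf_nonneg hP (closedLoop A R P *ᵥ x)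
  have := qf_nonneg hR.posSemidef (closedLoop A R P *ᵥ x - A *ᵥ x)
  linarith

lemma qf_le_riccatiMap (hR : R.PosDef) (hP : P.PosSemidef) (Q : Matrix (Fin n) (Fin n) ℝ)
    (x : Fin n → ℝ) : qf Q x ≤ qf (riccatiMap A R Q P) x := by
  rw [riccatiMap_eq hR hP]
  have := qf_nonneg hP (closedLoop A R P *ᵥ x)
  have := qf_nonneg hR.posSemidef (closedLoop A R P *ᵥ x - A *ᵥ x)
  linarith

/-- The difference of the Riccati map at two arguments is controlled by the difference of the
arguments along the closed loop of the smaller one. -/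
lemma riccatiMap_sub_le (hR : R.PosDef) (hX : X.PosSemidef) (hY : Y.PosSemidef)
    (Q : Matrix (Fin n) (Fin n) ℝ) (x : Fin n → ℝ) :
    qf (riccatiMap A R Q X) x - qf (riccatiMap A R Q Y) x ≤
      qf X (closedLoop A R Y *ᵥ x) - qf Y (closedLoop A R Y *ᵥ x) := by
  have h1 := riccatiMap_le (A := A) hR hX Q x (closedLoop A R Y *ᵥ x)
  rw [riccatiMap_eq hR hY]
  linarith

lemma riccatiMap_mono (hR : R.PosDef) (hX : X.PosSemidef) (hY : Y.PosSemidef)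
    (h : ∀ x, qf X x ≤ qf Y x) (Q : Matrix (Fin n) (Fin n) ℝ) (x : Fin n → ℝ) :
    qf (riccatiMap A R Q X) x ≤ qf (riccatiMap A R Q Y) x := by
  have := riccatiMap_sub_le (A := A) hR hX hY Q x
  linarith [h (closedLoop A R Y *ᵥ x)]

/-- The cost `Q + Aᵀ R A` of jumping to the origin in one step. -/
def deadbeat (A R Q : Matrix (Fin n) (Fin n) ℝ) : Matrix (Fin n) (Fin n) ℝ := Q + Aᵀ * R * A

lemma qf_deadbeat (x : Fin n → ℝ) : qf (deadbeat A R Q) x = qf Q x + qf R (A *ᵥ x) := by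
  rw [deadbeat, qf_add, qf_conj]

lemma riccatiMap_le_deadbeat (hR : R.PosDef) (hP : P.PosSemidef)
    (Q : Matrix (Fin n) (Fin n) ℝ) (x : Fin n → ℝ) :
    qf (riccatiMap A R Q P) x ≤ qf (deadbeat A R Q) x := by
  have := riccatiMap_le (A := A) hR hP Q x 0
  rw [qf_deadbeat]
  simpa [qf_neg] using this

/-! ### The value iteration and the fixed point of the Riccati map -/

/-- The value matrix of the problem with horizon `N`. -/
def valueIter (A R Q : Matrix (Fin n) (Fin n) ℝ) (N : ℕ) : Matrix (Fin n) (Fin n) ℝ :=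
  (riccatiMap A R Q)^[N] 0

lemma valueIter_succ (N : ℕ) :
    valueIter A R Q (N + 1) = riccatiMap A R Q (valueIter A R Q N) :=
  Function.iterate_succ_apply' _ _ _

lemma posSemidef_valueIter (hR : R.PosDef) (hQ : Q.PosSemidef) (N : ℕ) :
    (valueIter A R Q N).PosSemidef := by
  induction N with
  | zero => exact PosSemidef.zero
  | succ N ih => rw [valueIter_succ]; exact posSemidef_riccatiMap hR hQ ih

lemma valueIter_le_succ (hR : R.PosDef) (hQ : Q.PosSemidef) (N : ℕ) (x : Fin n → ℝ) :
    qf (valueIter A R Q N) x ≤ qf (valueIter A R Q (N + 1)) x := by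
  induction N generalizing x with
  | zero =>
    have := qf_nonneg (posSemidef_valueIter (A := A) hR hQ 1) x
    simpa [valueIter] using this
  | succ N ih =>
    rw [valueIter_succ, valueIter_succ (N + 1)]
    exact riccatiMap_mono hR (posSemidef_valueIter hR hQ N) (posSemidef_valueIter hR hQ (N + 1))
      ih Q x

lemma valueIter_le_deadbeat (hR : R.PosDef) (hQ : Q.PosSemidef) (N : ℕ) (x : Fin n → ℝ) :
    qf (valueIter A R Q N) x ≤ qf (deadbeat A R Q) x := by
  refine (valueIter_le_succ hR hQ N x).trans ?_
  rw [valueIter_succ]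
  exact riccatiMap_le_deadbeat hR (posSemidef_valueIter hR hQ N) Q x

lemma isClosed_posSemidef : IsClosed {M : Matrix (Fin n) (Fin n) ℝ | M.PosSemidef} := by
  have : {M : Matrix (Fin n) (Fin n) ℝ | M.PosSemidef} =
      {M | Mᵀ = M} ∩ ⋂ x, {M | 0 ≤ qf M x} := by
    ext M; simp [posSemidef_iff_qf, IsSymm]
  rw [this]
  refine IsClosed.inter (isClosed_eq (by fun_prop) continuous_id) ?_
  exact isClosed_iInter fun x => isClosed_le continuous_const (continuous_qf x)

lemma continuousAt_inv_of_posDef {M : Matrix (Fin n) (Fin n) ℝ} (hM : M.PosDef) :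
    ContinuousAt (fun X : Matrix (Fin n) (Fin n) ℝ => X⁻¹) M := by
  have h0 : M.det ≠ 0 := (isUnit_det_of_posDef hM).ne_zero
  have h1 : (fun X : Matrix (Fin n) (Fin n) ℝ => X⁻¹) = fun X => X.det⁻¹ • X.adjugate := by
    ext X; rw [inv_def, Ring.inverse_eq_inv']
  rw [h1]
  exact ContinuousAt.smul ((Continuous.matrix_det continuous_id).continuousAt.inv₀ h0)
    (Continuous.matrix_adjugate continuous_id).continuousAt

lemma continuousAt_closedLoop (hR : R.PosDef) (hP : P.PosSemidef) :
    ContinuousAt (fun P => closedLoop A R P) P := by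
  have h : ContinuousAt (fun P : Matrix (Fin n) (Fin n) ℝ => (R + P)⁻¹) P :=
    ContinuousAt.comp (f := fun P => R + P)
      (continuousAt_inv_of_posDef (hR.add_posSemidef hP)) (by fun_prop)
  unfold closedLoop
  exact h.mul continuousAt_const

lemma continuousAt_riccatiMap (hR : R.PosDef) (hP : P.PosSemidef) :
    ContinuousAt (fun P => riccatiMap A R Q P) P := by
  have := continuousAt_closedLoop (A := A) hR hP
  unfold riccatiMap
  exact continuousAt_const.add ((continuousAt_const.mul continuousAt_id).mul this)

/-- A sequence of symmetric matrices converges if its quadratic forms converge pointwise. -/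
lemma exists_tendsto_of_qf {u : ℕ → Matrix (Fin n) (Fin n) ℝ} (hu : ∀ k, (u k).IsSymm)
    (h : ∀ x, ∃ l, Tendsto (fun k => qf (u k) x) atTop (𝓝 l)) : ∃ M, Tendsto u atTop (𝓝 M) := by
  choose l hl using h
  refine ⟨Matrix.of fun i j => (l (Pi.single i 1 + Pi.single j 1) - l (Pi.single i 1)
    - l (Pi.single j 1)) / 2, tendsto_pi_nhds.2 fun i => tendsto_pi_nhds.2 fun j => ?_⟩
  have : (fun k => u k i j) = fun k => (qf (u k) (Pi.single i 1 + Pi.single j 1)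
      - qf (u k) (Pi.single i 1) - qf (u k) (Pi.single j 1)) / 2 :=
    funext fun k => entry_eq_qf (hu k) i j
  rw [this]
  exact (((hl _).sub (hl _)).sub (hl _)).div_const 2

/-- The value iteration is monotone and bounded, so it converges to a fixed point of the Riccati
map. -/
lemma exists_fixed_point (hR : R.PosDef) (hQ : Q.PosSemidef) :
    ∃ P : Matrix (Fin n) (Fin n) ℝ, P.PosSemidef ∧ riccatiMap A R Q P = P ∧
      Tendsto (valueIter A R Q) atTop (𝓝 P) := by
  obtain ⟨P, hP⟩ := exists_tendsto_of_qf
    (fun N => (posSemidef_valueIter (A := A) hR hQ N).symm') fun x =>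
    ⟨_, tendsto_atTop_ciSup (monotone_nat_of_le_succ fun N => valueIter_le_succ hR hQ N x)
      ⟨qf (deadbeat A R Q) x, by
        rintro _ ⟨N, rfl⟩; exact valueIter_le_deadbeat hR hQ N x⟩⟩
  have hPs : P.PosSemidef := isClosed_posSemidef.mem_of_tendsto hP
    (Eventually.of_forall fun N => posSemidef_valueIter hR hQ N)
  refine ⟨P, hPs, ?_, hP⟩
  have h1 : Tendsto (fun N => valueIter A R Q (N + 1)) atTop (𝓝 (riccatiMap A R Q P)) := by
    simp_rw [valueIter_succ]
    exact (continuousAt_riccatiMap hR hPs).tendsto.comp hP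
  exact tendsto_nhds_unique h1 ((tendsto_add_atTop_iff_nat 1).2 hP)

lemma valueIter_le_fixed_point (hR : R.PosDef) (hQ : Q.PosSemidef) (hP : P.PosSemidef)
    (hfix : riccatiMap A R Q P = P) (N : ℕ) (x : Fin n → ℝ) :
    qf (valueIter A R Q N) x ≤ qf P x := by
  induction N generalizing x with
  | zero => simpa [valueIter] using qf_nonneg hP x
  | succ N ih =>
    rw [valueIter_succ, ← hfix]
    exact riccatiMap_mono hR (posSemidef_valueIter hR hQ N) hP ih Q x

lemma posDef_fixed_point (hR : R.PosDef) (hQ : Q.PosDef) (hP : P.PosSemidef)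
    (hfix : riccatiMap A R Q P = P) : P.PosDef := by
  refine posDef_iff_qf.2 ⟨hP.symm', fun x hx => ?_⟩
  rw [← hfix]
  exact (qf_pos hQ hx).trans_le (qf_le_riccatiMap hR hP Q x)

/-- Geometric convergence of the value iteration: `c` bounds the cost of the deadbeat control
relative to the one-step cost. -/
lemma fixed_point_sub_valueIter_le (hR : R.PosDef) (hQ : Q.PosSemidef) (hP : P.PosSemidef)
    (hfix : riccatiMap A R Q P = P) {c : ℝ} (hc : 1 ≤ c)
    (hdb : ∀ x, qf (deadbeat A R Q) x ≤ c * qf Q x) (N : ℕ) (x : Fin n → ℝ) :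
    qf P x - qf (valueIter A R Q (N + 1)) x ≤
      c * (1 - 1 / c) ^ (N + 1) * qf (valueIter A R Q (N + 1)) x := by
  have hc0 : 0 < c := by linarith
  have hr : 0 ≤ 1 - 1 / c := by
    rw [sub_nonneg, div_le_one hc0]; exact hc
  induction N generalizing x with
  | zero =>
    have h1 : valueIter A R Q (0 + 1) = Q := by
      simp [valueIter, riccatiMap]
    have h2 : qf P x ≤ c * qf Q x := by
      rw [← hfix]; exact (riccatiMap_le_deadbeat hR hP Q x).trans (hdb x)
    rw [h1]
    have : c * (1 - 1 / c) ^ (0 + 1) = c - 1 := by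
      rw [zero_add, pow_one]; field_simp
    rw [this]; linarith
  | succ N ih =>
    rw [valueIter_succ (N + 1)]
    set Z := valueIter A R Q (N + 1) with hZ
    have hZp : Z.PosSemidef := posSemidef_valueIter hR hQ _
    have h1 := riccatiMap_sub_le (A := A) hR hP hZp Q x
    rw [hfix] at h1
    have h2 := ih (closedLoop A R Z *ᵥ x)
    have h3 := riccatiMap_eq (A := A) hR hZp Q x
    have h4 := qf_nonneg hR.posSemidef (closedLoop A R Z *ᵥ x - A *ᵥ x)
    have h5 : qf (riccatiMap A R Q Z) x ≤ c * qf Q x :=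
      (riccatiMap_le_deadbeat hR hZp Q x).trans (hdb x)
    have h6 : qf Z (closedLoop A R Z *ᵥ x) ≤ (1 - 1 / c) * qf (riccatiMap A R Q Z) x := by
      have : qf (riccatiMap A R Q Z) x / c ≤ qf Q x := by
        rw [div_le_iff₀ hc0]; linarith
      have e : (1 - 1 / c) * qf (riccatiMap A R Q Z) x =
        qf (riccatiMap A R Q Z) x - qf (riccatiMap A R Q Z) x / c := by ring
      rw [e]; linarith
    calc _ ≤ c * (1 - 1 / c) ^ (N + 1) * qf Z (closedLoop A R Z *ᵥ x) := h1.trans h2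
      _ ≤ c * (1 - 1 / c) ^ (N + 1) * ((1 - 1 / c) * qf (riccatiMap A R Q Z) x) :=
          mul_le_mul_of_nonneg_left h6 (by positivity)
      _ = _ := by ring

/-- The closed loop of a finite horizon is almost optimal for the infinite horizon. -/
lemma qf_closedLoop_sub_le (hR : R.PosDef) (hQ : Q.PosSemidef) (hP : P.PosSemidef)
    (hfix : riccatiMap A R Q P = P) {c : ℝ} (hc : 1 ≤ c)
    (hdb : ∀ x, qf (deadbeat A R Q) x ≤ c * qf Q x) (N : ℕ) (x : Fin n → ℝ) :
    qf R ((closedLoop A R (valueIter A R Q (N + 1)) - closedLoop A R P) *ᵥ x) ≤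
      c * (1 - 1 / c) ^ (N + 1) * qf (deadbeat A R Q) x := by
  have hc0 : 0 < c := by linarith
  have hr : 0 ≤ 1 - 1 / c := by
    rw [sub_nonneg, div_le_one hc0]; exact hc
  set Z := valueIter A R Q (N + 1) with hZ
  have hZp : Z.PosSemidef := posSemidef_valueIter hR hQ _
  set y := closedLoop A R Z *ᵥ x with hy
  have h1 := completion_of_squares (A := A) hR hP Q x y
  have h2 := riccatiMap_eq (A := A) hR hZp Q x
  have h3 := fixed_point_sub_valueIter_le hR hQ hP hfix hc hdb N y
  have h4 := valueIter_le_fixed_point hR hQ hP hfix (N + 1 + 1) x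
  rw [valueIter_succ (N + 1)] at h4
  have h5 := riccatiMap_le_deadbeat (A := A) hR hZp Q x
  have h6 : qf Z y ≤ qf (riccatiMap A R Q Z) x := by
    have := qf_nonneg hR.posSemidef (y - A *ᵥ x)
    have := qf_nonneg hQ x
    linarith
  have h7 := qf_nonneg hP (y - closedLoop A R P *ᵥ x)
  have h8 : c * (1 - 1 / c) ^ (N + 1) * qf Z y ≤
      c * (1 - 1 / c) ^ (N + 1) * qf (deadbeat A R Q) x :=
    mul_le_mul_of_nonneg_left (h6.trans h5) (by positivity)
  rw [hfix, qf_add] at h1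
  rw [sub_mulVec]
  rw [← hZ] at h3 h4
  linarith

end Riccati

/-! ### Stable matrices -/

section Stability

variable {n : ℕ} {T : Matrix (Fin n) (Fin n) ℝ}

/-- The complexification of a real matrix. -/
def cplx (T : Matrix (Fin n) (Fin n) ℝ) : Matrix (Fin n) (Fin n) ℂ := T.map (algebraMap ℝ ℂ)

lemma cplx_pow (T : Matrix (Fin n) (Fin n) ℝ) (k : ℕ) : cplx (T ^ k) = cplx T ^ k :=
  map_pow (algebraMap ℝ ℂ).mapMatrix T k

lemma mem_spectrum_iff_det {z : ℂ} :
    z ∈ spectrum ℂ (cplx T) ↔ (scalar (Fin n) z - cplx T).det = 0 := by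
  rw [spectrum.mem_iff, isUnit_iff_isUnit_det, isUnit_iff_ne_zero, not_not]
  rfl

lemma mem_spectrum_iff_exists {z : ℂ} :
    z ∈ spectrum ℂ (cplx T) ↔ ∃ v : Fin n → ℂ, v ≠ 0 ∧ cplx T *ᵥ v = z • v := by
  rw [mem_spectrum_iff_det, ← exists_mulVec_eq_zero_iff]
  refine exists_congr fun v => and_congr_right fun _ => ?_
  rw [sub_mulVec, sub_eq_zero, eq_comm]
  simp [scalar_apply]

lemma mem_stableSet_of_forall (h : ∀ z ∈ spectrum ℂ (cplx T), ‖z‖ < 1) : T ∈ stableSet n := by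
  let _ : NormedRing (Matrix (Fin n) (Fin n) ℂ) := Matrix.linftyOpNormedRing
  let _ : NormedAlgebra ℂ (Matrix (Fin n) (Fin n) ℂ) := Matrix.linftyOpNormedAlgebra
  change spectralRadius ℂ (cplx T) < 1
  by_cases hne : (spectrum ℂ (cplx T)).Nonempty
  · have := spectrum.spectralRadius_lt_of_forall_lt_of_nonempty hne (r := 1) fun z hz => by
      have := h z hz
      exact_mod_cast this
    simpa using this
  · rw [Set.not_nonempty_iff_eq_empty] at hne
    simp [spectralRadius, hne]

lemma norm_lt_one_of_mem_stableSet (h : T ∈ stableSet n) {z : ℂ}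
    (hz : z ∈ spectrum ℂ (cplx T)) : ‖z‖ < 1 := by
  have h1 : (‖z‖₊ : ℝ≥0∞) ≤ spectralRadius ℂ (cplx T) :=
    le_iSup₂ (f := fun (k : ℂ) (_ : k ∈ spectrum ℂ (cplx T)) => (‖k‖₊ : ℝ≥0∞)) z hz
  have h2 : (‖z‖₊ : ℝ≥0∞) < 1 := h1.trans_lt h
  exact_mod_cast h2

/-- An eigenvector of a real matrix for a complex eigenvalue, split into real and imaginary
part. -/
lemma exists_real_eigenpair {z : ℂ} (hz : z ∈ spectrum ℂ (cplx T)) :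
    ∃ a b : Fin n → ℝ, (a ≠ 0 ∨ b ≠ 0) ∧ T *ᵥ a = z.re • a - z.im • b ∧
      T *ᵥ b = z.im • a + z.re • b := by
  obtain ⟨v, hv, hTv⟩ := mem_spectrum_iff_exists.1 hz
  refine ⟨fun i => (v i).re, fun i => (v i).im, ?_, ?_, ?_⟩
  · by_contra! h0
    refine hv (funext fun i => Complex.ext ?_ ?_)
    · exact congrFun h0.1 i
    · exact congrFun h0.2 i
  · funext i
    have := congrArg Complex.re (congrFun hTv i)
    simpa [cplx, mulVec, dotProduct] using this
  · funext i
    have := congrArg Complex.im (congrFun hTv i)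
    simp [cplx, mulVec, dotProduct] at this
    simp [mulVec, dotProduct, this]; ring

lemma mem_spectrum_of_real_eigenpair {z : ℂ} {a b : Fin n → ℝ} (h0 : a ≠ 0 ∨ b ≠ 0)
    (ha : T *ᵥ a = z.re • a - z.im • b) (hb : T *ᵥ b = z.im • a + z.re • b) :
    z ∈ spectrum ℂ (cplx T) := by
  refine mem_spectrum_iff_exists.2 ⟨fun i => ⟨a i, b i⟩, ?_, ?_⟩
  · intro h
    rcases h0 with h0 | h0
    · exact h0 (funext fun i => congrArg Complex.re (congrFun h i))
    · exact h0 (funext fun i => congrArg Complex.im (congrFun h i))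
  · funext i
    have h1 := congrFun ha i
    have h2 := congrFun hb i
    simp only [mulVec, dotProduct, Pi.add_apply, Pi.sub_apply, Pi.smul_apply, smul_eq_mul]
      at h1 h2
    apply Complex.ext
    · simp [cplx, mulVec, dotProduct, h1]
    · simp [cplx, mulVec, dotProduct, h2]; ring

/-- On the real and imaginary part of an eigenvector, a matrix acts on quadratic forms by the
squared modulus of the eigenvalue. -/
lemma qf_eigenpair {M : Matrix (Fin n) (Fin n) ℝ} (hM : M.IsSymm) (s t : ℝ)
    (a b : Fin n → ℝ) :
    qf M (s • a - t • b) + qf M (t • a + s • b) = (s ^ 2 + t ^ 2) * (qf M a + qf M b) := by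
  rw [qf_sub_vec hM, qf_add_vec hM]
  simp only [qf_smul_vec, mulVec_smul, dotProduct_smul, smul_dotProduct, smul_eq_mul]
  ring

lemma sq_re_add_sq_im (z : ℂ) : z.re ^ 2 + z.im ^ 2 = ‖z‖ ^ 2 := by
  rw [← Complex.normSq_eq_norm_sq, Complex.normSq_apply]; ring

/-- Lyapunov's criterion. -/
lemma mem_stableSet_of_lyapunov {P Q : Matrix (Fin n) (Fin n) ℝ} (hP : P.PosSemidef)
    (hQ : Q.PosDef) (h : ∀ x, qf P (T *ᵥ x) + qf Q x ≤ qf P x) : T ∈ stableSet n := by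
  refine mem_stableSet_of_forall fun z hz => ?_
  obtain ⟨a, b, hab, ha, hb⟩ := exists_real_eigenpair hz
  have h1 := h a
  have h2 := h b
  rw [ha] at h1
  rw [hb] at h2
  have h3 := qf_eigenpair hP.symm' z.re z.im a b
  rw [sq_re_add_sq_im] at h3
  have hQa := qf_nonneg hQ.posSemidef a
  have hQb := qf_nonneg hQ.posSemidef b
  have h4 : 0 < qf Q a + qf Q b := by
    rcases hab with h0 | h0
    · linarith [qf_pos hQ h0]
    · linarith [qf_pos hQ h0]
  have h5 : 0 ≤ qf P a + qf P b := add_nonneg (qf_nonneg hP a) (qf_nonneg hP b)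
  by_contra! hz1
  have : 1 ≤ ‖z‖ ^ 2 := one_le_pow₀ hz1
  nlinarith

/-- Gelfand's formula: the powers of a stable matrix decay geometrically. -/
lemma exists_pow_entry_le (h : T ∈ stableSet n) :
    ∃ C r : ℝ, 0 ≤ r ∧ r < 1 ∧ ∀ (k : ℕ) (i j : Fin n), |(T ^ k) i j| ≤ C * r ^ k := by
  let _ : NormedRing (Matrix (Fin n) (Fin n) ℂ) := Matrix.linftyOpNormedRing
  let _ : NormedAlgebra ℂ (Matrix (Fin n) (Fin n) ℂ) := Matrix.linftyOpNormedAlgebra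
  have norm_entry_le : ∀ (M : Matrix (Fin n) (Fin n) ℂ) (i j : Fin n), ‖M i j‖ ≤ ‖M‖ := by
    intro M i j
    rw [linfty_opNorm_def]
    have h1 : ‖M i j‖₊ ≤ ∑ j, ‖M i j‖₊ :=
      Finset.single_le_sum (f := fun j => ‖M i j‖₊) (fun _ _ => zero_le) (Finset.mem_univ j)
    have h2 : ∑ j, ‖M i j‖₊ ≤ Finset.univ.sup fun i => ∑ j, ‖M i j‖₊ :=
      Finset.le_sup (f := fun i => ∑ j, ‖M i j‖₊) (Finset.mem_univ i)
    exact_mod_cast h1.trans h2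
  obtain ⟨r, hr1, hr2⟩ := ENNReal.lt_iff_exists_nnreal_btwn.1
    (show spectralRadius ℂ (cplx T) < 1 from h)
  have hr0 : 0 < r := by
    have : (0 : ℝ≥0∞) < r := (zero_le).trans_lt hr1
    exact_mod_cast this
  have h1 := (spectrum.pow_nnnorm_pow_one_div_tendsto_nhds_spectralRadius
    (cplx T)).eventually_lt_const
    hr1
  have h2 : (fun k => ‖cplx T ^ k‖) =O[atTop] fun k => (r : ℝ) ^ k := by
    refine Asymptotics.IsBigO.of_bound 1 ?_
    filter_upwards [h1, eventually_gt_atTop 0] with k hk hk0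
    have hk0' : (0 : ℝ) < k := by exact_mod_cast hk0
    have h3 : ((‖cplx T ^ k‖₊ : ℝ≥0∞) ^ (1 / k : ℝ)) ^ (k : ℝ) ≤ (r : ℝ≥0∞) ^ (k : ℝ) :=
      ENNReal.rpow_le_rpow hk.le hk0'.le
    rw [← ENNReal.rpow_mul, one_div_mul_cancel hk0'.ne', ENNReal.rpow_one,
      ENNReal.rpow_natCast] at h3
    have h4 : ‖cplx T ^ k‖₊ ≤ r ^ k := by exact_mod_cast h3
    have h5 : ‖cplx T ^ k‖ ≤ (r : ℝ) ^ k := by exact_mod_cast h4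
    simpa using h5
  obtain ⟨C, hC⟩ := (Asymptotics.isBigO_nat_atTop_iff fun k hk =>
    absurd hk (pow_ne_zero k (by exact_mod_cast hr0.ne'))).1 h2
  refine ⟨C, r, r.2, by exact_mod_cast hr2, fun k i j => ?_⟩
  have h6 := hC k
  have h7 := norm_entry_le (cplx T ^ k) i j
  rw [← cplx_pow] at h7 h6
  simp only [norm_norm, norm_pow] at h6
  have h8 : ‖cplx (T ^ k) i j‖ = |(T ^ k) i j| := by simp [cplx]
  rw [h8] at h7
  simpa using h7.trans h6

lemma exists_norm_pow_mulVec_le (h : T ∈ stableSet n) :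
    ∃ C r : ℝ, 0 ≤ C ∧ 0 ≤ r ∧ r < 1 ∧
      ∀ (k : ℕ) (x : Fin n → ℝ), ‖(T ^ k) *ᵥ x‖ ≤ C * r ^ k * ‖x‖ := by
  obtain ⟨C, r, hr0, hr1, hb⟩ := exists_pow_entry_le h
  refine ⟨n * |C|, r, by positivity, hr0, hr1, fun k x => ?_⟩
  refine (pi_norm_le_iff_of_nonneg (by positivity)).2 fun i => ?_
  calc ‖((T ^ k) *ᵥ x) i‖ ≤ ∑ j, ‖(T ^ k) i j * x j‖ :=
        norm_sum_le Finset.univ fun j => (T ^ k) i j * x j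
    _ ≤ ∑ _j : Fin n, |C| * r ^ k * ‖x‖ := by
        refine Finset.sum_le_sum fun j _ => ?_
        rw [norm_mul]
        refine mul_le_mul ((hb k i j).trans ?_) (norm_le_pi_norm x j) (norm_nonneg _)
          (by positivity)
        exact mul_le_mul_of_nonneg_right (le_abs_self C) (by positivity)
    _ = n * |C| * r ^ k * ‖x‖ := by simp; ring

lemma tendsto_pow_zero (h : T ∈ stableSet n) : Tendsto (fun k => T ^ k) atTop (𝓝 0) := by
  obtain ⟨C, r, hr0, hr1, hb⟩ := exists_pow_entry_le h
  refine tendsto_pi_nhds.2 fun i => tendsto_pi_nhds.2 fun j => ?_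
  refine squeeze_zero_norm (fun k => ?_)
    (by simpa using (tendsto_pow_atTop_nhds_zero_of_lt_one hr0 hr1).const_mul C)
  simpa using hb k i j

lemma tendsto_pow_mulVec_zero (h : T ∈ stableSet n) (x : Fin n → ℝ) :
    Tendsto (fun k => (T ^ k) *ᵥ x) atTop (𝓝 0) := by
  have hc : Continuous fun M : Matrix (Fin n) (Fin n) ℝ => M *ᵥ x := by fun_prop
  simpa [Function.comp_def] using (hc.tendsto 0).comp (tendsto_pow_zero h)

lemma continuous_qf_vec (M : Matrix (Fin n) (Fin n) ℝ) : Continuous (qf M) := by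
  unfold qf; fun_prop

/-- A positive definite form dominates every other form, by compactness of the unit sphere. -/
lemma exists_qf_le {Q : Matrix (Fin n) (Fin n) ℝ} (hQ : Q.PosDef)
    (M : Matrix (Fin n) (Fin n) ℝ) : ∃ C : ℝ, ∀ x, qf M x ≤ C * qf Q x := by
  have hne : ∀ x ∈ Metric.sphere (0 : Fin n → ℝ) 1, x ≠ 0 := fun x hx h0 => by
    simp [h0] at hx
  have hcont : ContinuousOn (fun x => qf M x / qf Q x) (Metric.sphere (0 : Fin n → ℝ) 1) :=
    (continuous_qf_vec M).continuousOn.div (continuous_qf_vec Q).continuousOn fun x hx =>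
      (qf_pos hQ (hne x hx)).ne'
  obtain ⟨C, hC⟩ := (isCompact_sphere (0 : Fin n → ℝ) 1).bddAbove_image hcont
  refine ⟨C, fun x => ?_⟩
  by_cases hx : x = 0
  · simp [hx]
  have hx' : 0 < ‖x‖ := norm_pos_iff.2 hx
  have hs : ‖x‖⁻¹ • x ∈ Metric.sphere (0 : Fin n → ℝ) 1 := by
    simp [norm_smul, hx'.ne']
  have h1 : qf M (‖x‖⁻¹ • x) / qf Q (‖x‖⁻¹ • x) ≤ C := hC ⟨_, hs, rfl⟩
  rw [div_le_iff₀ (qf_pos hQ (hne _ hs)), qf_smul_vec, qf_smul_vec] at h1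
  have h2 : 0 < (‖x‖⁻¹) ^ 2 := by positivity
  nlinarith

lemma qf_nonneg_of_tendsto {M : Matrix (Fin n) (Fin n) ℝ}
    (h0 : ∀ x, Tendsto (fun k => (T ^ k) *ᵥ x) atTop (𝓝 0))
    (h : ∀ x, qf M (T *ᵥ x) ≤ qf M x) (x : Fin n → ℝ) : 0 ≤ qf M x := by
  have h1 : ∀ k : ℕ, qf M ((T ^ k) *ᵥ x) ≤ qf M x := by
    intro k
    induction k with
    | zero => simp
    | succ k ih =>
      rw [pow_succ', ← mulVec_mulVec]
      exact (h _).trans ih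
  have h2 : Tendsto (fun k => qf M ((T ^ k) *ᵥ x)) atTop (𝓝 0) := by
    simpa [Function.comp_def] using ((continuous_qf_vec M).tendsto 0).comp (h0 x)
  exact le_of_tendsto h2 (Eventually.of_forall h1)

/-- Comparison principle for the Lyapunov equation. -/
lemma qf_nonneg_of_lyapunov {M : Matrix (Fin n) (Fin n) ℝ} (hT : T ∈ stableSet n)
    (h : ∀ x, qf M (T *ᵥ x) ≤ qf M x) (x : Fin n → ℝ) : 0 ≤ qf M x :=
  qf_nonneg_of_tendsto (tendsto_pow_mulVec_zero hT) h x

/-- The Lyapunov equation of a stable matrix is solvable. -/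
lemma exists_lyapunov_solution (hT : T ∈ stableSet n) (Q : Matrix (Fin n) (Fin n) ℝ) :
    ∃ X, X = Q + Tᵀ * X * T := by
  let φ : Matrix (Fin n) (Fin n) ℝ →ₗ[ℝ] Matrix (Fin n) (Fin n) ℝ :=
    { toFun := fun X => X - Tᵀ * X * T
      map_add' := fun X Y => by simp only [Matrix.mul_add, Matrix.add_mul]; abel
      map_smul' := fun c X => by simp [smul_sub] }
  have hinj : Function.Injective φ := by
    rw [← LinearMap.ker_eq_bot, LinearMap.ker_eq_bot']
    intro X hX
    have h1 : X = Tᵀ * X * T := sub_eq_zero.1 hX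
    have h2 : ∀ k : ℕ, X = (T ^ k)ᵀ * X * T ^ k := by
      intro k
      induction k with
      | zero => simp
      | succ k ih =>
        have e : (T ^ (k + 1))ᵀ * X * T ^ (k + 1) = (T ^ k)ᵀ * (Tᵀ * X * T) * T ^ k := by
          rw [pow_succ', transpose_mul]; noncomm_ring
        rw [e, ← h1, ← ih]
    have h3 : Tendsto (fun k => (T ^ k)ᵀ * X * T ^ k) atTop (𝓝 0) := by
      have hc : Continuous fun M : Matrix (Fin n) (Fin n) ℝ => Mᵀ * X * M := by fun_prop
      simpa [Function.comp_def] using (hc.tendsto 0).comp (tendsto_pow_zero hT)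
    refine tendsto_nhds_unique ?_ h3
    simp_rw [← h2]
    exact tendsto_const_nhds
  obtain ⟨X, hX⟩ := LinearMap.surjective_of_injective hinj Q
  exact ⟨X, by rw [← hX]; simp [φ]⟩

lemma transpose_mem_stableSet (hT : T ∈ stableSet n) : Tᵀ ∈ stableSet n := by
  refine mem_stableSet_of_forall fun z hz => norm_lt_one_of_mem_stableSet hT ?_
  rw [mem_spectrum_iff_det] at hz ⊢
  rw [← det_transpose]
  convert hz using 2
  simp [cplx, transpose_map]

/-- A limit of stable matrices has no eigenvalue outside the closed unit disc, as
`|det (z - T)| ≥ (|z| - 1)ⁿ` for stable `T`. -/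
lemma norm_le_one_of_tendsto {u : ℕ → Matrix (Fin n) (Fin n) ℝ} (hu : ∀ k, u k ∈ stableSet n)
    (hT : Tendsto u atTop (𝓝 T)) {z : ℂ} (hz : z ∈ spectrum ℂ (cplx T)) : ‖z‖ ≤ 1 := by
  by_contra! h1
  have hc : Continuous fun M : Matrix (Fin n) (Fin n) ℝ => ‖(scalar (Fin n) z - cplx M).det‖ := by
    unfold cplx
    have : Continuous fun M : Matrix (Fin n) (Fin n) ℝ => M.map (algebraMap ℝ ℂ) :=
      Continuous.matrix_map continuous_id (Complex.continuous_ofReal)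
    exact (Continuous.matrix_det (continuous_const.sub this)).norm
  have h2 : ∀ M ∈ stableSet n, (‖z‖ - 1) ^ n ≤ ‖(scalar (Fin n) z - cplx M).det‖ := by
    intro M hM
    have hs := IsAlgClosed.splits (cplx M).charpoly
    have hm := charpoly_monic (cplx M)
    rw [← eval_charpoly, hs.eval_eq_prod_roots_of_monic hm]
    have hcard : (cplx M).charpoly.roots.card = n := by
      rw [← hs.natDegree_eq_card_roots, charpoly_natDegree_eq_dim, Fintype.card_fin]
    have hroots : ∀ w ∈ (cplx M).charpoly.roots, ‖z‖ - 1 ≤ ‖z - w‖ := by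
      intro w hw
      have hw' : w ∈ spectrum ℂ (cplx M) := by
        rw [mem_spectrum_iff_det, ← eval_charpoly]
        exact (Polynomial.mem_roots'.1 hw).2
      have := norm_lt_one_of_mem_stableSet hM hw'
      have := norm_sub_norm_le z w
      linarith
    suffices h : ∀ s : Multiset ℂ, (∀ w ∈ s, ‖z‖ - 1 ≤ ‖z - w‖) →
        (‖z‖ - 1) ^ s.card ≤ ‖(s.map fun w => z - w).prod‖ by
      have := h _ hroots
      rwa [hcard] at this
    intro s hroots
    induction s using Multiset.induction with
    | empty => simp
    | cons w s ih =>
      rw [Multiset.card_cons, pow_succ', Multiset.map_cons, Multiset.prod_cons, norm_mul]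
      refine mul_le_mul (hroots w (by simp)) (ih fun w hw => hroots w (by simp [hw])) ?_
        (norm_nonneg _)
      exact pow_nonneg (by linarith) _
  have h3 : (‖z‖ - 1) ^ n ≤ ‖(scalar (Fin n) z - cplx T).det‖ :=
    ge_of_tendsto ((hc.tendsto T).comp hT) (Eventually.of_forall fun k => h2 _ (hu k))
  rw [mem_spectrum_iff_det.1 hz, norm_zero] at h3
  exact absurd h3 (not_le.2 (pow_pos (by linarith) n))

end Stability

/-! ### Solutions of the Riccati equation -/

section RiccatiSolution

variable {n : ℕ} {A R Q P Sw : Matrix (Fin n) (Fin n) ℝ} {δ : ℝ}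

/-- The closed loop of a solution of the Riccati equation satisfies a Lyapunov equation. -/
lemma closedLoop_mem_stableSet (hR : R.PosDef) (hQ : Q.PosDef) (hP : P.PosSemidef)
    (hfix : riccatiMap A R Q P = P) : closedLoop A R P ∈ stableSet n := by
  refine mem_stableSet_of_lyapunov hP hQ fun x => ?_
  have h := riccatiMap_eq (A := A) hR hP Q x
  rw [hfix] at h
  linarith [qf_nonneg hR.posSemidef (closedLoop A R P *ᵥ x - A *ᵥ x)]

/-- Comparison of solutions for different state costs. -/
lemma fixed_point_mono {Q' P' : Matrix (Fin n) (Fin n) ℝ} (hR : R.PosDef)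
    (hP : P.PosSemidef) (hP' : P'.PosSemidef) (hfix : riccatiMap A R Q P = P)
    (hfix' : riccatiMap A R Q' P' = P') (hQQ : ∀ x, qf Q x ≤ qf Q' x)
    (hs : closedLoop A R P' ∈ stableSet n) (x : Fin n → ℝ) : qf P x ≤ qf P' x := by
  have h := qf_nonneg_of_lyapunov (M := P' - P) hs (fun y => ?_) x
  · rw [qf_sub] at h; linarith
  · rw [qf_sub, qf_sub]
    have h1 := riccatiMap_eq (A := A) hR hP' Q' y
    have h2 := riccatiMap_le (A := A) hR hP Q y (closedLoop A R P' *ᵥ y)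
    rw [hfix'] at h1
    rw [hfix] at h2
    linarith [hQQ y]

lemma fixed_point_unique {P' : Matrix (Fin n) (Fin n) ℝ} (hR : R.PosDef) (hQ : Q.PosDef)
    (hP : P.PosSemidef) (hP' : P'.PosSemidef) (hfix : riccatiMap A R Q P = P)
    (hfix' : riccatiMap A R Q P' = P') : P = P' :=
  eq_of_qf_eq hP.symm' hP'.symm' fun x => le_antisymm
    (fixed_point_mono hR hP hP' hfix hfix' (fun _ => le_rfl)
      (closedLoop_mem_stableSet hR hQ hP' hfix') x)
    (fixed_point_mono hR hP' hP hfix' hfix (fun _ => le_rfl)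
      (closedLoop_mem_stableSet hR hQ hP hfix) x)

lemma posDef_smul (hSw : Sw.PosDef) (hδ : 0 < δ) : (δ • Sw).PosDef := hSw.smul hδ

lemma posDef_weight (hSw : Sw.PosDef) (hδ : 0 < δ) : ((2 * δ) • Sw)⁻¹.PosDef :=
  (posDef_smul hSw (by linarith)).inv

/-- `(1 + G P)⁻¹ A` is the closed loop for the input weight `G⁻¹`. -/
lemma inv_one_add_mul_eq_closedLoop {G : Matrix (Fin n) (Fin n) ℝ} (hG : G.PosDef)
    (P A : Matrix (Fin n) (Fin n) ℝ) :
    (1 + G * P)⁻¹ * A = closedLoop A G⁻¹ P := by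
  have h1 : 1 + G * P = G * (G⁻¹ + P) := by
    rw [Matrix.mul_add, mul_nonsing_inv _ (isUnit_det_of_posDef hG)]
  rw [h1, Matrix.mul_inv_rev, closedLoop, Matrix.mul_assoc]

lemma thetaForm_eq_closedLoop (hSw : Sw.PosDef) (hδ : 0 < δ)
    (P A : Matrix (Fin n) (Fin n) ℝ) :
    (1 + (2 * δ) • (Sw * P))⁻¹ * A = closedLoop A ((2 * δ) • Sw)⁻¹ P := by
  rw [← inv_one_add_mul_eq_closedLoop (posDef_smul hSw (by linarith)) P, smul_mul]

lemma isRiccatiSolution_iff (hSw : Sw.PosDef) (hQ : Q.PosDef) (hδ : 0 < δ) :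
    IsRiccatiSolution Sw Q A δ P ↔
      P.PosSemidef ∧ riccatiMap A ((2 * δ) • Sw)⁻¹ Q P = P := by
  have e : Q + A.transpose * P * (1 + (2 * δ) • (Sw * P))⁻¹ * A =
      riccatiMap A ((2 * δ) • Sw)⁻¹ Q P := by
    rw [Matrix.mul_assoc _ _ A, thetaForm_eq_closedLoop hSw hδ P]; rfl
  constructor
  · rintro ⟨hP, h⟩
    rw [e] at h
    exact ⟨hP.posSemidef, h.symm⟩
  · rintro ⟨hP, h⟩
    refine ⟨posDef_fixed_point (posDef_weight hSw hδ) hQ hP h, ?_⟩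
    rw [e, h]

lemma existsUnique_riccatiSolution (hSw : Sw.PosDef) (hQ : Q.PosDef) (hδ : 0 < δ)
    (A : Matrix (Fin n) (Fin n) ℝ) : ∃! P, IsRiccatiSolution Sw Q A δ P := by
  have hR := posDef_weight hSw hδ
  obtain ⟨P, hP, hfix, -⟩ := exists_fixed_point (A := A) hR hQ.posSemidef
  refine ⟨P, (isRiccatiSolution_iff hSw hQ hδ).2 ⟨hP, hfix⟩, fun P' hP' => ?_⟩
  obtain ⟨h1, h2⟩ := (isRiccatiSolution_iff hSw hQ hδ).1 hP'
  exact fixed_point_unique hR hQ h1 hP h2 hfix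

lemma riccatiSolution_spec (hSw : Sw.PosDef) (hQ : Q.PosDef) (hδ : 0 < δ)
    (A : Matrix (Fin n) (Fin n) ℝ) :
    (riccatiSolution Sw Q A δ).PosSemidef ∧
      riccatiMap A ((2 * δ) • Sw)⁻¹ Q (riccatiSolution Sw Q A δ) = riccatiSolution Sw Q A δ := by
  have h := (existsUnique_riccatiSolution hSw hQ hδ A).exists
  rw [riccatiSolution, dif_pos h]
  exact (isRiccatiSolution_iff hSw hQ hδ).1 h.choose_spec

lemma thetaStar_eq (hSw : Sw.PosDef) (hδ : 0 < δ)
    (Q A : Matrix (Fin n) (Fin n) ℝ) :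
    thetaStar Sw Q A δ = closedLoop A ((2 * δ) • Sw)⁻¹ (riccatiSolution Sw Q A δ) :=
  thetaForm_eq_closedLoop hSw hδ _ A

lemma thetaStar_mem_stableSet (hSw : Sw.PosDef) (hQ : Q.PosDef) (hδ : 0 < δ)
    (A : Matrix (Fin n) (Fin n) ℝ) : thetaStar Sw Q A δ ∈ stableSet n := by
  obtain ⟨hP, hfix⟩ := riccatiSolution_spec hSw hQ hδ A
  rw [thetaStar_eq hSw hδ]
  exact closedLoop_mem_stableSet (posDef_weight hSw hδ) hQ hP hfix

/-! ### The linear quadratic regulator -/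

/-- The cost of a single time step. -/
def stageCost (Q R : Matrix (Fin n) (Fin n) ℝ) (x u : Fin n → ℝ) : ℝ := qf Q x + qf R u

lemma lqrCost_one_eq (A Q R : Matrix (Fin n) (Fin n) ℝ) (x₀ : Fin n → ℝ) (u : ℕ → Fin n → ℝ) :
    lqrCost A (1 : Matrix (Fin n) (Fin n) ℝ) Q R x₀ u =
      ∑' t, ENNReal.ofReal (stageCost Q R (trajectory A 1 x₀ u t) (u t)) := rfl

lemma stageCost_nonneg (hQ : Q.PosSemidef) (hR : R.PosSemidef) (x u : Fin n → ℝ) :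
    0 ≤ stageCost Q R x u := add_nonneg (qf_nonneg hQ x) (qf_nonneg hR u)

lemma stageCost_eq (hR : R.PosDef) (hP : P.PosSemidef)
    (hfix : riccatiMap A R Q P = P) (x₀ : Fin n → ℝ) (u : ℕ → Fin n → ℝ) (t : ℕ) :
    stageCost Q R (trajectory A 1 x₀ u t) (u t) =
      qf P (trajectory A 1 x₀ u t) - qf P (trajectory A 1 x₀ u (t + 1)) +
        qf (R + P) (u t - (closedLoop A R P - A) *ᵥ trajectory A 1 x₀ u t) := by
  have h := completion_of_squares (A := A) hR hP Q (trajectory A 1 x₀ u t)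
    (trajectory A 1 x₀ u (t + 1))
  have e1 : trajectory A 1 x₀ u (t + 1) - A *ᵥ trajectory A 1 x₀ u t = u t := by
    simp [trajectory]
  have e2 : trajectory A 1 x₀ u (t + 1) - closedLoop A R P *ᵥ trajectory A 1 x₀ u t =
      u t - (closedLoop A R P - A) *ᵥ trajectory A 1 x₀ u t := by
    simp only [trajectory, one_mulVec, sub_mulVec]; abel
  rw [e1, e2, hfix] at h
  unfold stageCost
  linarith

/-- The value `x₀ᵀ P x₀`, plus the penalty for a deviation at time zero, bounds the cost of every
input sequence from below. -/
lemma le_lqrCost (hR : R.PosDef) (hQ : Q.PosDef) (hP : P.PosSemidef)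
    (hfix : riccatiMap A R Q P = P) (x₀ : Fin n → ℝ) (u : ℕ → Fin n → ℝ) :
    ENNReal.ofReal (qf P x₀ + qf (R + P) (u 0 - (closedLoop A R P - A) *ᵥ x₀)) ≤
      lqrCost A 1 Q R x₀ u := by
  rw [lqrCost_one_eq]
  by_cases htop : ∑' t, ENNReal.ofReal (stageCost Q R (trajectory A 1 x₀ u t) (u t)) = ⊤
  · rw [htop]; exact le_top
  have hnn := fun t => stageCost_nonneg hQ.posSemidef hR.posSemidef
    (trajectory A 1 x₀ u t) (u t)
  have hsum := ENNReal.summable_toReal htop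
  simp only [ENNReal.toReal_ofReal (hnn _)] at hsum
  -- a finite cost forces the state to converge to zero
  have hx : Tendsto (fun t => qf Q (trajectory A 1 x₀ u t)) atTop (𝓝 0) := by
    refine squeeze_zero (fun t => qf_nonneg hQ.posSemidef _) (fun t => ?_)
      hsum.tendsto_atTop_zero
    unfold stageCost
    linarith [qf_nonneg hR.posSemidef (u t)]
  obtain ⟨C, hC⟩ := exists_qf_le hQ P
  have hPx : Tendsto (fun t => qf P (trajectory A 1 x₀ u (t + 1))) atTop (𝓝 0) := by
    refine squeeze_zero (fun t => qf_nonneg hP _) (fun t => hC _) ?_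
    simpa using ((tendsto_add_atTop_iff_nat 1).2 hx).const_mul C
  have hpart : ∀ N : ℕ, qf P x₀ - qf P (trajectory A 1 x₀ u (N + 1)) +
      qf (R + P) (u 0 - (closedLoop A R P - A) *ᵥ x₀) ≤
      ∑ t ∈ Finset.range (N + 1), stageCost Q R (trajectory A 1 x₀ u t) (u t) := by
    intro N
    induction N with
    | zero =>
      rw [zero_add, Finset.sum_range_one, stageCost_eq hR hP hfix]
      simp [trajectory]
    | succ N ih =>
      rw [Finset.sum_range_succ, stageCost_eq hR hP hfix x₀ u (N + 1)]
      have := qf_nonneg (hR.add_posSemidef hP).posSemidef (u (N + 1) -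
        (closedLoop A R P - A) *ᵥ trajectory A 1 x₀ u (N + 1))
      linarith
  rw [← ENNReal.ofReal_tsum_of_nonneg hnn hsum]
  refine ENNReal.ofReal_le_ofReal ?_
  have h1 : Tendsto (fun N => qf P x₀ - qf P (trajectory A 1 x₀ u (N + 1)) +
      qf (R + P) (u 0 - (closedLoop A R P - A) *ᵥ x₀)) atTop
      (𝓝 (qf P x₀ - 0 + qf (R + P) (u 0 - (closedLoop A R P - A) *ᵥ x₀))) :=
    (tendsto_const_nhds.sub hPx).add tendsto_const_nhds
  rw [sub_zero] at h1
  exact le_of_tendsto h1 (Eventually.of_forall fun N =>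
    (hpart N).trans (hsum.sum_le_tsum _ fun t _ => hnn t))

lemma trajectory_feedbackInput (A K : Matrix (Fin n) (Fin n) ℝ) (x₀ : Fin n → ℝ) (t : ℕ) :
    trajectory A 1 x₀ (feedbackInput A 1 K x₀) t = ((A + K) ^ t) *ᵥ x₀ := by
  induction t with
  | zero => simp [trajectory]
  | succ t ih =>
    rw [trajectory, ih, feedbackInput, Matrix.one_mul, one_mulVec, pow_succ', ← mulVec_mulVec,
      add_mulVec]

/-- The cost of the closed loop telescopes. -/
lemma lqrCost_closedLoop_le (hR : R.PosDef) (hQ : Q.PosDef) (hP : P.PosSemidef)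
    (hfix : riccatiMap A R Q P = P) (x₀ : Fin n → ℝ) :
    lqrCost A 1 Q R x₀ (feedbackInput A 1 (closedLoop A R P - A) x₀) ≤
      ENNReal.ofReal (qf P x₀) := by
  set u := feedbackInput A 1 (closedLoop A R P - A) x₀ with hu
  have hnn := fun t => stageCost_nonneg hQ.posSemidef hR.posSemidef
    (trajectory A 1 x₀ u t) (u t)
  rw [lqrCost_one_eq]
  refine ENNReal.tsum_le_of_sum_range_le fun N => ?_
  rw [← ENNReal.ofReal_sum_of_nonneg fun t _ => hnn t]
  refine ENNReal.ofReal_le_ofReal ?_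
  have : ∑ t ∈ Finset.range N, stageCost Q R (trajectory A 1 x₀ u t) (u t) =
      qf P x₀ - qf P (trajectory A 1 x₀ u N) := by
    induction N with
    | zero => simp [trajectory]
    | succ N ih =>
      rw [Finset.sum_range_succ, ih, stageCost_eq hR hP hfix]
      have : u N - (closedLoop A R P - A) *ᵥ trajectory A 1 x₀ u N = 0 := by
        rw [hu, trajectory_feedbackInput, feedbackInput, Matrix.one_mul, sub_self]
      rw [this, qf_zero_vec]; ring
  rw [this]
  linarith [qf_nonneg hP (trajectory A 1 x₀ u N)]

lemma isOptimalGain_iff (hR : R.PosDef) (hQ : Q.PosDef) (hP : P.PosSemidef)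
    (hfix : riccatiMap A R Q P = P) (K : Matrix (Fin n) (Fin n) ℝ) :
    IsOptimalGain A 1 Q R K ↔ K = closedLoop A R P - A := by
  constructor
  · intro hK
    have h : ∀ x₀, K *ᵥ x₀ = (closedLoop A R P - A) *ᵥ x₀ := by
      intro x₀
      have h1 := (le_lqrCost hR hQ hP hfix x₀ (feedbackInput A 1 K x₀)).trans
        ((hK x₀ _).trans (lqrCost_closedLoop_le hR hQ hP hfix x₀))
      rw [ENNReal.ofReal_le_ofReal_iff (qf_nonneg hP x₀)] at h1
      have h2 := eq_zero_of_qf_nonpos (hR.add_posSemidef hP)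
        (show qf (R + P) (feedbackInput A 1 K x₀ 0 - (closedLoop A R P - A) *ᵥ x₀) ≤ 0 by
          linarith)
      simpa [feedbackInput] using sub_eq_zero.1 h2
    exact Matrix.mulVec_injective (funext h)
  · rintro rfl x₀ u
    refine (lqrCost_closedLoop_le hR hQ hP hfix x₀).trans ?_
    refine le_trans (ENNReal.ofReal_le_ofReal ?_) (le_lqrCost hR hQ hP hfix x₀ u)
    linarith [qf_nonneg (hR.add_posSemidef hP).posSemidef
      (u 0 - (closedLoop A R P - A) *ᵥ x₀)]

lemma existsUnique_isOptimalGain (hSw : Sw.PosDef) (hQ : Q.PosDef) (hδ : 0 < δ)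
    (A : Matrix (Fin n) (Fin n) ℝ) :
    ∃! K, IsOptimalGain A (1 : Matrix (Fin n) (Fin n) ℝ) Q ((2 * δ) • Sw)⁻¹ K := by
  obtain ⟨hP, hfix⟩ := riccatiSolution_spec hSw hQ hδ A
  simp only [isOptimalGain_iff (posDef_weight hSw hδ) hQ hP hfix]
  exact ⟨_, rfl, fun _ h => h⟩

lemma dlqr_eq (hSw : Sw.PosDef) (hQ : Q.PosDef) (hδ : 0 < δ)
    (A : Matrix (Fin n) (Fin n) ℝ) :
    dlqr A (1 : Matrix (Fin n) (Fin n) ℝ) Q ((2 * δ) • Sw)⁻¹ = thetaStar Sw Q A δ - A := by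
  obtain ⟨hP, hfix⟩ := riccatiSolution_spec hSw hQ hδ A
  have h := (existsUnique_isOptimalGain hSw hQ hδ A).exists
  rw [dlqr, dif_pos h, thetaStar_eq hSw hδ]
  exact (isOptimalGain_iff (posDef_weight hSw hδ) hQ hP hfix _).1 h.choose_spec

end RiccatiSolution

/-! ### The stationary distribution -/

section Stationary

variable {n : ℕ} {T Sw : Matrix (Fin n) (Fin n) ℝ} {μ ν : Measure (Fin n → ℝ)}

lemma continuous_mulVec (T : Matrix (Fin n) (Fin n) ℝ) :
    Continuous fun x : Fin n → ℝ => T *ᵥ x := by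
  fun_prop

/-- Multiplication by a matrix as a continuous linear map. -/
def mulVecCLM (T : Matrix (Fin n) (Fin n) ℝ) : (Fin n → ℝ) →L[ℝ] (Fin n → ℝ) :=
  ⟨T.mulVecLin, continuous_mulVec T⟩

lemma mulVecCLM_apply (T : Matrix (Fin n) (Fin n) ℝ) (x : Fin n → ℝ) :
    mulVecCLM T x = T *ᵥ x := rfl

lemma charFunDual_of_isInvariantLaw [IsProbabilityMeasure μ] (h : IsInvariantLaw μ T ν)
    (L : StrongDual ℝ (Fin n → ℝ)) :
    charFunDual ν L = charFunDual ν (L.comp (mulVecCLM T)) * charFunDual μ L := by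
  have := h.1
  have hm : Measurable (mulVecCLM T) := (mulVecCLM T).continuous.measurable
  have h1 : ν = ((ν.map (mulVecCLM T)).prod μ).map (fun p => p.1 + p.2) := by
    conv_lhs => rw [← h.2]
    have e : μ = μ.map id := by simp
    conv_rhs => rw [e, Measure.map_prod_map _ _ hm measurable_id,
      Measure.map_map (by fun_prop) (by fun_prop)]
    rfl
  have := Measure.isProbabilityMeasure_map hm.aemeasurable (μ := ν)
  conv_lhs => rw [h1]
  rw [charFunDual_map_add_prod_eq_mul, Pi.mul_apply, charFunDual_map]

lemma tendsto_charFunDual_pow [IsProbabilityMeasure ν] (hT : T ∈ stableSet n)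
    (L : StrongDual ℝ (Fin n → ℝ)) :
    Tendsto (fun k : ℕ => charFunDual ν (L.comp (mulVecCLM (T ^ k)))) atTop (𝓝 1) := by
  have h1 : (1 : ℂ) = ∫ _x, (1 : ℂ) ∂ν := by simp
  rw [h1]
  simp only [charFunDual_apply]
  refine tendsto_integral_of_dominated_convergence (fun _ => (1 : ℝ)) (fun k => ?_)
    (integrable_const _) (fun k => Eventually.of_forall fun x => ?_)
    (Eventually.of_forall fun x => ?_)
  · exact (Continuous.aestronglyMeasurable (by fun_prop))
  · rw [Complex.norm_exp_ofReal_mul_I]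
  · have h2 : Tendsto (fun k : ℕ => L ((T ^ k) *ᵥ x)) atTop (𝓝 0) := by
      simpa [Function.comp_def] using (L.continuous.tendsto 0).comp (tendsto_pow_mulVec_zero hT x)
    have h3 : Continuous fun t : ℝ => Complex.exp (t * Complex.I) := by fun_prop
    simpa [Function.comp_def, mulVecCLM_apply] using (h3.tendsto 0).comp h2

lemma norm_charFunDual_le_one [IsProbabilityMeasure μ] (L : StrongDual ℝ (Fin n → ℝ)) :
    ‖charFunDual μ L‖ ≤ 1 := by
  rw [charFunDual_apply]
  refine (norm_integral_le_of_norm_le_const (C := 1) (ae_of_all _ fun x => ?_)).trans (by simp)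
  rw [Complex.norm_exp_ofReal_mul_I]

/-- The characteristic functions of two invariant laws satisfy the same functional equation, and
both are continuous at the origin. -/
lemma isInvariantLaw_unique {ν' : Measure (Fin n → ℝ)} [IsProbabilityMeasure μ]
    (hT : T ∈ stableSet n) (h : IsInvariantLaw μ T ν) (h' : IsInvariantLaw μ T ν') : ν = ν' := by
  have := h.1
  have := h'.1
  refine Measure.ext_of_charFunDual (funext fun L => ?_)
  have h1 : ∀ k : ℕ, ‖charFunDual ν L - charFunDual ν' L‖ ≤
      ‖charFunDual ν (L.comp (mulVecCLM (T ^ k))) -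
        charFunDual ν' (L.comp (mulVecCLM (T ^ k)))‖ := by
    intro k
    induction k with
    | zero =>
      have : L.comp (mulVecCLM (T ^ 0)) = L := by ext x; simp [mulVecCLM_apply]
      rw [this]
    | succ k ih =>
      refine ih.trans ?_
      have e : L.comp (mulVecCLM (T ^ (k + 1))) =
          (L.comp (mulVecCLM (T ^ k))).comp (mulVecCLM T) := by
        ext x; simp [mulVecCLM_apply, pow_succ]
      rw [charFunDual_of_isInvariantLaw h, charFunDual_of_isInvariantLaw h', ← sub_mul, norm_mul, e]
      exact mul_le_of_le_one_right (norm_nonneg _) (norm_charFunDual_le_one (μ := μ) _)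
  have h2 := ((tendsto_charFunDual_pow (ν := ν) hT L).sub
    (tendsto_charFunDual_pow (ν := ν') hT L)).norm
  rw [sub_self, norm_zero] at h2
  have h3 := ge_of_tendsto h2 (Eventually.of_forall h1)
  exact sub_eq_zero.1 (norm_le_zero_iff.1 h3)

/-- The left shift on noise sequences. -/
def shiftSeq {α : Type*} (ω : ℕ → α) : ℕ → α := fun k => ω (k + 1)

lemma measurable_shiftSeq {α : Type*} [MeasurableSpace α] : Measurable (shiftSeq (α := α)) :=
  measurable_pi_lambda _ fun k => measurable_pi_apply (k + 1)

/-- Splitting off the first term of an i.i.d. sequence. -/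
lemma measurePreserving_shift_eval (μ : Measure (Fin n → ℝ)) [IsProbabilityMeasure μ] :
    MeasurePreserving (fun ω : ℕ → Fin n → ℝ => (shiftSeq ω, ω 0))
      (Measure.infinitePi fun _ => μ) ((Measure.infinitePi fun _ => μ).prod μ) := by
  let c : (ℕ → Fin n → ℝ) × (Fin n → ℝ) → ℕ → Fin n → ℝ := fun p k => Nat.casesOn k p.2 p.1
  have hc : Measurable c := by
    refine measurable_pi_lambda _ fun k => ?_
    cases k with
    | zero => exact measurable_snd
    | succ k => exact (measurable_pi_apply k).comp measurable_fst
  have hs : Measurable (fun ω : ℕ → Fin n → ℝ => (shiftSeq ω, ω 0)) :=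
    measurable_shiftSeq.prodMk (measurable_pi_apply 0)
  have h1 : ((Measure.infinitePi fun _ : ℕ => μ).prod μ).map c =
      Measure.infinitePi fun _ => μ := by
    refine Measure.eq_infinitePi _ fun s t ht => ?_
    classical
    obtain ⟨N, hN⟩ : ∃ N, s ⊆ Finset.range (N + 1) := by
      obtain ⟨N, hN⟩ := s.exists_nat_subset_range
      exact ⟨N, hN.trans (Finset.range_subset_range.2 (Nat.le_succ N))⟩
    -- replacing the unconstrained coordinates below `N` by the whole space
    set t' : ℕ → Set (Fin n → ℝ) := fun i => if i ∈ s then t i else Set.univ with ht'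
    have hmt' : ∀ i, MeasurableSet (t' i) := fun i => by
      simp only [ht']; split_ifs
      exacts [ht i, MeasurableSet.univ]
    have e1 : Set.pi (s : Set ℕ) t = Set.pi (Finset.range (N + 1) : Set ℕ) t' := by
      ext ω
      simp only [Set.mem_pi, ht']
      constructor
      · intro h i _
        split_ifs with hi
        exacts [h i hi, trivial]
      · intro h i hi
        have := h i (hN hi)
        rwa [if_pos (by exact_mod_cast hi)] at this
    have e2 : ∏ i ∈ s, μ (t i) = ∏ i ∈ Finset.range (N + 1), μ (t' i) := by
      rw [← Finset.prod_subset hN (f := fun i => μ (t' i)) fun i _ hi => by simp [ht', hi]]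
      exact Finset.prod_congr rfl fun i hi => by simp [ht', hi]
    have e3 : c ⁻¹' Set.pi (Finset.range (N + 1) : Set ℕ) t' =
        Set.pi (Finset.range N : Set ℕ) (fun i => t' (i + 1)) ×ˢ t' 0 := by
      ext ⟨ω, w⟩
      simp only [Set.mem_preimage, Set.mem_pi, Finset.coe_range, Set.mem_Iio, Set.mem_prod]
      constructor
      · intro h
        exact ⟨fun i hi => h (i + 1) (by omega), h 0 (by omega)⟩
      · rintro ⟨h, h0⟩ i hi
        cases i with
        | zero => exact h0
        | succ i => exact h i (by omega)
    rw [e1, e2, Measure.map_apply hc (MeasurableSet.pi (Finset.countable_toSet _)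
      fun i _ => hmt' i), e3, Measure.prod_prod, Measure.infinitePi_pi _ fun i _ => hmt' (i + 1),
      Finset.prod_range_succ']
  refine ⟨hs, ?_⟩
  conv_lhs => rw [← h1, Measure.map_map hs hc]
  exact Measure.map_id

/-- The stationary state `∑ₖ Tᵏ wₖ` converges in `L²`; its law is invariant. -/
lemma exists_isInvariantLaw [IsProbabilityMeasure μ] (hT : T ∈ stableSet n)
    (hμ : MemLp (fun w : Fin n → ℝ => w) 2 μ) :
    ∃ ν, IsInvariantLaw μ T ν ∧ MemLp (fun x : Fin n → ℝ => x) 2 ν := by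
  obtain ⟨P, hP, hsplit, heval⟩ : ∃ P : Measure (ℕ → Fin n → ℝ), IsProbabilityMeasure P ∧
      MeasurePreserving (fun ω : ℕ → Fin n → ℝ => (shiftSeq ω, ω 0)) P (P.prod μ) ∧
      ∀ k, MeasurePreserving (fun ω : ℕ → Fin n → ℝ => ω k) P μ :=
    ⟨Measure.infinitePi fun _ : ℕ => μ, inferInstance, measurePreserving_shift_eval μ,
      fun k => measurePreserving_eval_infinitePi _ k⟩
  have hshift : MeasurePreserving shiftSeq P P := measurePreserving_fst.comp hsplit
  have hfk : ∀ k : ℕ, MemLp (fun ω : ℕ → Fin n → ℝ => (T ^ k) *ᵥ ω k) 2 P := fun k =>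
    (mulVecCLM (T ^ k)).comp_memLp' (hμ.comp_measurePreserving (heval k))
  let Y : ℕ → Lp (Fin n → ℝ) 2 P := fun k => (hfk k).toLp _
  obtain ⟨C, r, hC, hr0, hr1, hb⟩ := exists_norm_pow_mulVec_le hT
  have hsum : Summable Y := by
    have hgeom : Summable fun k : ℕ => C * r ^ k *
        (eLpNorm (fun w : Fin n → ℝ => w) 2 μ).toReal :=
      ((summable_geometric_of_lt_one hr0 hr1).mul_left C).mul_right _
    refine Summable.of_norm_bounded hgeom fun k => ?_
    have h0 : ‖Y k‖ = (eLpNorm (fun ω : ℕ → Fin n → ℝ => (T ^ k) *ᵥ ω k) 2 P).toReal :=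
      Lp.norm_toLp _ (hfk k)
    rw [h0]
    have hae : ∀ᵐ ω ∂P, ‖(T ^ k) *ᵥ ω k‖ ≤ C * r ^ k * ‖ω k‖ := ae_of_all _ fun ω => hb k (ω k)
    have h1 : eLpNorm (fun ω : ℕ → Fin n → ℝ => (T ^ k) *ᵥ ω k) 2 P ≤
        ENNReal.ofReal (C * r ^ k) * eLpNorm (fun ω : ℕ → Fin n → ℝ => ω k) 2 P :=
      eLpNorm_le_mul_eLpNorm_of_ae_le_mul hae 2
    have h2 := eLpNorm_comp_measurePreserving (p := 2) hμ.aestronglyMeasurable (heval k)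
    simp only [Function.comp_def] at h2
    rw [h2] at h1
    have h3 := ENNReal.toReal_mono (ENNReal.mul_ne_top ENNReal.ofReal_ne_top hμ.eLpNorm_ne_top) h1
    rwa [ENNReal.toReal_mul, ENNReal.toReal_ofReal (by positivity)] at h3
  let U : Lp (Fin n → ℝ) 2 P →L[ℝ] Lp (Fin n → ℝ) 2 P :=
    ((mulVecCLM T).compLpL 2 P).comp
      (Lp.compMeasurePreservingₗᵢ ℝ shiftSeq hshift).toContinuousLinearMap
  have hU : ∀ f : Lp (Fin n → ℝ) 2 P, U f =ᵐ[P] fun ω => T *ᵥ f (shiftSeq ω) := by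
    intro f
    have h1 := (mulVecCLM T).coeFn_compLpL (p := 2)
      (Lp.compMeasurePreserving shiftSeq hshift f)
    have h2 := Lp.coeFn_compMeasurePreserving f hshift
    filter_upwards [h1, h2] with ω h1 h2
    change ((mulVecCLM T).compLpL 2 P (Lp.compMeasurePreserving shiftSeq hshift f)) ω = _
    rw [h1, h2]; rfl
  have hUY : ∀ k, U (Y k) = Y (k + 1) := by
    intro k
    refine Lp.ext ?_
    filter_upwards [hU (Y k), (hfk (k + 1)).coeFn_toLp,
      hshift.quasiMeasurePreserving.ae_eq_comp (hfk k).coeFn_toLp] with ω h1 h2 h3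
    rw [h1, h2]
    have h3' : (Y k) (shiftSeq ω) = (T ^ k) *ᵥ (shiftSeq ω k) := h3
    rw [h3', mulVec_mulVec, ← pow_succ']; rfl
  have hX : ∑' k, Y k = Y 0 + U (∑' k, Y k) := by
    rw [U.map_tsum hsum]
    simp_rw [hUY]
    exact hsum.tsum_eq_zero_add
  set f : Lp (Fin n → ℝ) 2 P := ∑' k, Y k with hf
  have hfae : (f : (ℕ → Fin n → ℝ) → Fin n → ℝ) =ᵐ[P] fun ω => T *ᵥ f (shiftSeq ω) + ω 0 := by
    have h0 : (f : (ℕ → Fin n → ℝ) → Fin n → ℝ) =ᵐ[P]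
        ((Y 0 + U f : Lp (Fin n → ℝ) 2 P) : _ → _) := by
      rw [← hX]
    filter_upwards [h0, Lp.coeFn_add (Y 0) (U f), hU f, (hfk 0).coeFn_toLp] with ω h0 h1 h2 h3
    have h3' : (Y 0) ω = ω 0 := by rw [h3]; simp
    rw [h0, h1, Pi.add_apply, h2, h3', add_comm]
  have hfm : Measurable f := (Lp.stronglyMeasurable f).measurable
  refine ⟨P.map f, ⟨Measure.isProbabilityMeasure_map hfm.aemeasurable, ?_⟩, ?_⟩
  · have := Measure.isProbabilityMeasure_map (μ := P) hfm.aemeasurable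
    have hm : Measurable fun q : (Fin n → ℝ) × (Fin n → ℝ) => T *ᵥ q.1 + q.2 :=
      (((continuous_mulVec T).comp continuous_fst).add continuous_snd).measurable
    have e : μ = μ.map id := by simp
    conv_lhs => rw [e, Measure.map_prod_map _ _ hfm measurable_id, ← hsplit.map_eq,
      Measure.map_map (hfm.prodMap measurable_id) hsplit.measurable,
      Measure.map_map hm ((hfm.prodMap measurable_id).comp hsplit.measurable)]
    exact Measure.map_congr hfae.symm
  · rw [memLp_map_measure_iff (by fun_prop) hfm.aemeasurable]
    exact Lp.memLp f

/-- The stationary covariance solves the discrete Lyapunov equation. -/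
lemma stationaryCov_eq (hμ : IsNoiseLaw Sw μ) (hT : T ∈ stableSet n) :
    stationaryCov μ T = T * stationaryCov μ T * Tᵀ + Sw := by
  have := hμ.isProbabilityMeasure
  obtain ⟨ν₀, hν₀, hmem⟩ := exists_isInvariantLaw hT hμ.memLp_two
  have hex : ∃ ν, IsInvariantLaw μ T ν := ⟨ν₀, hν₀⟩
  have hlaw : invariantLaw μ T = ν₀ := by
    rw [invariantLaw, dif_pos hex]
    exact isInvariantLaw_unique hT hex.choose_spec hν₀
  have := hν₀.1
  have hm : Measurable fun q : (Fin n → ℝ) × (Fin n → ℝ) => T *ᵥ q.1 + q.2 :=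
    (((continuous_mulVec T).comp continuous_fst).add continuous_snd).measurable
  have hx : ∀ i, MemLp (fun x : Fin n → ℝ => x i) 2 ν₀ := fun i => hmem.eval i
  have hw : ∀ i, MemLp (fun w : Fin n → ℝ => w i) 2 μ := fun i => hμ.memLp_two.eval i
  have hTx : ∀ i, MemLp (fun x : Fin n → ℝ => (T *ᵥ x) i) 2 ν₀ := fun i => by
    simp only [mulVec, dotProduct]
    exact memLp_finsetSum _ fun j _ => (hx j).const_mul (T i j)
  have hTx1 : ∀ i, Integrable (fun x : Fin n → ℝ => (T *ᵥ x) i) ν₀ := fun i =>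
    (hTx i).integrable one_le_two
  have hw1 : ∀ i, Integrable (fun w : Fin n → ℝ => w i) μ := fun i =>
    (hw i).integrable one_le_two
  have hfst : MeasurePreserving Prod.fst (ν₀.prod μ) ν₀ := measurePreserving_fst
  have hsnd : MeasurePreserving Prod.snd (ν₀.prod μ) μ := measurePreserving_snd
  have hint_fst : ∀ f : (Fin n → ℝ) → ℝ, ∫ q, f q.1 ∂(ν₀.prod μ) = ∫ x, f x ∂ν₀ := fun f => by
    rw [integral_fun_fst]; simp
  have hint_snd : ∀ f : (Fin n → ℝ) → ℝ, ∫ q, f q.2 ∂(ν₀.prod μ) = ∫ x, f x ∂μ := fun f => by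
    rw [integral_fun_snd]; simp
  set m : Fin n → ℝ := fun i => ∫ x, x i ∂ν₀ with hmdef
  have hTm : ∀ i, ∫ x, (T *ᵥ x) i ∂ν₀ = (T *ᵥ m) i := by
    intro i
    simp only [mulVec, dotProduct]
    rw [integral_finsetSum _ fun j _ => ((hx j).integrable one_le_two).const_mul (T i j)]
    simp_rw [integral_const_mul]; rfl
  -- the mean is a fixed point of `T`, so it vanishes
  have hm0 : m = 0 := by
    have h1 : m = T *ᵥ m := by
      funext i
      have : m i = ∫ x, x i ∂((ν₀.prod μ).map fun q => T *ᵥ q.1 + q.2) := by rw [hν₀.2]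
      have h1 : Integrable (fun q : (Fin n → ℝ) × (Fin n → ℝ) => (T *ᵥ q.1) i) (ν₀.prod μ) :=
        hfst.integrable_comp_of_integrable (hTx1 i)
      have h2 : Integrable (fun q : (Fin n → ℝ) × (Fin n → ℝ) => q.2 i) (ν₀.prod μ) :=
        hsnd.integrable_comp_of_integrable (hw1 i)
      rw [this, integral_map hm.aemeasurable (measurable_pi_apply i).aestronglyMeasurable]
      simp only [Pi.add_apply]
      rw [integral_add h1 h2, hint_fst fun x => (T *ᵥ x) i,
        hint_snd fun w => w i, hμ.mean_zero, add_zero, hTm]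
    have h2 : ∀ k : ℕ, m = (T ^ k) *ᵥ m := by
      intro k
      induction k with
      | zero => simp
      | succ k ih => rw [pow_succ, ← mulVec_mulVec, ← h1, ← ih]
    refine tendsto_nhds_unique ?_ (tendsto_pow_mulVec_zero hT m)
    simp_rw [← h2]
    exact tendsto_const_nhds
  have hcov : ∀ i j, stationaryCov μ T i j = ∫ x, x i * x j ∂ν₀ := by
    intro i j
    rw [stationaryCov, of_apply, hlaw, covariance_eq_sub (hx i) (hx j)]
    have h0 : ∫ x, x i ∂ν₀ = 0 := congrFun hm0 i
    simp [h0]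
  have hTcov : ∀ i j, ∫ x, (T *ᵥ x) i * (T *ᵥ x) j ∂ν₀ =
      (T * stationaryCov μ T * Tᵀ) i j := by
    intro i j
    have e : ∀ x : Fin n → ℝ, (T *ᵥ x) i * (T *ᵥ x) j =
        ∑ k, ∑ l, T i k * T j l * (x k * x l) := by
      intro x
      simp only [mulVec, dotProduct]
      rw [Finset.sum_mul_sum]
      exact Finset.sum_congr rfl fun k _ => Finset.sum_congr rfl fun l _ => by ring
    simp_rw [e]
    have hi : ∀ k l, Integrable (fun x : Fin n → ℝ => T i k * T j l * (x k * x l)) ν₀ := fun k l =>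
      ((hx k).integrable_mul (hx l)).const_mul _
    rw [integral_finsetSum _ fun k _ => integrable_finsetSum _ fun l _ => hi k l]
    simp_rw [integral_finsetSum _ fun l _ => hi _ l, integral_const_mul, ← hcov]
    simp only [mul_apply, transpose_apply, Finset.sum_mul]
    rw [Finset.sum_comm]
    exact Finset.sum_congr rfl fun l _ => Finset.sum_congr rfl fun k _ => by ring
  ext i j
  rw [hcov, Matrix.add_apply, ← hTcov]
  have : ∫ x, x i * x j ∂ν₀ =
      ∫ x, x i * x j ∂((ν₀.prod μ).map fun q => T *ᵥ q.1 + q.2) := by rw [hν₀.2]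
  have hmij : Measurable fun x : Fin n → ℝ => x i * x j :=
    (measurable_pi_apply i).mul (measurable_pi_apply j)
  rw [this, integral_map hm.aemeasurable hmij.aestronglyMeasurable]
  have hA : Integrable (fun q : (Fin n → ℝ) × (Fin n → ℝ) => (T *ᵥ q.1) i * (T *ᵥ q.1) j)
      (ν₀.prod μ) := hfst.integrable_comp_of_integrable ((hTx i).integrable_mul (hTx j))
  have hB : Integrable (fun q : (Fin n → ℝ) × (Fin n → ℝ) => q.2 i * q.2 j)
      (ν₀.prod μ) := hsnd.integrable_comp_of_integrable ((hw i).integrable_mul (hw j))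
  have hAB : ∀ i j, Integrable (fun q : (Fin n → ℝ) × (Fin n → ℝ) => (T *ᵥ q.1) i * q.2 j)
      (ν₀.prod μ) := fun i j => (hTx1 i).mul_prod (hw1 j)
  have e : ∀ q : (Fin n → ℝ) × (Fin n → ℝ), (T *ᵥ q.1 + q.2) i * (T *ᵥ q.1 + q.2) j =
      (T *ᵥ q.1) i * (T *ᵥ q.1) j + (T *ᵥ q.1) i * q.2 j + (T *ᵥ q.1) j * q.2 i
        + q.2 i * q.2 j := by
    intro q; simp only [Pi.add_apply]; ring
  have hcross : ∀ i j, ∫ q, (T *ᵥ q.1) i * q.2 j ∂(ν₀.prod μ) = 0 := by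
    intro i j
    rw [integral_prod_mul (fun x : Fin n → ℝ => (T *ᵥ x) i) (fun w : Fin n → ℝ => w j),
      hμ.mean_zero, mul_zero]
  have hA1 : Integrable (fun q : (Fin n → ℝ) × (Fin n → ℝ) =>
      (T *ᵥ q.1) i * (T *ᵥ q.1) j + (T *ᵥ q.1) i * q.2 j) (ν₀.prod μ) := hA.add (hAB i j)
  have hA2 : Integrable (fun q : (Fin n → ℝ) × (Fin n → ℝ) =>
      (T *ᵥ q.1) i * (T *ᵥ q.1) j + (T *ᵥ q.1) i * q.2 j + (T *ᵥ q.1) j * q.2 i)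
      (ν₀.prod μ) := hA1.add (hAB j i)
  simp_rw [e]
  rw [integral_add hA2 hB, integral_add hA1 (hAB j i), integral_add hA (hAB i j), hcross, hcross,
    hint_fst fun x => (T *ᵥ x) i * (T *ᵥ x) j, hint_snd fun w => w i * w j, hμ.second_moment]
  ring

end Stationary

/-! ### The spectral norm -/

section SpecNorm

variable {n : ℕ}

lemma specNorm_nonneg (M : Matrix (Fin n) (Fin n) ℝ) : 0 ≤ specNorm M := norm_nonneg _

lemma norm_toLp_sq (x : Fin n → ℝ) : ‖WithLp.toLp 2 x‖ ^ 2 = x ⬝ᵥ x := by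
  rw [EuclideanSpace.norm_sq_eq]
  simp [dotProduct, sq]

lemma dot_mulVec_self_le (M : Matrix (Fin n) (Fin n) ℝ) (x : Fin n → ℝ) :
    (M *ᵥ x) ⬝ᵥ (M *ᵥ x) ≤ specNorm M ^ 2 * (x ⬝ᵥ x) := by
  have h := (toEuclideanCLM (n := Fin n) (𝕜 := ℝ) M).le_opNorm (WithLp.toLp 2 x)
  rw [toEuclideanCLM_toLp] at h
  rw [← norm_toLp_sq, ← norm_toLp_sq, ← mul_pow]
  exact pow_le_pow_left₀ (norm_nonneg _) h 2

lemma specNorm_le_of_forall {M : Matrix (Fin n) (Fin n) ℝ} {c : ℝ} (hc : 0 ≤ c)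
    (h : ∀ x, (M *ᵥ x) ⬝ᵥ (M *ᵥ x) ≤ c ^ 2 * (x ⬝ᵥ x)) : specNorm M ≤ c := by
  refine ContinuousLinearMap.opNorm_le_bound _ hc fun v => ?_
  obtain ⟨x, rfl⟩ : ∃ x, v = WithLp.toLp 2 x := ⟨v.ofLp, rfl⟩
  rw [toEuclideanCLM_toLp]
  have := h x
  rw [← norm_toLp_sq, ← norm_toLp_sq, ← mul_pow] at this
  exact (sq_le_sq₀ (norm_nonneg _) (mul_nonneg hc (norm_nonneg _))).1 this

end SpecNorm

/-! ### Reverse `I`-projections -/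

section Projection

variable {n : ℕ} {A Q R S L X T P Sw : Matrix (Fin n) (Fin n) ℝ} {δ : ℝ}
  {noise : Matrix (Fin n) (Fin n) ℝ → Measure (Fin n → ℝ)}

open scoped MatrixOrder in
lemma exists_symm_mul_self (hS : S.PosDef) :
    ∃ B : Matrix (Fin n) (Fin n) ℝ, B.IsSymm ∧ B * B = S ∧ IsUnit B.det := by
  have h1 := CFC.sqrt_mul_sqrt_self S hS.posSemidef.nonneg
  refine ⟨CFC.sqrt S, (CFC.sqrt_nonneg S).posSemidef.symm', h1, ?_⟩
  have h2 := isUnit_det_of_posDef hS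
  rw [← h1, det_mul] at h2
  exact isUnit_of_mul_isUnit_left h2

lemma trace_conj_mul_nonneg (hL : L.PosDef) (hS : S.PosDef) (X : Matrix (Fin n) (Fin n) ℝ) :
    0 ≤ (Xᵀ * L * X * S).trace ∧ ((Xᵀ * L * X * S).trace ≤ 0 → X = 0) := by
  obtain ⟨B, hB, hBB, hu⟩ := exists_symm_mul_self hS
  have e : (Xᵀ * L * X * S).trace = ((X * B)ᵀ * L * (X * B)).trace := by
    rw [← hBB, ← Matrix.mul_assoc, trace_mul_comm, transpose_mul, hB.eq]
    simp only [Matrix.mul_assoc]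
  have hps : ((X * B)ᵀ * L * (X * B)).PosSemidef :=
    posSemidef_iff_qf.2 ⟨IsSymm_conj hL.symm' _, fun x => by
      rw [qf_conj]; exact qf_nonneg hL.posSemidef _⟩
  rw [e]
  refine ⟨hps.trace_nonneg, fun h => ?_⟩
  have h0 := hps.trace_eq_zero_iff.1 (le_antisymm h hps.trace_nonneg)
  have h1 : X * B = 0 := by
    refine Matrix.mulVec_injective (funext fun x => ?_)
    rw [zero_mulVec]
    refine eq_zero_of_qf_nonpos hL ?_
    rw [← qf_conj, h0, qf_zero]
  have h2 := congrArg (· * B⁻¹) h1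
  simpa [Matrix.mul_assoc, mul_nonsing_inv _ hu] using h2

/-- A solution of a stable Lyapunov equation with positive definite inhomogeneity is positive
definite. -/
lemma posDef_of_lyapunov (hT : T ∈ stableSet n) (hS : S.IsSymm) (hSw : Sw.PosDef)
    (h : S = T * S * Tᵀ + Sw) : S.PosDef := by
  have key : ∀ x, qf S x = qf S (Tᵀ *ᵥ x) + qf Sw x := fun x => by
    conv_lhs => rw [h]
    rw [qf_add, ← qf_conj, transpose_transpose]
  have h0 := qf_nonneg_of_lyapunov (M := S) (transpose_mem_stableSet hT) fun x => by
    rw [key x]; linarith [qf_nonneg hSw.posSemidef x]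
  refine posDef_iff_qf.2 ⟨hS, fun x hx => ?_⟩
  rw [key x]
  linarith [h0 (Tᵀ *ᵥ x), qf_pos hSw hx]

lemma isSymm_stationaryCov (μ : Measure (Fin n → ℝ)) (T : Matrix (Fin n) (Fin n) ℝ) :
    (stationaryCov μ T).IsSymm := by
  ext i j
  simp only [stationaryCov, transpose_apply, of_apply]
  exact covariance_comm _ _

/-- The discrepancy as the stationary cost of an LQR problem: completing squares with any solution
of a Riccati equation with input weight `(2 S_w)⁻¹`. -/
lemma discrepancy_eq (hSw : Sw.PosDef) (hnoise : IsNoiseLaw Sw (noise T)) (hT : T ∈ stableSet n)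
    (hQ : Q.IsSymm) (hP : P.PosSemidef) (hfix : riccatiMap A ((2 : ℝ) • Sw)⁻¹ Q P = P) :
    discrepancy Sw noise A T = (P * Sw).trace - (Q * stationaryCov (noise T) T).trace +
      ((T - closedLoop A ((2 : ℝ) • Sw)⁻¹ P)ᵀ * (((2 : ℝ) • Sw)⁻¹ + P) *
        (T - closedLoop A ((2 : ℝ) • Sw)⁻¹ P) * stationaryCov (noise T) T).trace := by
  have hR : ((2 : ℝ) • Sw)⁻¹.PosDef := (posDef_smul hSw two_pos).inv
  have hRe : ((2 : ℝ) • Sw)⁻¹ = (1 / 2 : ℝ) • Sw⁻¹ := by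
    refine inv_eq_right_inv ?_
    rw [Matrix.smul_mul, Matrix.mul_smul, smul_smul, mul_nonsing_inv _ (isUnit_det_of_posDef hSw)]
    norm_num
  set R := ((2 : ℝ) • Sw)⁻¹ with hRdef
  set F := closedLoop A R P with hF
  set S := stationaryCov (noise T) T with hS
  have hlyap : S = T * S * Tᵀ + Sw := stationaryCov_eq hnoise hT
  have hid : Q + Tᵀ * P * T + (T - A)ᵀ * R * (T - A) = P + (T - F)ᵀ * (R + P) * (T - F) := by
    refine eq_of_qf_eq ((hQ.add (IsSymm_conj hP.symm' T)).add (IsSymm_conj hR.symm' _))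
      (hP.symm'.add (IsSymm_conj (hR.symm'.add hP.symm') _)) fun x => ?_
    have := completion_of_squares (A := A) hR hP Q x (T *ᵥ x)
    rw [hfix] at this
    simp only [qf_add _ _ x, qf_conj, sub_mulVec]
    exact this
  have h1 : discrepancy Sw noise A T = ((T - A)ᵀ * R * (T - A) * S).trace := by
    have e : (T - A)ᵀ * R * (T - A) = (A - T)ᵀ * R * (A - T) := by
      simp only [transpose_sub]; noncomm_ring
    rw [discrepancy, e, hRe, trace_mul_comm (Sw⁻¹ * (A - T) * S)]
    simp only [Matrix.mul_smul, Matrix.smul_mul, trace_smul, smul_eq_mul, Matrix.mul_assoc]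
  have h2 : (P * S).trace = (Tᵀ * P * T * S).trace + (P * Sw).trace := by
    conv_lhs => rw [hlyap]
    rw [Matrix.mul_add, trace_add]
    congr 1
    rw [← Matrix.mul_assoc, trace_mul_comm]
    simp only [Matrix.mul_assoc]
  have h3 := congrArg (fun M => (M * S).trace) hid
  simp only [Matrix.add_mul, trace_add] at h3
  rw [h1, Matrix.mul_add (T - F)ᵀ, Matrix.add_mul, Matrix.add_mul, trace_add]
  simp only [Matrix.mul_add, Matrix.add_mul, trace_add] at h3
  linarith

/-! ### The limit of vanishing state cost -/

/-- The rescaled Riccati solution `δ P_δ`, which belongs to the fixed input weight `(2 S_w)⁻¹` and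
the state cost `δ Q`. -/
def scaledValue (Sw Q A : Matrix (Fin n) (Fin n) ℝ) (δ : ℝ) : Matrix (Fin n) (Fin n) ℝ :=
  δ • riccatiSolution Sw Q A δ

lemma posSemidef_scaledValue (hSw : Sw.PosDef) (hQ : Q.PosDef) (hδ : 0 < δ)
    (A : Matrix (Fin n) (Fin n) ℝ) : (scaledValue Sw Q A δ).PosSemidef :=
  (riccatiSolution_spec hSw hQ hδ A).1.smul hδ.le

lemma thetaStar_eq_scaled (hSw : Sw.PosDef) (Q A : Matrix (Fin n) (Fin n) ℝ) (δ : ℝ) :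
    thetaStar Sw Q A δ = closedLoop A ((2 : ℝ) • Sw)⁻¹ (scaledValue Sw Q A δ) := by
  rw [← inv_one_add_mul_eq_closedLoop (posDef_smul hSw two_pos), thetaStar, scaledValue]
  congr 3
  rw [Matrix.mul_smul, smul_mul, smul_smul, mul_comm]

lemma riccatiMap_scaledValue (hSw : Sw.PosDef) (hQ : Q.PosDef) (hδ : 0 < δ)
    (A : Matrix (Fin n) (Fin n) ℝ) :
    riccatiMap A ((2 : ℝ) • Sw)⁻¹ (δ • Q) (scaledValue Sw Q A δ) = scaledValue Sw Q A δ := by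
  have h := (riccatiSolution_spec hSw hQ hδ A).2
  rw [riccatiMap, ← thetaStar_eq hSw hδ] at h
  rw [riccatiMap, ← thetaStar_eq_scaled hSw]
  conv_rhs => rw [scaledValue, ← h]
  rw [scaledValue, Matrix.mul_smul, smul_mul, smul_add]

lemma scaledValue_mono (hSw : Sw.PosDef) (hQ : Q.PosDef) (hδ : 0 < δ) {δ' : ℝ} (hle : δ ≤ δ')
    (A : Matrix (Fin n) (Fin n) ℝ) (x : Fin n → ℝ) :
    qf (scaledValue Sw Q A δ) x ≤ qf (scaledValue Sw Q A δ') x := by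
  have hδ' := hδ.trans_le hle
  refine fixed_point_mono (A := A) (posDef_smul hSw two_pos).inv
    (posSemidef_scaledValue hSw hQ hδ A) (posSemidef_scaledValue hSw hQ hδ' A)
    (riccatiMap_scaledValue hSw hQ hδ A) (riccatiMap_scaledValue hSw hQ hδ' A) (fun y => ?_) ?_ x
  · rw [qf_smul, qf_smul]
    exact mul_le_mul_of_nonneg_right hle (qf_nonneg hQ.posSemidef y)
  · rw [← thetaStar_eq_scaled hSw]
    exact thetaStar_mem_stableSet hSw hQ hδ' A

/-- A positive sequence tending to zero. -/
def vanishing (k : ℕ) : ℝ := 1 / ((k : ℝ) + 1)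

lemma vanishing_pos (k : ℕ) : 0 < vanishing k := by unfold vanishing; positivity

lemma tendsto_vanishing : Tendsto vanishing atTop (𝓝 0) := tendsto_one_div_add_atTop_nhds_zero_nat

lemma vanishing_antitone : Antitone vanishing := fun k l h => by
  unfold vanishing
  exact one_div_le_one_div_of_le (by positivity) (by exact_mod_cast Nat.succ_le_succ h)

/-- The rescaled value matrices converge to a solution of the Riccati equation without state
cost. -/
lemma exists_limit_value (hSw : Sw.PosDef) (hQ : Q.PosDef) (A : Matrix (Fin n) (Fin n) ℝ) :
    ∃ P, P.PosSemidef ∧ riccatiMap A ((2 : ℝ) • Sw)⁻¹ 0 P = P ∧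
      Tendsto (fun k => scaledValue Sw Q A (vanishing k)) atTop (𝓝 P) ∧
      Tendsto (fun k => thetaStar Sw Q A (vanishing k)) atTop
        (𝓝 (closedLoop A ((2 : ℝ) • Sw)⁻¹ P)) := by
  have hR : ((2 : ℝ) • Sw)⁻¹.PosDef := (posDef_smul hSw two_pos).inv
  have hps := fun k => posSemidef_scaledValue hSw hQ (vanishing_pos k) A
  obtain ⟨P, hP⟩ := exists_tendsto_of_qf (fun k => (hps k).symm') fun x =>
    ⟨_, tendsto_atTop_ciInf (f := fun k => qf (scaledValue Sw Q A (vanishing k)) x)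
      (fun k l h => scaledValue_mono hSw hQ (vanishing_pos l) (vanishing_antitone h) A x)
      ⟨0, by rintro _ ⟨k, rfl⟩; exact qf_nonneg (hps k) x⟩⟩
  have hPs : P.PosSemidef := isClosed_posSemidef.mem_of_tendsto hP (Eventually.of_forall hps)
  refine ⟨P, hPs, ?_, hP, ?_⟩
  · have h1 : Tendsto (fun k => vanishing k • Q +
        riccatiMap A ((2 : ℝ) • Sw)⁻¹ 0 (scaledValue Sw Q A (vanishing k))) atTop
        (𝓝 ((0 : ℝ) • Q + riccatiMap A ((2 : ℝ) • Sw)⁻¹ 0 P)) :=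
      (tendsto_vanishing.smul_const Q).add ((continuousAt_riccatiMap hR hPs).tendsto.comp hP)
    rw [zero_smul, zero_add] at h1
    refine tendsto_nhds_unique h1 (hP.congr fun k => ?_)
    conv_lhs => rw [← riccatiMap_scaledValue hSw hQ (vanishing_pos k) A]
    simp [riccatiMap]
  · simp_rw [thetaStar_eq_scaled hSw]
    exact (continuousAt_closedLoop hR hPs).tendsto.comp hP

/-- The reverse `I`-projections are exactly the limit closed loop, if it is stable. -/
lemma isReverseIProjection_iff (hSw : Sw.PosDef) (hQ : Q.PosDef)
    (hnoise : ∀ θ ∈ stableSet n, IsNoiseLaw Sw (noise θ)) (hP : P.PosSemidef)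
    (hfix : riccatiMap A ((2 : ℝ) • Sw)⁻¹ 0 P = P)
    (hlim : Tendsto (fun k => scaledValue Sw Q A (vanishing k)) atTop (𝓝 P)) :
    IsReverseIProjection Sw noise A T ↔
      T = closedLoop A ((2 : ℝ) • Sw)⁻¹ P ∧ T ∈ stableSet n := by
  have hR : ((2 : ℝ) • Sw)⁻¹.PosDef := (posDef_smul hSw two_pos).inv
  have hcov : ∀ θ ∈ stableSet n, (stationaryCov (noise θ) θ).PosDef := fun θ hθ =>
    posDef_of_lyapunov hθ (isSymm_stationaryCov _ _) hSw (stationaryCov_eq (hnoise θ hθ) hθ)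
  have hdisc : ∀ θ ∈ stableSet n, discrepancy Sw noise A θ = (P * Sw).trace +
      ((θ - closedLoop A ((2 : ℝ) • Sw)⁻¹ P)ᵀ * (((2 : ℝ) • Sw)⁻¹ + P) *
        (θ - closedLoop A ((2 : ℝ) • Sw)⁻¹ P) * stationaryCov (noise θ) θ).trace := fun θ hθ => by
    rw [discrepancy_eq hSw (hnoise θ hθ) hθ isSymm_zero hP hfix]; simp
  constructor
  · rintro ⟨hT, hmin⟩
    refine ⟨?_, hT⟩
    have h1 : ∀ k, discrepancy Sw noise A T ≤
        (scaledValue Sw Q A (vanishing k) * Sw).trace := by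
      intro k
      have hst := thetaStar_mem_stableSet hSw hQ (vanishing_pos k) A
      refine (hmin hst).trans ?_
      rw [discrepancy_eq hSw (hnoise _ hst) hst (hQ.symm'.smul _)
        (posSemidef_scaledValue hSw hQ (vanishing_pos k) A)
        (riccatiMap_scaledValue hSw hQ (vanishing_pos k) A), ← thetaStar_eq_scaled hSw]
      have h2 := (trace_conj_mul_nonneg (hQ.smul (vanishing_pos k)) (hcov _ hst) 1).1
      simp only [transpose_one, Matrix.one_mul, Matrix.mul_one] at h2
      simp only [sub_self, transpose_zero, Matrix.zero_mul, trace_zero, add_zero]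
      linarith
    have hc : Continuous fun M : Matrix (Fin n) (Fin n) ℝ => (M * Sw).trace := by fun_prop
    have h2 : discrepancy Sw noise A T ≤ (P * Sw).trace :=
      ge_of_tendsto ((hc.tendsto P).comp hlim) (Eventually.of_forall h1)
    rw [hdisc T hT] at h2
    have h3 := (trace_conj_mul_nonneg (hR.add_posSemidef hP) (hcov T hT)
      (T - closedLoop A ((2 : ℝ) • Sw)⁻¹ P)).2 (by linarith)
    exact sub_eq_zero.1 h3
  · rintro ⟨hTF, hT⟩
    refine ⟨hT, fun θ hθ => ?_⟩
    change discrepancy Sw noise A T ≤ discrepancy Sw noise A θ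
    rw [hdisc T hT, hdisc θ hθ, ← hTF]
    have := (trace_conj_mul_nonneg (hR.add_posSemidef hP) (hcov θ hθ) (θ - T)).1
    simp only [sub_self, transpose_zero, Matrix.zero_mul, trace_zero, add_zero]
    linarith

/-- Without eigenvalues of modulus one, the limit closed loop is stable: a unimodular eigenvalue of
the limit would be one of `A`, because the corresponding input has zero cost. -/
lemma limit_mem_stableSet (hR : R.PosDef) (hP : P.PosSemidef) (hfix : riccatiMap A R 0 P = P)
    {u : ℕ → Matrix (Fin n) (Fin n) ℝ} (hu : ∀ k, u k ∈ stableSet n)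
    (hlim : Tendsto u atTop (𝓝 (closedLoop A R P)))
    (hA : ∀ z ∈ spectrum ℂ (cplx A), ‖z‖ ≠ 1) : closedLoop A R P ∈ stableSet n := by
  refine mem_stableSet_of_forall fun z hz => lt_of_le_of_ne (norm_le_one_of_tendsto hu hlim hz) ?_
  intro hz1
  obtain ⟨a, b, hab, ha, hb⟩ := exists_real_eigenpair hz
  have h1 := riccatiMap_eq (A := A) hR hP 0 a
  have h2 := riccatiMap_eq (A := A) hR hP 0 b
  have h3 := qf_eigenpair hP.symm' z.re z.im a b
  rw [← ha, ← hb, sq_re_add_sq_im, hz1] at h3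
  rw [hfix, qf_zero] at h1 h2
  have h4 := qf_nonneg hR.posSemidef (closedLoop A R P *ᵥ a - A *ᵥ a)
  have h5 := qf_nonneg hR.posSemidef (closedLoop A R P *ᵥ b - A *ᵥ b)
  have h6 := sub_eq_zero.1 (eq_zero_of_qf_nonpos hR
    (show qf R (closedLoop A R P *ᵥ a - A *ᵥ a) ≤ 0 by linarith))
  have h7 := sub_eq_zero.1 (eq_zero_of_qf_nonpos hR
    (show qf R (closedLoop A R P *ᵥ b - A *ᵥ b) ≤ 0 by linarith))
  refine hA z (mem_spectrum_of_real_eigenpair hab ?_ ?_) hz1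
  · rw [← h6, ha]
  · rw [← h7, hb]

/-- The linear rate: `0 ≤ δ P_δ - P ≤ δ X`, where `X` is the cost of `Q` along the limit closed
loop. -/
lemma exists_rate (hSw : Sw.PosDef) (hQ : Q.PosDef) (hP : P.PosSemidef)
    (hfix : riccatiMap A ((2 : ℝ) • Sw)⁻¹ 0 P = P)
    (hst : closedLoop A ((2 : ℝ) • Sw)⁻¹ P ∈ stableSet n) :
    ∃ C : ℝ, ∀ δ : ℝ, 0 < δ →
      specNorm (closedLoop A ((2 : ℝ) • Sw)⁻¹ P - thetaStar Sw Q A δ) ≤ C * δ := by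
  have hR : ((2 : ℝ) • Sw)⁻¹.PosDef := (posDef_smul hSw two_pos).inv
  set R := ((2 : ℝ) • Sw)⁻¹ with hRdef
  set F := closedLoop A R P with hF
  obtain ⟨X, hX⟩ := exists_lyapunov_solution hst Q
  obtain ⟨g, hg⟩ := exists_qf_le hR 1
  obtain ⟨h, hh⟩ := exists_qf_le PosDef.one X
  refine ⟨|g| * |h| * specNorm F, fun δ hδ => ?_⟩
  have hZp := posSemidef_scaledValue hSw hQ hδ A
  have hZfix := riccatiMap_scaledValue hSw hQ hδ A
  have hZst := thetaStar_mem_stableSet hSw hQ hδ A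
  rw [thetaStar_eq_scaled hSw] at hZst ⊢
  rw [← hRdef] at hZfix hZst ⊢
  set Z := scaledValue Sw Q A δ with hZ
  set F' := closedLoop A R Z with hF'
  have hlow : ∀ x, qf P x ≤ qf Z x := fixed_point_mono hR hP hZp hfix hZfix
    (fun x => by rw [qf_zero, qf_smul]; exact mul_nonneg hδ.le (qf_nonneg hQ.posSemidef x)) hZst
  have hD : (Z - P).PosSemidef := posSemidef_iff_qf.2 ⟨hZp.symm'.sub hP.symm', fun x => by
    rw [qf_sub]; linarith [hlow x]⟩
  have hup : ∀ x, qf (Z - P) x ≤ δ * |h| * (x ⬝ᵥ x) := by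
    intro x
    have h1 := qf_nonneg_of_lyapunov (M := δ • X - (Z - P)) hst (fun y => by
      have h2 := riccatiMap_le (A := A) hR hZp (δ • Q) y (F *ᵥ y)
      have h3 := riccatiMap_eq (A := A) hR hP 0 y
      have h4 : qf X y = qf Q y + qf X (F *ᵥ y) := by
        conv_lhs => rw [hX]
        rw [qf_add, qf_conj]
      rw [hZfix, qf_smul] at h2
      rw [hfix, qf_zero, ← hF] at h3
      simp only [qf_sub, qf_smul]
      rw [h4]
      linarith) x
    rw [qf_sub, qf_smul] at h1
    have h2 := hh x
    rw [qf_one] at h2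
    have h3 : h * (x ⬝ᵥ x) ≤ |h| * (x ⬝ᵥ x) :=
      mul_le_mul_of_nonneg_right (le_abs_self h) (dot_self_nonneg x)
    have h4 : δ * qf X x ≤ δ * (|h| * (x ⬝ᵥ x)) :=
      mul_le_mul_of_nonneg_left (h2.trans h3) hδ.le
    linarith
  have hDsq : ∀ w, ((Z - P) *ᵥ w) ⬝ᵥ ((Z - P) *ᵥ w) ≤ (δ * |h|) ^ 2 * (w ⬝ᵥ w) := by
    intro w
    set v := (Z - P) *ᵥ w with hv
    have h1 := sq_dot_mulVec_le hD v w
    rw [← hv] at h1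
    have h2 := mul_le_mul (hup v) (hup w) (qf_nonneg hD w)
      (mul_nonneg (by positivity) (dot_self_nonneg v))
    by_cases h0 : v ⬝ᵥ v = 0
    · rw [h0]; exact mul_nonneg (by positivity) (dot_self_nonneg w)
    · have hpos : 0 < v ⬝ᵥ v := lt_of_le_of_ne (dot_self_nonneg v) (Ne.symm h0)
      refine le_of_mul_le_mul_left ?_ hpos
      calc v ⬝ᵥ v * v ⬝ᵥ v = (v ⬝ᵥ v) ^ 2 := by ring
        _ ≤ _ := h1.trans h2
        _ = _ := by ring
  refine specNorm_le_of_forall (mul_nonneg (mul_nonneg (by positivity) (specNorm_nonneg F)) hδ.le)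
    fun x => ?_
  set z := (F - F') *ᵥ x with hz
  have hres : (R + Z) *ᵥ z = (Z - P) *ᵥ (F *ᵥ x) := by
    have h1 := mul_closedLoop (A := A) hR hP
    have h2 := mul_closedLoop (A := A) hR hZp
    rw [← hF] at h1
    rw [← hF'] at h2
    rw [hz, mulVec_mulVec, mulVec_mulVec]
    congr 1
    rw [Matrix.mul_sub, h2, ← h1]
    noncomm_ring
  set y := (Z - P) *ᵥ (F *ᵥ x) with hy
  have hy1 : y ⬝ᵥ y ≤ (δ * |h|) ^ 2 * (specNorm F ^ 2 * (x ⬝ᵥ x)) :=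
    (hDsq _).trans (mul_le_mul_of_nonneg_left (dot_mulVec_self_le F x) (by positivity))
  have hz1 : z ⬝ᵥ z ≤ |g| * (z ⬝ᵥ y) := by
    have h1 := hg z
    rw [qf_one] at h1
    have h2 : qf (R + Z) z = z ⬝ᵥ y := by rw [qf, hres]
    rw [qf_add] at h2
    have h3 := qf_nonneg hZp z
    have h4 := qf_nonneg hR.posSemidef z
    calc z ⬝ᵥ z ≤ g * qf R z := h1
      _ ≤ |g| * qf R z := mul_le_mul_of_nonneg_right (le_abs_self g) h4
      _ ≤ |g| * (z ⬝ᵥ y) := mul_le_mul_of_nonneg_left (by linarith) (abs_nonneg g)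
  have hz2 : z ⬝ᵥ z ≤ |g| ^ 2 * (y ⬝ᵥ y) := by
    by_cases h0 : z ⬝ᵥ z = 0
    · rw [h0]; exact mul_nonneg (by positivity) (dot_self_nonneg y)
    · have hpos : 0 < z ⬝ᵥ z := lt_of_le_of_ne (dot_self_nonneg z) (Ne.symm h0)
      refine le_of_mul_le_mul_left ?_ hpos
      calc z ⬝ᵥ z * z ⬝ᵥ z = (z ⬝ᵥ z) ^ 2 := by ring
        _ ≤ (|g| * (z ⬝ᵥ y)) ^ 2 := pow_le_pow_left₀ hpos.le hz1 2
        _ = |g| ^ 2 * (z ⬝ᵥ y) ^ 2 := by ring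
        _ ≤ |g| ^ 2 * ((z ⬝ᵥ z) * (y ⬝ᵥ y)) :=
            mul_le_mul_of_nonneg_left (sq_dot_le z y) (by positivity)
        _ = _ := by ring
  calc z ⬝ᵥ z ≤ |g| ^ 2 * (y ⬝ᵥ y) := hz2
    _ ≤ |g| ^ 2 * ((δ * |h|) ^ 2 * (specNorm F ^ 2 * (x ⬝ᵥ x))) :=
        mul_le_mul_of_nonneg_left hy1 (by positivity)
    _ = _ := by ring

/-- Existence and uniqueness of the reverse `I`-projection, and the linear rate. -/
theorem reverseIProjection_theory (hSw : Sw.PosDef) (hQ : Q.PosDef)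
    (hnoise : ∀ θ ∈ stableSet n, IsNoiseLaw Sw (noise θ)) (A : Matrix (Fin n) (Fin n) ℝ) :
    ((∀ z ∈ spectrum ℂ (A.map (algebraMap ℝ ℂ)), ‖z‖ ≠ 1) →
      ∃! P, IsReverseIProjection Sw noise A P) ∧
    ∀ P, IsReverseIProjection Sw noise A P →
      ∃ C : ℝ, ∀ δ : ℝ, 0 < δ → specNorm (P - thetaStar Sw Q A δ) ≤ C * δ := by
  obtain ⟨P, hP, hfix, hlim, hlim'⟩ := exists_limit_value hSw hQ A
  have hR : ((2 : ℝ) • Sw)⁻¹.PosDef := (posDef_smul hSw two_pos).inv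
  have hiff := fun T => isReverseIProjection_iff (T := T) hSw hQ hnoise hP hfix hlim
  constructor
  · intro hA
    have hst := limit_mem_stableSet hR hP hfix
      (fun k => thetaStar_mem_stableSet hSw hQ (vanishing_pos k) A) hlim' hA
    exact ⟨_, (hiff _).2 ⟨rfl, hst⟩, fun T hT => ((hiff T).1 hT).1⟩
  · intro T hT
    obtain ⟨rfl, hst⟩ := (hiff T).1 hT
    exact exists_rate hSw hQ hP hfix hst

end Projection

/-! ### Matrix programs on the random access machine -/

/-- The abstract state of a matrix program: loop counters, a bank of matrices and a bank of
scalars. -/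
structure AState (n : ℕ) where
  c : ℕ → ℕ
  m : ℕ → Matrix (Fin n) (Fin n) ℝ
  s : ℕ → ℝ

/-- The address of the first entry of the matrix number `b`. The first three matrices are the input
matrices; a gap of sixteen cells after them holds the scalars. -/
def baseAddr (n b : ℕ) : ℕ := b * n ^ 2 + if b < 3 then 0 else 16

/-- A machine state represents an abstract state: register `0` holds `n`, register `1` the constant
`1`, the registers `3` to `6` the loop counters, the even registers from `10` on the addresses of
the scalars and the odd ones from `11` on the addresses of the matrices. Register `2` is free for
address computations. -/
structure Rep {n : ℕ} (σ : RamState) (a : AState n) : Prop where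
  idx_zero : σ.idx 0 = n
  idx_one : σ.idx 1 = 1
  ctr : ∀ r, 3 ≤ r → r < 7 → σ.idx r = a.c r
  sreg : ∀ k < 16, σ.idx (10 + 2 * k) = 3 * n ^ 2 + k
  breg : ∀ b < 24, σ.idx (11 + 2 * b) = baseAddr n b
  smem : ∀ k < 16, σ.mem (3 * n ^ 2 + k) = a.s k
  bmem : ∀ b < 24, Stores σ (baseAddr n b) (a.m b)

section Layout

variable {n : ℕ}

lemma mul_add_inj {N e e' b b' : ℕ} (he : e < N) (he' : e' < N) (h : b * N + e = b' * N + e') :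
    b = b' ∧ e = e' := by
  rcases lt_trichotomy b b' with hb | rfl | hb
  · have := Nat.mul_le_mul_right N (Nat.succ_le_of_lt hb)
    rw [Nat.succ_mul] at this; omega
  · exact ⟨rfl, by omega⟩
  · have := Nat.mul_le_mul_right N (Nat.succ_le_of_lt hb)
    rw [Nat.succ_mul] at this; omega

lemma entry_lt (i j : Fin n) : i.val * n + j.val < n ^ 2 := by
  have := Nat.mul_le_mul_right n (Nat.succ_le_of_lt i.2)
  rw [Nat.succ_mul] at this
  have := j.2
  rw [sq]; omega

lemma entry_addr_ne_scalar (b : ℕ) (i j : Fin n) {k : ℕ} (hk : k < 16) :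
    baseAddr n b + i.val * n + j.val ≠ 3 * n ^ 2 + k := by
  have he := entry_lt i j
  unfold baseAddr
  split_ifs with hb
  · have := Nat.mul_le_mul_right (n ^ 2) (Nat.succ_le_of_lt hb)
    rw [Nat.succ_mul] at this; omega
  · have := Nat.mul_le_mul_right (n ^ 2) (not_lt.1 hb)
    omega

lemma entry_addr_inj {b b' : ℕ} {i j i' j' : Fin n}
    (h : baseAddr n b + i.val * n + j.val = baseAddr n b' + i'.val * n + j'.val) :
    b = b' ∧ i = i' ∧ j = j' := by
  have he := entry_lt i j
  have he' := entry_lt i' j'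
  have key : b * n ^ 2 + (i.val * n + j.val) = b' * n ^ 2 + (i'.val * n + j'.val) := by
    unfold baseAddr at h
    split_ifs at h with hb hb' hb'
    · omega
    · have h1 := Nat.mul_le_mul_right (n ^ 2) (Nat.succ_le_of_lt hb)
      have h2 := Nat.mul_le_mul_right (n ^ 2) (not_lt.1 hb')
      rw [Nat.succ_mul] at h1; omega
    · have h1 := Nat.mul_le_mul_right (n ^ 2) (Nat.succ_le_of_lt hb')
      have h2 := Nat.mul_le_mul_right (n ^ 2) (not_lt.1 hb)
      rw [Nat.succ_mul] at h1; omega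
    · omega
  obtain ⟨h1, h2⟩ := mul_add_inj he he' key
  obtain ⟨h3, h4⟩ := mul_add_inj j.2 j'.2 h2
  exact ⟨h1, Fin.ext h3, Fin.ext h4⟩

/-- Replacing a single entry of a matrix. -/
def setEntry (M : Matrix (Fin n) (Fin n) ℝ) (i j : Fin n) (v : ℝ) :
    Matrix (Fin n) (Fin n) ℝ :=
  Matrix.of fun i' j' => if i' = i ∧ j' = j then v else M i' j'

variable {σ : RamState} {a : AState n}

lemma Rep.setScalar (h : Rep σ a) {k : ℕ} (hk : k < 16) (v : ℝ) :
    Rep ⟨σ.idx, Function.update σ.mem (3 * n ^ 2 + k) v⟩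
      { a with s := Function.update a.s k v } where
  idx_zero := h.idx_zero
  idx_one := h.idx_one
  ctr := h.ctr
  sreg := h.sreg
  breg := h.breg
  smem := fun l hl => by
    by_cases hkl : l = k
    · subst hkl; simp
    · have : 3 * n ^ 2 + l ≠ 3 * n ^ 2 + k := by omega
      simp [Function.update_of_ne this, Function.update_of_ne hkl, h.smem l hl]
  bmem := fun b hb i j => by
    simp only [Function.update_of_ne (entry_addr_ne_scalar b i j hk)]
    exact h.bmem b hb i j

lemma Rep.setEntry (h : Rep σ a) (b : ℕ) (i j : Fin n) (v : ℝ) :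
    Rep ⟨σ.idx, Function.update σ.mem (baseAddr n b + i.val * n + j.val) v⟩
      { a with m := Function.update a.m b (setEntry (a.m b) i j v) } where
  idx_zero := h.idx_zero
  idx_one := h.idx_one
  ctr := h.ctr
  sreg := h.sreg
  breg := h.breg
  smem := fun k hk => by
    simp only [Function.update_of_ne (entry_addr_ne_scalar b i j hk).symm]
    exact h.smem k hk
  bmem := fun b' hb' i' j' => by
    by_cases he : baseAddr n b' + i'.val * n + j'.val = baseAddr n b + i.val * n + j.val
    · obtain ⟨rfl, rfl, rfl⟩ := entry_addr_inj he
      simp [RevI.setEntry]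
    · simp only [Function.update_of_ne he]
      rw [h.bmem b' hb' i' j']
      by_cases hbb : b' = b
      · subst hbb
        have : ¬ (i' = i ∧ j' = j) := by rintro ⟨rfl, rfl⟩; exact he rfl
        simp [RevI.setEntry, this]
      · rw [Function.update_of_ne hbb]

lemma Rep.setTemp (h : Rep σ a) (v : ℕ) : Rep ⟨Function.update σ.idx 2 v, σ.mem⟩ a where
  idx_zero := by simp [h.idx_zero]
  idx_one := by simp [h.idx_one]
  ctr := fun r h1 h2 => by
    simp only [Function.update_of_ne (show r ≠ 2 by omega)]; exact h.ctr r h1 h2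
  sreg := fun k hk => by
    simp only [Function.update_of_ne (show 10 + 2 * k ≠ 2 by omega)]; exact h.sreg k hk
  breg := fun b hb => by
    simp only [Function.update_of_ne (show 11 + 2 * b ≠ 2 by omega)]; exact h.breg b hb
  smem := h.smem
  bmem := h.bmem

lemma Rep.setCtr (h : Rep σ a) {r : ℕ} (hr : 3 ≤ r) (hr' : r < 7) (v : ℕ) :
    Rep ⟨Function.update σ.idx r v, σ.mem⟩ { a with c := Function.update a.c r v } where
  idx_zero := by simp [Function.update_of_ne (show 0 ≠ r by omega), h.idx_zero]
  idx_one := by simp [Function.update_of_ne (show 1 ≠ r by omega), h.idx_one]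
  ctr := fun r' h1 h2 => by
    by_cases hrr : r' = r
    · subst hrr; simp
    · simp only [Function.update_of_ne hrr]; exact h.ctr r' h1 h2
  sreg := fun k hk => by
    simp only [Function.update_of_ne (show 10 + 2 * k ≠ r by omega)]; exact h.sreg k hk
  breg := fun b hb => by
    simp only [Function.update_of_ne (show 11 + 2 * b ≠ r by omega)]; exact h.breg b hb
  smem := h.smem
  bmem := h.bmem

end Layout

section Run

variable {n S : ℕ} {a : AState n} {Q : AState n → Prop}

/-- Total correctness with a time bound: from every machine state representing `a`, the program
halts within `T` operations in a state representing some abstract state with property `Q`. -/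
def Run (S : ℕ) {n : ℕ} (p : Prog) (T : ℕ) (Q : AState n → Prop) (a : AState n) : Prop :=
  ∀ σ, Rep σ a → ∃ σ' t a', Exec S p σ σ' t ∧ t ≤ T ∧ Rep σ' a' ∧ Q a'

/-- The space bound under which the programs below run. -/
def spaceBound (n : ℕ) : ℕ := 24 * n ^ 2 + 64

lemma Run.mono {p : Prog} {T T' : ℕ} {Q' : AState n → Prop} (h : Run S p T Q a) (hT : T ≤ T')
    (hQ : ∀ a', Q a' → Q' a') : Run S p T' Q' a := fun σ hσ => by
  obtain ⟨σ', t, a', h1, h2, h3, h4⟩ := h σ hσ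
  exact ⟨σ', t, a', h1, h2.trans hT, h3, hQ a' h4⟩

lemma Run.seq {p q : Prog} {T T' : ℕ} (h : Run S p T (fun a' => Run S q T' Q a') a) :
    Run S (.seq p q) (T + T') Q a := fun σ hσ => by
  obtain ⟨σ', t, a', h1, h2, h3, h4⟩ := h σ hσ
  obtain ⟨σ'', t', a'', h1', h2', h3', h4'⟩ := h4 σ' h3
  exact ⟨σ'', t + t', a'', Exec.seq h1 h1', add_le_add h2 h2', h3', h4'⟩

lemma scalar_addr_lt {k : ℕ} (hk : k < 16) : 3 * n ^ 2 + k < spaceBound n := by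
  unfold spaceBound; omega

lemma entry_addr_lt {b : ℕ} (hb : b < 24) (i j : Fin n) :
    baseAddr n b + i.val * n + j.val < spaceBound n := by
  have he := entry_lt i j
  have := Nat.mul_le_mul_right (n ^ 2) (Nat.succ_le_of_lt hb)
  rw [Nat.succ_mul] at this
  unfold baseAddr spaceBound
  split_ifs <;> omega

/-! ### Scalar instructions -/

/-- scalar `k := z` -/
def sconst (k : ℕ) (z : ℤ) : Prog := .realConst (10 + 2 * k) z

/-- scalar `k := l` -/
def scopy (k l : ℕ) : Prog := .realCopy (10 + 2 * k) (10 + 2 * l)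

/-- scalar `k := l op l'` -/
def sop (op : RealOp) (k l l' : ℕ) : Prog := .realOp op (10 + 2 * k) (10 + 2 * l) (10 + 2 * l')

lemma Run.sconst {k : ℕ} (hk : k < 16) (z : ℤ)
    (h : Q { a with s := Function.update a.s k (z : ℝ) }) :
    Run (spaceBound n) (sconst k z) 1 Q a := fun σ hσ => by
  refine ⟨_, 1, _, Exec.realConst σ _ z ?_, le_rfl, ?_, h⟩
  · rw [hσ.sreg k hk]; exact scalar_addr_lt hk
  · rw [hσ.sreg k hk]; exact hσ.setScalar hk _

lemma Run.scopy {k l : ℕ} (hk : k < 16) (hl : l < 16)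
    (h : Q { a with s := Function.update a.s k (a.s l) }) :
    Run (spaceBound n) (scopy k l) 1 Q a := fun σ hσ => by
  refine ⟨_, 1, _, Exec.realCopy σ _ _ ?_ ?_, le_rfl, ?_, h⟩
  · rw [hσ.sreg k hk]; exact scalar_addr_lt hk
  · rw [hσ.sreg l hl]; exact scalar_addr_lt hl
  · rw [hσ.sreg k hk, hσ.sreg l hl, hσ.smem l hl]; exact hσ.setScalar hk _

lemma Run.sop {op : RealOp} {k l l' : ℕ} (hk : k < 16) (hl : l < 16) (hl' : l' < 16)
    (hdiv : op = .div → a.s l' ≠ 0)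
    (h : Q { a with s := Function.update a.s k (op.eval (a.s l) (a.s l')) }) :
    Run (spaceBound n) (sop op k l l') 1 Q a := fun σ hσ => by
  refine ⟨_, 1, _, Exec.realOp σ op _ _ _ ?_ ?_ ?_ ?_, le_rfl, ?_, h⟩
  · rw [hσ.sreg k hk]; exact scalar_addr_lt hk
  · rw [hσ.sreg l hl]; exact scalar_addr_lt hl
  · rw [hσ.sreg l' hl']; exact scalar_addr_lt hl'
  · rw [hσ.sreg l' hl', hσ.smem l' hl']; exact hdiv
  · rw [hσ.sreg k hk, hσ.sreg l hl, hσ.sreg l' hl', hσ.smem l hl, hσ.smem l' hl']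
    exact hσ.setScalar hk _

/-! ### Reading and writing matrix entries -/

/-- register `2 :=` address of the entry `(i, j)` of the matrix `b`, for counters `i`, `j` -/
def entryAddr (b i j : ℕ) : Prog :=
  .seq (.idxOp .mul 2 i 0) (.seq (.idxOp .add 2 2 j) (.idxOp .add 2 2 (11 + 2 * b)))

/-- scalar `k :=` entry `(i, j)` of the matrix `b` -/
def ld (k b i j : ℕ) : Prog := .seq (entryAddr b i j) (.realCopy (10 + 2 * k) 2)

/-- entry `(i, j)` of the matrix `b :=` scalar `k` -/
def st (b i j k : ℕ) : Prog := .seq (entryAddr b i j) (.realCopy 2 (10 + 2 * k))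

lemma exec_entryAddr {σ : RamState} (hσ : Rep σ a) {b i j : ℕ} (hb : b < 24)
    (hi : 3 ≤ i ∧ i < 7) (hj : 3 ≤ j ∧ j < 7) {I J : Fin n} (hI : a.c i = I) (hJ : a.c j = J) :
    ∃ σ', Exec (spaceBound n) (entryAddr b i j) σ σ' 3 ∧ Rep σ' a ∧ σ'.mem = σ.mem ∧
      σ'.idx 2 = baseAddr n b + I.val * n + J.val := by
  have hlt := entry_addr_lt hb I J
  have e1 : σ.idx i = I := by rw [hσ.ctr i hi.1 hi.2, hI]
  have e2 : σ.idx j = J := by rw [hσ.ctr j hj.1 hj.2, hJ]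
  have e3 := hσ.breg b hb
  have e0 := hσ.idx_zero
  have h1 : Exec (spaceBound n) (.idxOp .mul 2 i 0) σ
      ⟨Function.update σ.idx 2 (I.val * n), σ.mem⟩ 1 := by
    have := Exec.idxOp (S := spaceBound n) σ .mul 2 i 0 (by
      simp only [IdxOp.eval, e1, e0]; omega)
    simpa only [IdxOp.eval, e1, e0] using this
  have h2 : Exec (spaceBound n) (.idxOp .add 2 2 j) ⟨Function.update σ.idx 2 (I.val * n), σ.mem⟩
      ⟨Function.update σ.idx 2 (I.val * n + J.val), σ.mem⟩ 1 := by
    have hj2 : j ≠ 2 := by omega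
    have := Exec.idxOp (S := spaceBound n) ⟨Function.update σ.idx 2 (I.val * n), σ.mem⟩ .add 2 2 j
      (by simp only [IdxOp.eval, Function.update_self, Function.update_of_ne hj2, e2]; omega)
    simpa only [IdxOp.eval, Function.update_self, Function.update_of_ne hj2, e2,
      Function.update_idem] using this
  have h3 : Exec (spaceBound n) (.idxOp .add 2 2 (11 + 2 * b))
      ⟨Function.update σ.idx 2 (I.val * n + J.val), σ.mem⟩
      ⟨Function.update σ.idx 2 (I.val * n + J.val + baseAddr n b), σ.mem⟩ 1 := by
    have hj2 : 11 + 2 * b ≠ 2 := by omega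
    have := Exec.idxOp (S := spaceBound n) ⟨Function.update σ.idx 2 (I.val * n + J.val), σ.mem⟩
      .add 2 2 (11 + 2 * b)
      (by simp only [IdxOp.eval, Function.update_self, Function.update_of_ne hj2, e3]; omega)
    simpa only [IdxOp.eval, Function.update_self, Function.update_of_ne hj2, e3,
      Function.update_idem] using this
  exact ⟨_, Exec.seq h1 (Exec.seq h2 h3), hσ.setTemp _, rfl, by
    simp only [Function.update_self]; ring⟩

lemma Run.ld {k b i j : ℕ} (hk : k < 16) (hb : b < 24) (hi : 3 ≤ i ∧ i < 7) (hj : 3 ≤ j ∧ j < 7)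
    {I J : Fin n} (hI : a.c i = I) (hJ : a.c j = J)
    (h : Q { a with s := Function.update a.s k (a.m b I J) }) :
    Run (spaceBound n) (ld k b i j) 4 Q a := fun σ hσ => by
  obtain ⟨σ', h1, h2, h3, h4⟩ := exec_entryAddr hσ hb hi hj hI hJ
  refine ⟨_, 4, _, Exec.seq h1 (Exec.realCopy σ' _ _ ?_ ?_), le_rfl, ?_, h⟩
  · rw [h2.sreg k hk]; exact scalar_addr_lt hk
  · rw [h4]; exact entry_addr_lt hb I J
  · rw [h2.sreg k hk, h4, h2.bmem b hb I J]; exact h2.setScalar hk _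

lemma Run.st {k b i j : ℕ} (hk : k < 16) (hb : b < 24) (hi : 3 ≤ i ∧ i < 7) (hj : 3 ≤ j ∧ j < 7)
    {I J : Fin n} (hI : a.c i = I) (hJ : a.c j = J)
    (h : Q { a with m := Function.update a.m b (setEntry (a.m b) I J (a.s k)) }) :
    Run (spaceBound n) (st b i j k) 4 Q a := fun σ hσ => by
  obtain ⟨σ', h1, h2, h3, h4⟩ := exec_entryAddr hσ hb hi hj hI hJ
  refine ⟨_, 4, _, Exec.seq h1 (Exec.realCopy σ' _ _ ?_ ?_), le_rfl, ?_, h⟩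
  · rw [h4]; exact entry_addr_lt hb I J
  · rw [h2.sreg k hk]; exact scalar_addr_lt hk
  · rw [h2.sreg k hk, h4, h2.smem k hk]; exact h2.setEntry b I J _

/-! ### Branches and loops -/

/-- if scalar `k <` scalar `l` then `p` else `q` -/
def ifS (k l : ℕ) (p q : Prog) : Prog := .ifReal (10 + 2 * k) (10 + 2 * l) p q

lemma Run.ifS {k l T : ℕ} {p q : Prog} (hk : k < 16) (hl : l < 16)
    (h1 : a.s k < a.s l → Run (spaceBound n) p T Q a)
    (h2 : ¬ a.s k < a.s l → Run (spaceBound n) q T Q a) :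
    Run (spaceBound n) (ifS k l p q) (T + 1) Q a := fun σ hσ => by
  have ek := hσ.sreg k hk
  have el := hσ.sreg l hl
  have hk' : σ.idx (10 + 2 * k) < spaceBound n := by rw [ek]; exact scalar_addr_lt hk
  have hl' : σ.idx (10 + 2 * l) < spaceBound n := by rw [el]; exact scalar_addr_lt hl
  have hiff : σ.mem (σ.idx (10 + 2 * k)) < σ.mem (σ.idx (10 + 2 * l)) ↔ a.s k < a.s l := by
    rw [ek, el, hσ.smem k hk, hσ.smem l hl]
  by_cases h : a.s k < a.s l
  · obtain ⟨σ', t, a', e1, e2, e3, e4⟩ := h1 h σ hσ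
    exact ⟨σ', t + 1, a', Exec.ifRealTrue hk' hl' (hiff.2 h) e1, by omega, e3, e4⟩
  · obtain ⟨σ', t, a', e1, e2, e3, e4⟩ := h2 h σ hσ
    exact ⟨σ', t + 1, a', Exec.ifRealFalse hk' hl' (fun h' => h (hiff.1 h')) e1, by omega, e3, e4⟩

lemma Run.ifIdx {i j T : ℕ} {p q : Prog} (hi : 3 ≤ i ∧ i < 7) (hj : 3 ≤ j ∧ j < 7)
    (h1 : a.c i < a.c j → Run S p T Q a) (h2 : ¬ a.c i < a.c j → Run S q T Q a) :
    Run S (.ifIdx i j p q) (T + 1) Q a := fun σ hσ => by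
  have hiff : σ.idx i < σ.idx j ↔ a.c i < a.c j := by
    rw [hσ.ctr i hi.1 hi.2, hσ.ctr j hj.1 hj.2]
  by_cases h : a.c i < a.c j
  · obtain ⟨σ', t, a', e1, e2, e3, e4⟩ := h1 h σ hσ
    exact ⟨σ', t + 1, a', Exec.ifIdxTrue (hiff.2 h) e1, by omega, e3, e4⟩
  · obtain ⟨σ', t, a', e1, e2, e3, e4⟩ := h2 h σ hσ
    exact ⟨σ', t + 1, a', Exec.ifIdxFalse (fun h' => h (hiff.1 h')) e1, by omega, e3, e4⟩

/-- for counter `r` from `0` to `n - 1` do `p` -/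
def forC (r : ℕ) (p : Prog) : Prog :=
  .seq (.idxConst r 0) (.whileIdx r 0 (.seq p (.idxOp .add r r 1)))

lemma Run.forC {r T : ℕ} {p : Prog} (hr : 3 ≤ r ∧ r < 7) (Inv : ℕ → AState n → Prop)
    (h0 : Inv 0 { a with c := Function.update a.c r 0 })
    (hstep : ∀ k < n, ∀ a, Inv k a → a.c r = k → Run (spaceBound n) p T (fun a' =>
      a'.c r = k ∧ Inv (k + 1) { a' with c := Function.update a'.c r (k + 1) }) a)
    (hend : ∀ a, Inv n a → Q a) :
    Run (spaceBound n) (forC r p) (n * (T + 2) + 2) Q a := fun σ hσ => by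
  have hn : n ≤ spaceBound n := by
    unfold spaceBound; nlinarith [Nat.le_self_pow two_ne_zero n]
  have main : ∀ d k, k + d = n → ∀ (σ : RamState) (a : AState n), Rep σ a → Inv k a →
      a.c r = k → ∃ σ' t a', Exec (spaceBound n) (.whileIdx r 0 (.seq p (.idxOp .add r r 1)))
        σ σ' t ∧ t ≤ d * (T + 2) + 1 ∧ Rep σ' a' ∧ Q a' := by
    intro d
    induction d with
    | zero =>
      intro k hk σ a hσ hI hc
      have hkn : k = n := by omega
      subst hkn
      refine ⟨σ, 1, a, Exec.whileIdxFalse ?_, by omega, hσ, hend a hI⟩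
      rw [hσ.idx_zero, hσ.ctr r hr.1 hr.2, hc]; omega
    | succ d ih =>
      intro k hk σ a hσ hI hc
      obtain ⟨σ₁, t₁, a₁, e1, e2, e3, e4, e5⟩ := hstep k (by omega) a hI hc σ hσ
      have hσ₁r : σ₁.idx r = k := by rw [e3.ctr r hr.1 hr.2, e4]
      have hex : Exec (spaceBound n) (.idxOp .add r r 1) σ₁
          ⟨Function.update σ₁.idx r (k + 1), σ₁.mem⟩ 1 := by
        have := Exec.idxOp (S := spaceBound n) σ₁ .add r r 1 (by
          simp only [IdxOp.eval, hσ₁r, e3.idx_one]; omega)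
        simpa only [IdxOp.eval, hσ₁r, e3.idx_one] using this
      obtain ⟨σ₂, t₂, a₂, f1, f2, f3, f4⟩ := ih (k + 1) (by omega) _ _
        (e3.setCtr hr.1 hr.2 (k + 1)) e5 (by simp)
      refine ⟨σ₂, 1 + (t₁ + 1) + t₂, a₂, Exec.whileIdxTrue ?_ (Exec.seq e1 hex) f1, ?_, f3, f4⟩
      · rw [hσ.idx_zero, hσ.ctr r hr.1 hr.2, hc]; omega
      · rw [Nat.succ_mul]; omega
  obtain ⟨σ', t, a', e1, e2, e3, e4⟩ := main n 0 (by omega) _ _ (hσ.setCtr hr.1 hr.2 0) h0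
    (by simp)
  exact ⟨σ', 1 + t, a', Exec.seq (Exec.idxConst σ r 0 (Nat.zero_le _)) e1, by omega, e3, e4⟩

/-- while scalar `k <` scalar `l` do `p` -/
def whileS (k l : ℕ) (p : Prog) : Prog := .whileReal (10 + 2 * k) (10 + 2 * l) p

lemma Run.whileS {k l T N : ℕ} {p : Prog} (hk : k < 16) (hl : l < 16)
    (Inv : ℕ → AState n → Prop) (h0 : Inv 0 a)
    (hstep : ∀ i a, Inv i a → a.s k < a.s l → i < N ∧ Run (spaceBound n) p T (Inv (i + 1)) a)
    (hend : ∀ i a, Inv i a → ¬ a.s k < a.s l → Q a) :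
    Run (spaceBound n) (whileS k l p) (N * (T + 1) + 1) Q a := fun σ hσ => by
  have main : ∀ d i, N ≤ i + d → ∀ (σ : RamState) (a : AState n), Rep σ a → Inv i a →
      ∃ σ' t a', Exec (spaceBound n) (RevI.whileS k l p) σ σ' t ∧ t ≤ d * (T + 1) + 1 ∧
        Rep σ' a' ∧ Q a' := by
    intro d
    induction d with
    | zero =>
      intro i hi σ a hσ hI
      have hcond : ¬ a.s k < a.s l := fun h => by have := (hstep i a hI h).1; omega
      refine ⟨σ, 1, a, Exec.whileRealFalse ?_ ?_ ?_, by omega, hσ, hend i a hI hcond⟩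
      · rw [hσ.sreg k hk]; exact scalar_addr_lt hk
      · rw [hσ.sreg l hl]; exact scalar_addr_lt hl
      · rwa [hσ.sreg k hk, hσ.sreg l hl, hσ.smem k hk, hσ.smem l hl]
    | succ d ih =>
      intro i hi σ a hσ hI
      by_cases hcond : a.s k < a.s l
      · obtain ⟨σ₁, t₁, a₁, e1, e2, e3, e4⟩ := (hstep i a hI hcond).2 σ hσ
        obtain ⟨σ₂, t₂, a₂, f1, f2, f3, f4⟩ := ih (i + 1) (by omega) σ₁ a₁ e3 e4
        refine ⟨σ₂, 1 + t₁ + t₂, a₂, Exec.whileRealTrue ?_ ?_ ?_ e1 f1, ?_, f3, f4⟩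
        · rw [hσ.sreg k hk]; exact scalar_addr_lt hk
        · rw [hσ.sreg l hl]; exact scalar_addr_lt hl
        · rwa [hσ.sreg k hk, hσ.sreg l hl, hσ.smem k hk, hσ.smem l hl]
        · rw [Nat.succ_mul]; omega
      · refine ⟨σ, 1, a, Exec.whileRealFalse ?_ ?_ ?_, by omega, hσ, hend i a hI hcond⟩
        · rw [hσ.sreg k hk]; exact scalar_addr_lt hk
        · rw [hσ.sreg l hl]; exact scalar_addr_lt hl
        · rwa [hσ.sreg k hk, hσ.sreg l hl, hσ.smem k hk, hσ.smem l hl]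
  exact main N 0 (by omega) σ a hσ h0

end Run

/-! ### Matrix arithmetic on the random access machine -/

section MatrixPrograms

variable {n : ℕ} {a : AState n} {Q : AState n → Prop}

/-- The state `a'` arises from `a` by storing `M` in the matrix `d`; the scalars below `4` and the
counters below `6` are scratch space. -/
structure Stored (d : ℕ) (M : Matrix (Fin n) (Fin n) ℝ) (a a' : AState n) : Prop where
  m_eq : a'.m = Function.update a.m d M
  s_eq : ∀ k, 4 ≤ k → a'.s k = a.s k
  c_eq : a'.c 6 = a.c 6

/-- for all `i`, `j` do `body` and store the scalar `0` in the entry `(i, j)` of the matrix `d` -/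
def fill (d : ℕ) (body : Prog) : Prog := forC 3 (forC 4 (.seq body (st d 3 4 0)))

lemma Run.fill {d T : ℕ} {body : Prog} (hd : d < 24) (M : Matrix (Fin n) (Fin n) ℝ)
    (hbody : ∀ (I J : Fin n) (a' : AState n), (∀ b, b ≠ d → a'.m b = a.m b) →
      (∀ k, 4 ≤ k → a'.s k = a.s k) → a'.c 6 = a.c 6 → a'.c 3 = I → a'.c 4 = J →
      Run (spaceBound n) body T (fun a'' => a''.m = a'.m ∧ (∀ k, 4 ≤ k → a''.s k = a'.s k) ∧
        a''.c 3 = a'.c 3 ∧ a''.c 4 = a'.c 4 ∧ a''.c 6 = a'.c 6 ∧ a''.s 0 = M I J) a')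
    (h : ∀ a', Stored d M a a' → Q a') :
    Run (spaceBound n) (fill d body) (n * (n * (T + 4 + 2) + 2 + 2) + 2) Q a := by
  refine Run.forC (by norm_num) (fun k a' => (∀ b, b ≠ d → a'.m b = a.m b) ∧
      (∀ k, 4 ≤ k → a'.s k = a.s k) ∧ a'.c 6 = a.c 6 ∧
      ∀ I J : Fin n, I.val < k → a'.m d I J = M I J) ?_ ?_ ?_
  · exact ⟨fun _ _ => rfl, fun _ _ => rfl, rfl, fun _ _ h => absurd h (Nat.not_lt_zero _)⟩
  · rintro k hk a₁ ⟨hm, hs, hc, hM⟩ hk3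
    refine Run.forC (by norm_num) (fun j a' => (∀ b, b ≠ d → a'.m b = a.m b) ∧
      (∀ k, 4 ≤ k → a'.s k = a.s k) ∧ a'.c 6 = a.c 6 ∧ a'.c 3 = k ∧
      ∀ I J : Fin n, I.val < k ∨ (I.val = k ∧ J.val < j) → a'.m d I J = M I J) ?_ ?_ ?_
    · refine ⟨hm, hs, hc, hk3, fun I J h => ?_⟩
      rcases h with h | h
      · exact hM I J h
      · exact absurd h.2 (Nat.not_lt_zero _)
    · rintro j hj a₂ ⟨hm₂, hs₂, hc₂, hk₂, hM₂⟩ hj4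
      refine Run.seq (Run.mono (hbody ⟨k, hk⟩ ⟨j, hj⟩ a₂ hm₂ hs₂ hc₂ hk₂ hj4) le_rfl ?_)
      rintro a₃ ⟨e1, e2, e3, e4, e5, e6⟩
      refine Run.st (by norm_num) hd (by norm_num) (by norm_num) (I := ⟨k, hk⟩) (J := ⟨j, hj⟩)
        (by rw [e3, hk₂]) (by rw [e4, hj4]) ⟨by rw [e4, hj4], ?_, ?_, ?_, ?_, ?_⟩
      · intro b hb
        simp only [Function.update_of_ne hb, e1]
        exact hm₂ b hb
      · intro k hk; simp only [e2 k hk]; exact hs₂ k hk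
      · simp [e5, hc₂]
      · simp [e3, hk₂]
      · intro I J hIJ
        simp only [Function.update_self, RevI.setEntry, Matrix.of_apply]
        split_ifs with hc'
        · rw [hc'.1, hc'.2, e6]
        · rw [e1]
          refine hM₂ I J ?_
          rcases hIJ with h | ⟨h1, h2⟩
          · exact Or.inl h
          · refine Or.inr ⟨h1, lt_of_le_of_ne (Nat.lt_succ_iff.1 h2) fun h3 => hc' ?_⟩
            exact ⟨Fin.ext h1, Fin.ext h3⟩
    · rintro a₂ ⟨hm₂, hs₂, hc₂, hk₂, hM₂⟩
      refine ⟨hk₂, hm₂, hs₂, by simpa using hc₂, fun I J hI => hM₂ I J ?_⟩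
      rcases Nat.lt_succ_iff_lt_or_eq.1 hI with h | h
      · exact Or.inl h
      · exact Or.inr ⟨h, J.2⟩
  · rintro a' ⟨hm, hs, hc, hM⟩
    refine h a' ⟨?_, hs, hc⟩
    funext b
    by_cases hb : b = d
    · subst hb
      rw [Function.update_self]
      ext I J
      exact hM I J I.2
    · rw [Function.update_of_ne hb, hm b hb]

/-- `X` or its transpose. -/
def opT (t : Bool) (X : Matrix (Fin n) (Fin n) ℝ) : Matrix (Fin n) (Fin n) ℝ :=
  match t with
  | true => Xᵀ
  | false => X

/-- load the entry `(i, j)` of the matrix `b` or of its transpose -/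
def ldT (k b : ℕ) (t : Bool) (i j : ℕ) : Prog :=
  match t with
  | true => ld k b j i
  | false => ld k b i j

lemma Run.ldT {k b i j : ℕ} {t : Bool} (hk : k < 16) (hb : b < 24) (hi : 3 ≤ i ∧ i < 7)
    (hj : 3 ≤ j ∧ j < 7) {I J : Fin n} (hI : a.c i = I) (hJ : a.c j = J)
    (h : Q { a with s := Function.update a.s k (opT t (a.m b) I J) }) :
    Run (spaceBound n) (ldT k b t i j) 4 Q a := by
  cases t
  · exact Run.ld hk hb hi hj hI hJ h
  · exact Run.ld hk hb hj hi hJ hI h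

/-- matrix `d :=` matrix `e` `+` matrix `x` `*` matrix `y`, with `x` or `y` transposed if the
corresponding flag is set -/
def mac (d e x : ℕ) (tx : Bool) (y : ℕ) (ty : Bool) : Prog :=
  fill d (.seq (ld 0 e 3 4) (forC 5 (.seq (ldT 1 x tx 3 5) (.seq (ldT 2 y ty 5 4)
    (.seq (sop .mul 1 1 2) (sop .add 0 0 1))))))

lemma Run.mac {d e x y : ℕ} {tx ty : Bool} (hn : 1 ≤ n) (hd : d < 24) (he : e < 24) (hx : x < 24)
    (hy : y < 24) (hed : e ≠ d) (hxd : x ≠ d) (hyd : y ≠ d)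
    (h : ∀ a', Stored d (a.m e + opT tx (a.m x) * opT ty (a.m y)) a a' → Q a') :
    Run (spaceBound n) (mac d e x tx y ty) (30 * n ^ 3) Q a := by
  refine Run.mono (Run.fill (T := 12 * n + 6) hd (a.m e + opT tx (a.m x) * opT ty (a.m y)) ?_ h)
    ?_ fun _ h => h
  · intro I J a' hm hs hc h3 h4
    refine Run.mono (Run.seq (T := 4) (T' := n * (4 + (4 + (1 + 1)) + 2) + 2)
      (Run.ld (by norm_num) he (by norm_num) (by norm_num) h3 h4 ?_)) (by omega) fun _ h => h
    refine Run.forC (by norm_num) (fun k a'' => a''.m = a'.m ∧ (∀ k, 4 ≤ k → a''.s k = a'.s k) ∧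
        a''.c 3 = a'.c 3 ∧ a''.c 4 = a'.c 4 ∧ a''.c 6 = a'.c 6 ∧
        a''.s 0 = a.m e I J + ∑ l : Fin n with l.val < k, opT tx (a.m x) I l * opT ty (a.m y) l J)
      ?_ ?_ ?_
    · refine ⟨rfl, fun k hk => ?_, rfl, rfl, rfl, ?_⟩
      · simp [Function.update_of_ne (show k ≠ 0 by omega)]
      · simp [hm e hed]
    · rintro k hk a₁ ⟨e1, e2, e3, e4, e5, e6⟩ hk5
      refine Run.seq (Run.ldT (k := 1) (t := tx) (i := 3) (j := 5) (I := I) (J := ⟨k, hk⟩)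
        (by norm_num) hx (by norm_num) (by norm_num) (by exact e3.trans h3) hk5 ?_)
      refine Run.seq (T' := 2) (Run.ldT (k := 2) (t := ty) (i := 5) (j := 4) (I := ⟨k, hk⟩)
        (J := J) (by norm_num) hy (by norm_num) (by norm_num) (by exact hk5)
        (by exact e4.trans h4) ?_)
      refine Run.seq (T' := 1) (Run.sop (by norm_num) (by norm_num) (by norm_num) (by simp) ?_)
      refine Run.sop (by norm_num) (by norm_num) (by norm_num) (by simp) ?_
      refine ⟨hk5, e1, fun l hl => ?_, by simpa using e3, by simpa using e4, by simpa using e5, ?_⟩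
      · have := e2 l hl
        simpa [Function.update_of_ne (show l ≠ 0 by omega),
          Function.update_of_ne (show l ≠ 1 by omega), Function.update_of_ne (show l ≠ 2 by omega)]
      · have hset : (Finset.univ.filter fun l : Fin n => l.val < k + 1) =
            insert ⟨k, hk⟩ (Finset.univ.filter fun l : Fin n => l.val < k) := by
          ext l
          simp only [Finset.mem_filter, Finset.mem_univ, true_and, Finset.mem_insert, Fin.ext_iff]
          omega
        rw [hset, Finset.sum_insert (by simp)]
        simp [RealOp.eval, e1, e6, hm x hxd, hm y hyd]
        ring
    · rintro a'' ⟨e1, e2, e3, e4, e5, e6⟩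
      refine ⟨e1, e2, e3, e4, e5, ?_⟩
      rw [e6, Matrix.add_apply, Matrix.mul_apply]
      congr 1
      exact Finset.sum_congr (by ext l; simp) fun _ _ => rfl
  · nlinarith [Nat.mul_le_mul hn hn, Nat.mul_le_mul (Nat.mul_le_mul hn hn) hn,
      Nat.mul_le_mul_left (n ^ 2) hn, Nat.mul_le_mul_left n hn,
      Nat.mul_le_mul_left n (Nat.mul_le_mul hn hn)]

/-- matrix `d :=` scalar `k` times the identity -/
def diag (d k : ℕ) : Prog :=
  fill d (.ifIdx 3 4 (sconst 0 0) (.ifIdx 4 3 (sconst 0 0) (scopy 0 k)))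

lemma Run.diag {d k : ℕ} (hn : 1 ≤ n) (hd : d < 24) (hk : 4 ≤ k ∧ k < 16)
    (h : ∀ a', Stored d (a.s k • (1 : Matrix (Fin n) (Fin n) ℝ)) a a' → Q a') :
    Run (spaceBound n) (diag d k) (20 * n ^ 3) Q a := by
  refine Run.mono (Run.fill (T := 3) hd (a.s k • (1 : Matrix (Fin n) (Fin n) ℝ)) ?_ h)
    ?_ fun _ h => h
  · intro I J a' hm hs hc h3 h4
    have hs' : ∀ v, ∀ l, 4 ≤ l → Function.update a'.s 0 v l = a'.s l := fun v l hl =>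
      Function.update_of_ne (by omega) _ _
    refine Run.ifIdx (T := 2) (by norm_num) (by norm_num) (fun hlt => ?_) fun hlt => ?_
    · refine Run.mono (Run.sconst (by norm_num) 0
        ⟨rfl, hs' _, rfl, rfl, rfl, ?_⟩) (by norm_num) fun _ h => h
      have : I ≠ J := by rintro rfl; omega
      simp [this]
    · refine Run.ifIdx (T := 1) (by norm_num) (by norm_num) (fun hlt' => ?_) fun hlt' => ?_
      · refine Run.sconst (by norm_num) 0 ⟨rfl, hs' _, rfl, rfl, rfl, ?_⟩
        have : I ≠ J := by rintro rfl; omega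
        simp [this]
      · refine Run.scopy (by norm_num) hk.2 ⟨rfl, hs' _, rfl, rfl, rfl, ?_⟩
        have : I = J := Fin.ext (by omega)
        simp [this, hs k hk.1]
  · nlinarith [Nat.mul_le_mul hn hn, Nat.mul_le_mul (Nat.mul_le_mul hn hn) hn,
      Nat.mul_le_mul_left (n ^ 2) hn, Nat.mul_le_mul_left n hn,
      Nat.mul_le_mul_left n (Nat.mul_le_mul hn hn)]

end MatrixPrograms

/-! ### Inversion of positive definite matrices by principal exchange steps -/

section Sweep

variable {n : ℕ}

/-- The principal exchange step with pivot `κ`: it solves the equation number `κ` of `v = N u` for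
`u κ` and so exchanges the roles of `u κ` and `v κ`. -/
def sweep (N : Matrix (Fin n) (Fin n) ℝ) (κ : Fin n) : Matrix (Fin n) (Fin n) ℝ :=
  Matrix.of fun i j => N i j -
    (N i κ + (1 : Matrix (Fin n) (Fin n) ℝ) i κ) * (N κ j - (1 : Matrix (Fin n) (Fin n) ℝ) κ j) /
      N κ κ

lemma sweep_mulVec {N : Matrix (Fin n) (Fin n) ℝ} {κ : Fin n} (hN : N κ κ ≠ 0)
    (u : Fin n → ℝ) : sweep N κ *ᵥ Function.update u κ ((N *ᵥ u) κ) =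
      Function.update (N *ᵥ u) κ (u κ) := by
  set v := N *ᵥ u with hv
  set t := v κ - u κ with ht
  have hu : Function.update u κ (v κ) = u + t • Pi.single κ 1 := by
    ext i
    by_cases hi : i = κ
    · subst hi; simp [ht]
    · simp [hi]
  have hNu : N *ᵥ Function.update u κ (v κ) = v + t • N.col κ := by
    rw [hu, mulVec_add, mulVec_smul, mulVec_single_one]
  have hs : sweep N κ = N - (N κ κ)⁻¹ • vecMulVec (fun i => N i κ + (1 : Matrix _ _ ℝ) i κ)
      (fun j => N κ j - (1 : Matrix _ _ ℝ) κ j) := by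
    ext i j
    simp [sweep, vecMulVec_apply]
    ring
  have hdot : (fun j => N κ j - (1 : Matrix (Fin n) (Fin n) ℝ) κ j) ⬝ᵥ Function.update u κ (v κ) =
      t * N κ κ := by
    have h1 : (fun j => N κ j - (1 : Matrix (Fin n) (Fin n) ℝ) κ j) ⬝ᵥ Function.update u κ (v κ) =
        (N *ᵥ Function.update u κ (v κ)) κ -
          ((1 : Matrix (Fin n) (Fin n) ℝ) *ᵥ Function.update u κ (v κ)) κ := by
      simp only [mulVec, dotProduct, sub_mul, Finset.sum_sub_distrib]
    rw [h1, hNu, one_mulVec]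
    simp
  rw [hs, sub_mulVec, smul_mulVec, vecMulVec_mulVec, hdot, hNu]
  ext i
  by_cases hi : i = κ
  · subst hi
    simp [ht]; field_simp; ring
  · simp [hi]; field_simp; ring

/-- The vector with the first `k` entries of `a` and the remaining entries of `b`. -/
def mix (k : ℕ) (a b : Fin n → ℝ) : Fin n → ℝ := fun i => if i.val < k then a i else b i

lemma mix_succ {k : ℕ} (hk : k < n) (a b : Fin n → ℝ) :
    mix (k + 1) a b = Function.update (mix k a b) ⟨k, hk⟩ (a ⟨k, hk⟩) := by
  ext i
  by_cases hi : i = ⟨k, hk⟩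
  · subst hi; simp [mix]
  · have : i.val ≠ k := fun h => hi (Fin.ext h)
    rw [Function.update_of_ne hi]
    simp only [mix, show i.val < k + 1 ↔ i.val < k by omega]

/-- `N` arises from `M` by exchanging the first `k` entries of `x` and `M x`. -/
def Swept (k : ℕ) (M N : Matrix (Fin n) (Fin n) ℝ) : Prop :=
  ∀ x, N *ᵥ mix k (M *ᵥ x) x = mix k x (M *ᵥ x)

/-- The leading principal `k`-by-`k` block of `M` is positive definite. -/
def LeadingPos (k : ℕ) (M : Matrix (Fin n) (Fin n) ℝ) : Prop :=
  ∀ x, (∀ i : Fin n, k ≤ i.val → x i = 0) → x ≠ 0 → 0 < qf M x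

lemma Swept.zero (M : Matrix (Fin n) (Fin n) ℝ) : Swept 0 M M := fun x => by
  have : ∀ a b : Fin n → ℝ, mix 0 a b = b := fun a b => by ext i; simp [mix]
  rw [this, this]

lemma Swept.succ {k : ℕ} (hk : k < n) {M N : Matrix (Fin n) (Fin n) ℝ} (h : Swept k M N)
    (hN : N ⟨k, hk⟩ ⟨k, hk⟩ ≠ 0) : Swept (k + 1) M (sweep N ⟨k, hk⟩) := fun x => by
  have := sweep_mulVec hN (mix k (M *ᵥ x) x)
  rw [h x] at this
  rw [mix_succ hk, mix_succ hk]
  simpa [mix] using this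

/-- After `k` exchange steps the next pivot decides whether positive definiteness extends to the
next leading block: the pivot is the value of the quadratic form at the vector `y` with
`y k = 1`, supported on the first `k + 1` coordinates, for which `M y` vanishes on the first `k`
coordinates. -/
lemma Swept.pivot_pos_iff {k : ℕ} (hk : k < n) {M N : Matrix (Fin n) (Fin n) ℝ} (hM : M.IsSymm)
    (h : Swept k M N) (hl : LeadingPos k M) :
    0 < N ⟨k, hk⟩ ⟨k, hk⟩ ↔ LeadingPos (k + 1) M := by
  have hmix : ∀ c a b : Fin n → ℝ, ∀ i, (mix k a b) i = if i.val < k then a i else b i :=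
    fun _ _ _ _ => rfl
  let L : (Fin n → ℝ) →ₗ[ℝ] (Fin n → ℝ) :=
    { toFun := fun x => mix k (M *ᵥ x) x
      map_add' := fun x y => by
        ext i; simp only [mix, mulVec_add, Pi.add_apply]; split_ifs <;> rfl
      map_smul' := fun c x => by
        ext i; simp only [mix, mulVec_smul, Pi.smul_apply, RingHom.id_apply]; split_ifs <;> rfl }
  have hinj : Function.Injective L := by
    rw [injective_iff_map_eq_zero]
    intro x hx
    have hx' : ∀ i : Fin n, (if i.val < k then (M *ᵥ x) i else x i) = 0 := fun i => congrFun hx i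
    by_contra hne
    refine (hl x (fun i hi => ?_) hne).ne' ?_
    · simpa [not_lt.2 hi] using hx' i
    · refine Finset.sum_eq_zero (s := Finset.univ) fun (i : Fin n) _ => ?_
      by_cases hi : i.val < k
      · have := hx' i; rw [if_pos hi] at this; rw [this, mul_zero]
      · have := hx' i; rw [if_neg hi] at this; rw [this, zero_mul]
  obtain ⟨y, hy⟩ := (LinearMap.injective_iff_surjective.1 hinj) (Pi.single ⟨k, hk⟩ 1)
  have hy' : mix k (M *ᵥ y) y = Pi.single ⟨k, hk⟩ 1 := hy
  have hyi : ∀ i : Fin n, (if i.val < k then (M *ᵥ y) i else y i) =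
      (Pi.single ⟨k, hk⟩ 1 : Fin n → ℝ) i := fun i => congrFun hy' i
  have hylt : ∀ i : Fin n, i.val < k → (M *ᵥ y) i = 0 := fun i hi => by
    have := hyi i
    rwa [if_pos hi, Pi.single_eq_of_ne (by rintro rfl; exact lt_irrefl _ hi)] at this
  have hygt : ∀ i : Fin n, k < i.val → y i = 0 := fun i hi => by
    have := hyi i
    rwa [if_neg (by omega), Pi.single_eq_of_ne (by rintro rfl; exact lt_irrefl _ hi)] at this
  have hyk : y ⟨k, hk⟩ = 1 := by
    have := hyi ⟨k, hk⟩
    simpa using this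
  have hdot : ∀ z : Fin n → ℝ, (∀ i : Fin n, k < i.val → z i = 0) →
      z ⬝ᵥ (M *ᵥ y) = z ⟨k, hk⟩ * (M *ᵥ y) ⟨k, hk⟩ := fun z hz => by
    refine Finset.sum_eq_single_of_mem (⟨k, hk⟩ : Fin n) (Finset.mem_univ _) fun i _ hi => ?_
    rcases lt_trichotomy i.val k with h1 | h1 | h1
    · rw [hylt i h1, mul_zero]
    · exact absurd (Fin.ext h1) hi
    · rw [hz i h1, zero_mul]
  have hpiv : N ⟨k, hk⟩ ⟨k, hk⟩ = (M *ᵥ y) ⟨k, hk⟩ := by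
    have := congrFun (h y) ⟨k, hk⟩
    rw [hy', mulVec_single_one] at this
    simpa [mix] using this
  have hqf : qf M y = N ⟨k, hk⟩ ⟨k, hk⟩ := by
    rw [hpiv]; unfold qf; rw [hdot y hygt, hyk, one_mul]
  constructor
  · intro hpos x hx hne
    set z := x - x ⟨k, hk⟩ • y with hz
    have hzk : z ⟨k, hk⟩ = 0 := by simp [hz, hyk]
    have hzgt : ∀ i : Fin n, k < i.val → z i = 0 := fun i hi => by
      simp [hz, hx i hi, hygt i hi]
    have hzge : ∀ i : Fin n, k ≤ i.val → z i = 0 := fun i hi => by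
      rcases hi.lt_or_eq with h1 | h1
      · exact hzgt i h1
      · rw [show i = ⟨k, hk⟩ from Fin.ext h1.symm, hzk]
    have hxz : x = z + x ⟨k, hk⟩ • y := by rw [hz]; abel
    have hq : qf M x = qf M z + x ⟨k, hk⟩ ^ 2 * N ⟨k, hk⟩ ⟨k, hk⟩ := by
      have hcross : z ⬝ᵥ (M *ᵥ y) = 0 := by rw [hdot z hzgt, hzk, zero_mul]
      have hcross' : y ⬝ᵥ (M *ᵥ z) = 0 := by rw [← hcross]; exact dot_mulVec_comm hM _ _
      conv_lhs => rw [hxz]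
      unfold qf at hqf ⊢
      simp only [mulVec_add, mulVec_smul, dotProduct_add, add_dotProduct, smul_dotProduct,
        dotProduct_smul, smul_eq_mul, hcross, hcross', hqf]
      ring
    rw [hq]
    by_cases hxk : x ⟨k, hk⟩ = 0
    · have : z = x := by rw [hz, hxk]; simp
      have hzne : z ≠ 0 := by rw [this]; exact hne
      have := hl z hzge hzne
      positivity
    · have hz0 : 0 ≤ qf M z := by
        by_cases hz0 : z = 0
        · rw [hz0]; simp [qf]
        · exact (hl z hzge hz0).le
      have := mul_pos (sq_pos_of_ne_zero hxk) hpos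
      linarith
  · intro hl'
    rw [← hqf]
    refine hl' y (fun i hi => hygt i hi) fun h0 => ?_
    rw [h0] at hyk
    simp at hyk

lemma LeadingPos.of_posDef {M : Matrix (Fin n) (Fin n) ℝ} (hM : M.PosDef) (k : ℕ) :
    LeadingPos k M := fun _ _ hx => qf_pos hM hx

lemma LeadingPos.posDef {M : Matrix (Fin n) (Fin n) ℝ} (hM : M.IsSymm) (h : LeadingPos n M) :
    M.PosDef :=
  posDef_iff_qf.2 ⟨hM, fun x hx => h x (fun i hi => absurd i.2 (not_lt.2 hi)) hx⟩

lemma Swept.eq_inv {M N : Matrix (Fin n) (Fin n) ℝ} (h : Swept n M N) : N = M⁻¹ := by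
  symm
  refine Matrix.inv_eq_left_inv (Matrix.ext_of_mulVec_single fun i => ?_)
  have : ∀ a b : Fin n → ℝ, mix n a b = a := fun a b => by ext i; simp [mix]
  have h1 := h (Pi.single i 1)
  rw [this, this] at h1
  rw [← mulVec_mulVec, h1, one_mulVec]

end Sweep

section Invert

variable {n : ℕ} {a : AState n} {Q : AState n → Prop}

/-- matrix `w :=` exchange step applied to matrix `w`, with the pivot index in counter `6` and the
pivot in scalar `4`; the matrix `4` is the identity and the matrix `5` a buffer -/
def sweepProg (w : ℕ) : Prog :=
  .seq (fill 5 (.seq (ld 0 w 3 4) (.seq (ld 1 w 3 6) (.seq (ld 2 4 3 6) (.seq (sop .add 1 1 2)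
    (.seq (ld 2 w 6 4) (.seq (ld 3 4 6 4) (.seq (sop .sub 2 2 3) (.seq (sop .mul 1 1 2)
      (.seq (sop .div 1 1 4) (sop .sub 0 0 1))))))))))) (fill w (ld 0 5 3 4))

lemma Run.sweepProg {w : ℕ} (hn : 1 ≤ n) (hw : w < 24) (hw5 : w ≠ 5)
    (hid : a.m 4 = 1) {κ : Fin n} (hκ : a.c 6 = κ) (hpiv : a.s 4 = a.m w κ κ)
    (hne : a.m w κ κ ≠ 0)
    (h : ∀ a', (∀ b, b ≠ 5 → b ≠ w → a'.m b = a.m b) → (∀ k, 4 ≤ k → a'.s k = a.s k) →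
      a'.c 6 = a.c 6 → a'.m w = sweep (a.m w) κ → Q a') :
    Run (spaceBound n) (sweepProg w) (54 * n ^ 2) Q a := by
  refine Run.mono (Run.seq (T := n * (n * (26 + 4 + 2) + 2 + 2) + 2)
    (T' := n * (n * (4 + 4 + 2) + 2 + 2) + 2)
    (Run.fill (by norm_num) (sweep (a.m w) κ) ?_ fun a₁ h₁ =>
      Run.fill hw (sweep (a.m w) κ) ?_ fun a₂ h₂ => ?_)) ?_ fun _ h => h
  · intro I J a' hm hs hc h3 h4
    have h6 : a'.c 6 = κ := hc.trans hκ
    refine Run.seq (T := 4) (T' := 22) (Run.ld (I := I) (J := J) (by norm_num) hw (by norm_num)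
      (by norm_num) (by exact h3) (by exact h4) ?_)
    refine Run.seq (T := 4) (T' := 18) (Run.ld (I := I) (J := κ) (by norm_num) hw (by norm_num)
      (by norm_num) (by exact h3) (by exact h6) ?_)
    refine Run.seq (T := 4) (T' := 14) (Run.ld (I := I) (J := κ) (by norm_num) (by norm_num)
      (by norm_num) (by norm_num) (by exact h3) (by exact h6) ?_)
    refine Run.seq (T := 1) (T' := 13) (Run.sop (by norm_num) (by norm_num) (by norm_num)
      (by simp) ?_)
    refine Run.seq (T := 4) (T' := 9) (Run.ld (I := κ) (J := J) (by norm_num) hw (by norm_num)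
      (by norm_num) (by exact h6) (by exact h4) ?_)
    refine Run.seq (T := 4) (T' := 5) (Run.ld (I := κ) (J := J) (by norm_num) (by norm_num)
      (by norm_num) (by norm_num) (by exact h6) (by exact h4) ?_)
    refine Run.seq (T := 1) (T' := 4) (Run.sop (by norm_num) (by norm_num) (by norm_num)
      (by simp) ?_)
    refine Run.seq (T := 1) (T' := 3) (Run.sop (by norm_num) (by norm_num) (by norm_num)
      (by simp) ?_)
    refine Run.seq (T := 1) (T' := 2) (Run.sop (by norm_num) (by norm_num) (by norm_num) ?_ ?_)
    · simpa [hs, hpiv] using hne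
    refine Run.mono (Run.sop (by norm_num) (by norm_num) (by norm_num) (by simp)
      ⟨rfl, fun k hk => ?_, rfl, rfl, rfl, ?_⟩) (by norm_num) fun _ h => h
    · simp [Function.update_of_ne (show k ≠ 0 by omega),
        Function.update_of_ne (show k ≠ 1 by omega),
        Function.update_of_ne (show k ≠ 2 by omega), Function.update_of_ne (show k ≠ 3 by omega)]
    · simp [RealOp.eval, sweep, hm w hw5, hm 4 (by norm_num), hid, hs 4 le_rfl, hpiv]
  · intro I J a' hm hs hc h3 h4
    refine Run.ld (I := I) (J := J) (by norm_num) (by norm_num) (by norm_num)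
      (by norm_num) (by exact h3) (by exact h4) ⟨rfl, fun k hk => ?_, rfl, rfl, rfl, ?_⟩
    · simp [Function.update_of_ne (show k ≠ 0 by omega)]
    · simp [hm 5 (Ne.symm hw5), h₁.m_eq]
  · refine h a₂ (fun b hb5 hbw => ?_) (fun k hk => (h₂.s_eq k hk).trans (h₁.s_eq k hk))
      (h₂.c_eq.trans h₁.c_eq) ?_
    · rw [h₂.m_eq, Function.update_of_ne hbw, h₁.m_eq, Function.update_of_ne hb5]
    · rw [h₂.m_eq, Function.update_self]
  · nlinarith [Nat.mul_le_mul hn hn, Nat.mul_le_mul (Nat.mul_le_mul hn hn) hn,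
      Nat.mul_le_mul_left (n ^ 2) hn, Nat.mul_le_mul_left n hn,
      Nat.mul_le_mul_left n (Nat.mul_le_mul hn hn)]

/-- Test whether the matrix `w` is positive definite, with the answer in scalar `5`, and replace it
by its inverse if it is. The matrix `4` is the identity, the matrix `5` a buffer, and the scalar
`6` is zero. -/
def invert (w : ℕ) : Prog :=
  .seq (sconst 5 1) (forC 6 (.seq (ld 4 w 6 6) (ifS 6 4 (sweepProg w) (sconst 5 0))))

lemma Run.invert {w : ℕ} (hn : 1 ≤ n) (hw : w < 24) (hw4 : w ≠ 4) (hw5 : w ≠ 5)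
    (hid : a.m 4 = 1) (hzero : a.s 6 = 0) (hsymm : (a.m w).IsSymm)
    (h : ∀ a', (∀ b, b ≠ 5 → b ≠ w → a'.m b = a.m b) → (∀ k, 6 ≤ k → a'.s k = a.s k) →
      ((a.m w).PosDef → a'.s 5 = 1 ∧ a'.m w = (a.m w)⁻¹) →
      (¬ (a.m w).PosDef → a'.s 5 = 0) → Q a') :
    Run (spaceBound n) (invert w) (64 * n ^ 3) Q a := by
  refine Run.mono (Run.seq (T := 1) (T' := n * (4 + (54 * n ^ 2 + 1) + 2) + 2)
    (Run.sconst (by norm_num) 1 ?_)) ?_ fun _ h => h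
  · refine Run.forC (by norm_num) (fun k a' => (∀ b, b ≠ 5 → b ≠ w → a'.m b = a.m b) ∧
      (∀ k, 6 ≤ k → a'.s k = a.s k) ∧
      ((a'.s 5 = 1 ∧ Swept k (a.m w) (a'.m w) ∧ LeadingPos k (a.m w)) ∨
        (a'.s 5 = 0 ∧ ¬ (a.m w).PosDef))) ?_ ?_ ?_
    · refine ⟨fun _ _ _ => rfl, fun k hk => ?_, Or.inl ⟨by simp, Swept.zero _, fun x hx hx' => ?_⟩⟩
      · simp [Function.update_of_ne (show k ≠ 5 by omega)]
      · exact absurd (funext fun i => hx i (Nat.zero_le _)) hx'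
    · rintro k hk a₁ ⟨hm, hs, hI⟩ hc
      refine Run.seq (Run.ld (I := ⟨k, hk⟩) (J := ⟨k, hk⟩) (by norm_num) hw (by norm_num)
        (by norm_num) (by exact hc) (by exact hc) ?_)
      refine Run.ifS (by norm_num) (by norm_num) (fun hlt => ?_) fun hlt => ?_
      · have hpos : 0 < a₁.m w ⟨k, hk⟩ ⟨k, hk⟩ := by simpa [hs 6 le_rfl, hzero] using hlt
        refine Run.sweepProg hn hw hw5 (by exact (hm 4 (by norm_num) hw4.symm).trans hid)
          (κ := ⟨k, hk⟩) (by exact hc) (by simp) (by exact hpos.ne') fun a₂ hm₂ hs₂ hc₂ hw₂ => ?_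
        refine ⟨hc₂.trans hc, fun b hb hb' => (hm₂ b hb hb').trans (hm b hb hb'),
          fun l hl => ?_, ?_⟩
        · have := hs₂ l (by omega)
          rw [show ({ a₂ with c := Function.update a₂.c 6 (k + 1) } : AState n).s l = a₂.s l
            from rfl,
            this, ← hs l hl]
          simp [Function.update_of_ne (show l ≠ 4 by omega)]
        · have h5 : a₂.s 5 = a₁.s 5 := by rw [hs₂ 5 (by norm_num)]; simp
          rcases hI with ⟨h1, h2, h3⟩ | ⟨h1, h2⟩
          · refine Or.inl ⟨h5.trans h1, ?_, (h2.pivot_pos_iff hk hsymm h3).1 hpos⟩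
            exact hw₂ ▸ h2.succ hk hpos.ne'
          · exact Or.inr ⟨h5.trans h1, h2⟩
      · have hpos : ¬ 0 < a₁.m w ⟨k, hk⟩ ⟨k, hk⟩ := by simpa [hs 6 le_rfl, hzero] using hlt
        refine Run.mono (Run.sconst (by norm_num) 0
          ⟨hc, hm, fun l hl => ?_, Or.inr ⟨by simp, ?_⟩⟩) (by nlinarith) fun _ h => h
        · simp [Function.update_of_ne (show l ≠ 4 by omega),
            Function.update_of_ne (show l ≠ 5 by omega), hs l hl]
        · rcases hI with ⟨h1, h2, h3⟩ | ⟨h1, h2⟩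
          · exact fun hpd => hpos ((h2.pivot_pos_iff hk hsymm h3).2 (LeadingPos.of_posDef hpd _))
          · exact h2
    · rintro a' ⟨hm, hs, hI⟩
      rcases hI with ⟨h1, h2, h3⟩ | ⟨h1, h2⟩
      · exact h a' hm hs (fun _ => ⟨h1, h2.eq_inv⟩) fun h' => absurd (h3.posDef hsymm) h'
      · exact h a' hm hs (fun h' => absurd h' h2) fun _ => h1
  · nlinarith [Nat.mul_le_mul hn hn, Nat.mul_le_mul (Nat.mul_le_mul hn hn) hn,
      Nat.mul_le_mul_left (n ^ 2) hn, Nat.mul_le_mul_left n hn,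
      Nat.mul_le_mul_left n (Nat.mul_le_mul hn hn)]

end Invert

/-! ### The doubling iteration -/

section Doubling

variable {n : ℕ} {A R Q a G H P : Matrix (Fin n) (Fin n) ℝ}

lemma closedLoop_unique (hR : R.PosDef) (hP : P.PosSemidef) {F : Matrix (Fin n) (Fin n) ℝ}
    (hF : (R + P) * F = R * A) : closedLoop A R P = F := by
  rw [closedLoop, ← hF, ← Matrix.mul_assoc,
    nonsing_inv_mul _ (isUnit_det_of_posDef (hR.add_posSemidef hP)), Matrix.one_mul]

lemma posDef_doubling (hG : G.PosDef) (hH : H.PosSemidef) (a : Matrix (Fin n) (Fin n) ℝ) :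
    (G + a * (G⁻¹ + H)⁻¹ * aᵀ).PosDef := by
  refine hG.add_posSemidef ?_
  have := (hG.inv.add_posSemidef hH).inv.posSemidef.mul_mul_conjTranspose_same a
  rwa [conjTranspose_eq_transpose_of_trivial] at this

/-- Two Riccati steps with the data `(a, G, H)` amount to one Riccati step with the doubled
data. -/
lemma riccatiMap_doubling (hG : G.PosDef) (hH : H.PosSemidef) (hP : P.PosSemidef) :
    riccatiMap a G⁻¹ H (riccatiMap a G⁻¹ H P) =
      riccatiMap (a * ((G⁻¹ + H)⁻¹ * (G⁻¹ * a))) (G + a * (G⁻¹ + H)⁻¹ * aᵀ)⁻¹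
        (H + aᵀ * (H * ((G⁻¹ + H)⁻¹ * (G⁻¹ * a)))) P := by
  have hR := hG.inv
  have hS := hR.add_posSemidef hH
  have hG' := posDef_doubling hG hH a
  have hP1 : (riccatiMap a G⁻¹ H P).PosSemidef := posSemidef_riccatiMap hR hH hP
  have e1 := mul_closedLoop (A := a) hR hP
  have e2 := mul_closedLoop (A := a) hR hP1
  set F1 := closedLoop a G⁻¹ P with hF1
  set F2 := closedLoop a G⁻¹ (riccatiMap a G⁻¹ H P) with hF2
  set W := (G⁻¹ + H)⁻¹ with hW
  set Z := W * (G⁻¹ * a) with hZ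
  have hGR : G * G⁻¹ = 1 := mul_nonsing_inv _ (isUnit_det_of_posDef hG)
  have hWS : W * (G⁻¹ + H) = 1 := nonsing_inv_mul _ (isUnit_det_of_posDef hS)
  have hSW : (G⁻¹ + H) * W = 1 := mul_nonsing_inv _ (isUnit_det_of_posDef hS)
  have hWs : Wᵀ = W := hS.inv.symm'.eq
  have hRs : (G⁻¹)ᵀ = G⁻¹ := hR.symm'.eq
  -- the costate of the second step
  set Y := P * (F1 * F2) with hY
  have c1 : F1 * F2 + G * Y = a * F2 := by
    have h1 : G * ((G⁻¹ + P) * F1) * F2 = a * F2 := by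
      rw [e1, ← Matrix.mul_assoc G, hGR, Matrix.one_mul]
    have h2 : G * ((G⁻¹ + P) * F1) * F2 = (G * G⁻¹) * (F1 * F2) + G * (P * (F1 * F2)) := by
      noncomm_ring
    rw [hGR, Matrix.one_mul, h1] at h2
    exact h2.symm
  have hP1Y : riccatiMap a G⁻¹ H P * F2 = H * F2 + aᵀ * Y := by
    rw [riccatiMap, hY]; noncomm_ring
  have c2 : F2 = Z - W * (aᵀ * Y) := by
    have h1 : (G⁻¹ + H) * F2 = G⁻¹ * a - aᵀ * Y := by
      have : (G⁻¹ + H) * F2 = G⁻¹ * F2 + (H * F2 + aᵀ * Y) - aᵀ * Y := by noncomm_ring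
      rw [this, ← hP1Y, ← Matrix.add_mul, e2]
    calc F2 = W * ((G⁻¹ + H) * F2) := by rw [← Matrix.mul_assoc, hWS, Matrix.one_mul]
      _ = _ := by rw [h1, Matrix.mul_sub]
  have c3 : closedLoop (a * Z) (G + a * W * aᵀ)⁻¹ P = F1 * F2 := by
    refine closedLoop_unique hG'.inv hP ?_
    have hu : (G + a * W * aᵀ)⁻¹ * (G + a * W * aᵀ) = 1 :=
      nonsing_inv_mul _ (isUnit_det_of_posDef hG')
    have h1 : F1 * F2 + (G + a * W * aᵀ) * Y = a * Z := by
      have : F1 * F2 + (G + a * W * aᵀ) * Y = F1 * F2 + G * Y + a * (W * (aᵀ * Y)) := by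
        noncomm_ring
      rw [this, c1, c2]; noncomm_ring
    rw [← h1, Matrix.mul_add, ← Matrix.mul_assoc _ (G + a * W * aᵀ), hu, Matrix.one_mul,
      Matrix.add_mul, hY]
  have hZt : Zᵀ = aᵀ - aᵀ * (H * W) := by
    have : G⁻¹ * W = 1 - H * W := by
      rw [← hSW]; noncomm_ring
    rw [hZ, transpose_mul, transpose_mul, hWs, hRs, Matrix.mul_assoc, this, Matrix.mul_sub,
      Matrix.mul_one]
  conv_lhs => rw [riccatiMap]
  conv_rhs => rw [riccatiMap, c3]
  rw [Matrix.mul_assoc, ← hF2, hP1Y, transpose_mul, hZt, Matrix.mul_assoc _ P, ← hY, c2]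
  noncomm_ring

/-- The data `(a, G, H)` encode `2 ^ k` steps of the Riccati iteration of `(A, R, Q)`. -/
structure Doubled (A R Q : Matrix (Fin n) (Fin n) ℝ) (k : ℕ)
    (a G H : Matrix (Fin n) (Fin n) ℝ) : Prop where
  posDef : G.PosDef
  posSemidef : H.PosSemidef
  riccatiMap_eq : ∀ P : Matrix (Fin n) (Fin n) ℝ, P.PosSemidef →
    riccatiMap a G⁻¹ H P = (riccatiMap A R Q)^[2 ^ k] P

lemma Doubled.zero (hG : G.PosDef) (hQ : Q.PosSemidef) : Doubled A G⁻¹ Q 0 A G Q where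
  posDef := hG
  posSemidef := hQ
  riccatiMap_eq := fun P _ => by simp

lemma Doubled.succ {k : ℕ} (h : Doubled A R Q k a G H) :
    Doubled A R Q (k + 1) (a * ((G⁻¹ + H)⁻¹ * (G⁻¹ * a))) (G + a * (G⁻¹ + H)⁻¹ * aᵀ)
      (H + aᵀ * (H * ((G⁻¹ + H)⁻¹ * (G⁻¹ * a)))) where
  posDef := posDef_doubling h.posDef h.posSemidef a
  posSemidef := by
    have h1 : H + aᵀ * (H * ((G⁻¹ + H)⁻¹ * (G⁻¹ * a))) = riccatiMap a G⁻¹ H H := by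
      rw [riccatiMap, closedLoop, Matrix.mul_assoc]
    rw [h1]
    exact posSemidef_riccatiMap h.posDef.inv h.posSemidef h.posSemidef
  riccatiMap_eq := fun P hP => by
    rw [← riccatiMap_doubling h.posDef h.posSemidef hP,
      h.riccatiMap_eq _ (posSemidef_riccatiMap h.posDef.inv h.posSemidef hP),
      h.riccatiMap_eq P hP, ← Function.iterate_add_apply, pow_succ, mul_two]

lemma Doubled.eq_valueIter {k : ℕ} (h : Doubled A R Q k a G H) : H = valueIter A R Q (2 ^ k) := by
  rw [valueIter, ← h.riccatiMap_eq 0 PosSemidef.zero]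
  simp [riccatiMap]

/-- The a posteriori error bound by which the iteration is stopped. -/
lemma specNorm_closedLoop_sub_le (hR : R.PosDef) (hQ : Q.PosSemidef) (hP : P.PosSemidef)
    (hfix : riccatiMap A R Q P = P) {c ε : ℝ} (hc : 1 ≤ c) (hε : 0 ≤ ε)
    (h1 : (c • (1 : Matrix (Fin n) (Fin n) ℝ) - deadbeat A R Q).PosDef)
    (h2 : (c • R - 1).PosDef) (h3 : (c • Q - deadbeat A R Q).PosDef) (k : ℕ)
    (hk : c ^ 3 * (1 - 1 / c) ^ 2 ^ k ≤ ε ^ 2) :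
    specNorm (closedLoop A R (valueIter A R Q (2 ^ k)) - closedLoop A R P) ≤ ε := by
  have hc0 : 0 < c := by linarith
  have hr : 0 ≤ 1 - 1 / c := by rw [sub_nonneg, div_le_one hc0]; exact hc
  refine specNorm_le_of_forall hε fun x => ?_
  have b1 : ∀ x, qf (deadbeat A R Q) x ≤ c * (x ⬝ᵥ x) := fun x => by
    have := qf_nonneg h1.posSemidef x
    rw [qf_sub, qf_smul, qf_one] at this; linarith
  have b2 : ∀ x, x ⬝ᵥ x ≤ c * qf R x := fun x => by
    have := qf_nonneg h2.posSemidef x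
    rw [qf_sub, qf_smul, qf_one] at this; linarith
  have b3 : ∀ x, qf (deadbeat A R Q) x ≤ c * qf Q x := fun x => by
    have := qf_nonneg h3.posSemidef x
    rw [qf_sub, qf_smul] at this; linarith
  obtain ⟨N, hN⟩ : ∃ N, 2 ^ k = N + 1 := ⟨2 ^ k - 1, by have := Nat.one_le_two_pow (n := k); omega⟩
  have key := qf_closedLoop_sub_le hR hQ hP hfix hc b3 N x
  rw [← hN] at key
  set D := closedLoop A R (valueIter A R Q (2 ^ k)) - closedLoop A R P
  have hp : 0 ≤ (1 - 1 / c) ^ 2 ^ k := pow_nonneg hr _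
  calc (D *ᵥ x) ⬝ᵥ (D *ᵥ x) ≤ c * qf R (D *ᵥ x) := b2 _
    _ ≤ c * (c * (1 - 1 / c) ^ 2 ^ k * (c * (x ⬝ᵥ x))) := by
        refine mul_le_mul_of_nonneg_left (key.trans ?_) hc0.le
        exact mul_le_mul_of_nonneg_left (b1 x) (by positivity)
    _ = c ^ 3 * (1 - 1 / c) ^ 2 ^ k * (x ⬝ᵥ x) := by ring
    _ ≤ ε ^ 2 * (x ⬝ᵥ x) := mul_le_mul_of_nonneg_right hk (dot_self_nonneg x)

end Doubling

/-! ### Conditioning -/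

section Conditioning

variable {n : ℕ} {A Q Sw M : Matrix (Fin n) (Fin n) ℝ} {δ κ : ℝ}

lemma qf_le_specNorm (M : Matrix (Fin n) (Fin n) ℝ) (x : Fin n → ℝ) :
    qf M x ≤ specNorm M * (x ⬝ᵥ x) := by
  have h0 := dot_self_nonneg x
  refine abs_le_of_sq_le_sq' ?_ (mul_nonneg (specNorm_nonneg M) h0) |>.2
  calc qf M x ^ 2 ≤ (x ⬝ᵥ x) * ((M *ᵥ x) ⬝ᵥ (M *ᵥ x)) := sq_dot_le _ _
    _ ≤ (x ⬝ᵥ x) * (specNorm M ^ 2 * (x ⬝ᵥ x)) :=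
        mul_le_mul_of_nonneg_left (dot_mulVec_self_le M x) h0
    _ = _ := by ring

/-- An upper bound for a positive definite form is a lower bound for the inverse form. -/
lemma dot_self_le_qf_inv (hM : M.PosDef) {m : ℝ} (h : ∀ x, qf M x ≤ m * (x ⬝ᵥ x))
    (x : Fin n → ℝ) : x ⬝ᵥ x ≤ m * qf M⁻¹ x := by
  have hx0 := dot_self_nonneg x
  rcases hx0.eq_or_lt with h0 | h0
  · have hx : x = 0 := dotProduct_self_eq_zero.1 h0.symm
    simp [hx]
  have e : M *ᵥ (M⁻¹ *ᵥ x) = x := by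
    rw [mulVec_mulVec, mul_nonsing_inv _ (isUnit_det_of_posDef hM), one_mulVec]
  have e2 : qf M (M⁻¹ *ᵥ x) = qf M⁻¹ x := by
    rw [qf, e, qf, dotProduct_comm]
  have h1 := sq_dot_mulVec_le hM.posSemidef x (M⁻¹ *ᵥ x)
  rw [e, e2] at h1
  have h2 : 0 ≤ qf M⁻¹ x := qf_nonneg hM.inv.posSemidef x
  have h3 := mul_le_mul_of_nonneg_right (h x) h2
  refine le_of_mul_le_mul_right ?_ h0
  nlinarith

lemma CondBound.one_le (h : CondBound κ A Q Sw δ) (hδ : 0 < δ) : 1 ≤ κ := by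
  obtain ⟨-, -, -, -, -, h1, h2⟩ := h
  have h3 : 0 < δ⁻¹ := inv_pos.2 hδ
  have h4 : δ * δ⁻¹ = 1 := mul_inv_cancel₀ hδ.ne'
  have h5 : δ * δ⁻¹ ≤ κ * κ := mul_le_mul h1 h2 h3.le (hδ.le.trans h1)
  nlinarith

/-- The test parameter of the algorithm is acceptable as soon as it exceeds a fixed power of the
condition bound. -/
lemma CondBound.tests (h : CondBound κ A Q Sw δ) (hSw : Sw.PosDef) (hQ : Q.PosDef) (hδ : 0 < δ)
    {c : ℝ} (hc : 3 * κ ^ 5 ≤ c) :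
    (c • (1 : Matrix (Fin n) (Fin n) ℝ) - deadbeat A ((2 * δ) • Sw)⁻¹ Q).PosDef ∧
      (c • ((2 * δ) • Sw)⁻¹ - 1).PosDef ∧
      (c • Q - deadbeat A ((2 * δ) • Sw)⁻¹ Q).PosDef := by
  have hκ := h.one_le hδ
  obtain ⟨hA, hQ1, hQ2, hS1, hS2, hd1, hd2⟩ := h
  have hG : ((2 * δ) • Sw).PosDef := posDef_smul hSw (by positivity)
  have hR := posDef_weight hSw hδ
  have hκ0 : 0 < κ := by linarith
  have hpow : ∀ i j : ℕ, i ≤ j → κ ^ i ≤ κ ^ j := fun i j hij => pow_le_pow_right₀ hκ hij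
  have bQ : ∀ x, x ⬝ᵥ x ≤ κ * qf Q x := fun x => by
    have := dot_self_le_qf_inv hQ.inv (m := κ) (fun x => (qf_le_specNorm _ x).trans
      (mul_le_mul_of_nonneg_right hQ2 (dot_self_nonneg x))) x
    rwa [nonsing_inv_nonsing_inv _ (isUnit_det_of_posDef hQ)] at this
  have bR : ∀ x, x ⬝ᵥ x ≤ 2 * κ ^ 2 * qf ((2 * δ) • Sw)⁻¹ x := dot_self_le_qf_inv hG fun x => by
    rw [qf_smul]
    have h0 := dot_self_nonneg x
    calc 2 * δ * qf Sw x ≤ 2 * δ * (κ * (x ⬝ᵥ x)) := by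
          refine mul_le_mul_of_nonneg_left ((qf_le_specNorm _ x).trans ?_) (by positivity)
          exact mul_le_mul_of_nonneg_right hS1 h0
      _ ≤ 2 * κ * (κ * (x ⬝ᵥ x)) := by
          refine mul_le_mul_of_nonneg_right (by linarith) (by positivity)
      _ = _ := by ring
  have hRS : ((2 * δ) • Sw)⁻¹ = (2 * δ)⁻¹ • Sw⁻¹ := by
    refine Matrix.inv_eq_left_inv ?_
    rw [smul_mul, Matrix.mul_smul, smul_smul, nonsing_inv_mul _ (isUnit_det_of_posDef hSw),
      inv_mul_cancel₀ (by positivity), one_smul]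
  have bR' : ∀ x, qf ((2 * δ) • Sw)⁻¹ x ≤ κ ^ 2 * (x ⬝ᵥ x) := fun x => by
    have h0 := dot_self_nonneg x
    rw [hRS, qf_smul, mul_inv]
    calc 2⁻¹ * δ⁻¹ * qf Sw⁻¹ x ≤ 2⁻¹ * δ⁻¹ * (κ * (x ⬝ᵥ x)) := by
          refine mul_le_mul_of_nonneg_left ((qf_le_specNorm _ x).trans ?_) (by positivity)
          exact mul_le_mul_of_nonneg_right hS2 h0
      _ ≤ 1 * κ * (κ * (x ⬝ᵥ x)) := by
          refine mul_le_mul_of_nonneg_right ?_ (by positivity)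
          exact mul_le_mul (by norm_num) hd2 (by positivity) (by norm_num)
      _ = _ := by ring
  have bV : ∀ x, qf (deadbeat A ((2 * δ) • Sw)⁻¹ Q) x ≤ 2 * κ ^ 4 * (x ⬝ᵥ x) := fun x => by
    have h0 := dot_self_nonneg x
    rw [qf_deadbeat]
    have i1 : qf Q x ≤ κ ^ 4 * (x ⬝ᵥ x) := by
      refine (qf_le_specNorm _ x).trans (mul_le_mul_of_nonneg_right (hQ1.trans ?_) h0)
      simpa using hpow 1 4 (by norm_num)
    have i2 : qf ((2 * δ) • Sw)⁻¹ (A *ᵥ x) ≤ κ ^ 4 * (x ⬝ᵥ x) := by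
      calc _ ≤ κ ^ 2 * ((A *ᵥ x) ⬝ᵥ (A *ᵥ x)) := bR' _
        _ ≤ κ ^ 2 * (κ ^ 2 * (x ⬝ᵥ x)) := by
            refine mul_le_mul_of_nonneg_left ((dot_mulVec_self_le A x).trans ?_) (by positivity)
            refine mul_le_mul_of_nonneg_right ?_ h0
            exact pow_le_pow_left₀ (specNorm_nonneg A) hA 2
        _ = _ := by ring
    linarith
  have hVs : (deadbeat A ((2 * δ) • Sw)⁻¹ Q).IsSymm := hQ.symm'.add (IsSymm_conj hR.symm' A)
  have h45 := hpow 4 5 (by norm_num)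
  have h25 := hpow 2 5 (by norm_num)
  have h5 : 0 < κ ^ 5 := by positivity
  have hc0 : 0 < c := by linarith
  have hpos : ∀ x : Fin n → ℝ, x ≠ 0 → 0 < x ⬝ᵥ x := fun x hx =>
    (dot_self_nonneg x).lt_of_ne' fun h => hx (dotProduct_self_eq_zero.1 h)
  refine ⟨posDef_iff_qf.2 ⟨?_, fun x hx => ?_⟩, posDef_iff_qf.2 ⟨?_, fun x hx => ?_⟩,
    posDef_iff_qf.2 ⟨?_, fun x hx => ?_⟩⟩
  · exact (isSymm_one.smul c).sub hVs
  · rw [qf_sub, qf_smul, qf_one]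
    have := bV x
    have := hpos x hx
    have : 2 * κ ^ 4 * (x ⬝ᵥ x) < c * (x ⬝ᵥ x) := mul_lt_mul_of_pos_right (by linarith) this
    linarith
  · exact (hR.symm'.smul c).sub isSymm_one
  · rw [qf_sub, qf_smul, qf_one]
    have := bR x
    have h1 : 0 < qf ((2 * δ) • Sw)⁻¹ x := qf_pos hR hx
    have : 2 * κ ^ 2 * qf ((2 * δ) • Sw)⁻¹ x < c * qf ((2 * δ) • Sw)⁻¹ x :=
      mul_lt_mul_of_pos_right (by linarith) h1
    linarith
  · exact (hQ.symm'.smul c).sub hVs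
  · rw [qf_sub, qf_smul]
    have h1 : 0 < qf Q x := qf_pos hQ hx
    have h2 : 2 * κ ^ 4 * (x ⬝ᵥ x) ≤ 2 * κ ^ 4 * (κ * qf Q x) :=
      mul_le_mul_of_nonneg_left (bQ x) (by positivity)
    have h3 : 2 * κ ^ 5 * qf Q x < c * qf Q x := mul_lt_mul_of_pos_right (by linarith) h1
    have := bV x
    nlinarith

/-- Quadratic convergence: the stopping criterion fails only for small `k`. -/
lemma two_pow_lt_of_lt {c L ε : ℝ} {k : ℕ} (hc : 1 ≤ c) (hε : 0 < ε) (hε1 : ε ≤ 1)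
    (hL : L = Real.log (1 / ε)) (h : ε ^ 2 < c ^ 3 * (1 - 1 / c) ^ 2 ^ k) :
    (2 : ℝ) ^ k < 3 * c ^ 2 * (1 + L) := by
  have hc0 : 0 < c := by linarith
  have hL0 : 0 ≤ L := by
    rw [hL]; exact Real.log_nonneg (by rw [le_div_iff₀ hε]; linarith)
  have h1 : (1 - 1 / c) ^ 2 ^ k ≤ Real.exp (-(2 ^ k / c)) := by
    calc (1 - 1 / c) ^ 2 ^ k ≤ Real.exp (-(1 / c)) ^ 2 ^ k := by
          refine pow_le_pow_left₀ ?_ ?_ _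
          · rw [sub_nonneg, div_le_one hc0]; exact hc
          · have := Real.add_one_le_exp (-(1 / c)); linarith
      _ = Real.exp (-(2 ^ k / c)) := by
          rw [← Real.exp_nat_mul]; congr 1; push_cast; ring
  have h2 : ε ^ 2 < c ^ 3 * Real.exp (-(2 ^ k / c)) :=
    h.trans_le (mul_le_mul_of_nonneg_left h1 (by positivity))
  have h3 := Real.log_lt_log (by positivity) h2
  rw [Real.log_mul (by positivity) (Real.exp_ne_zero _), Real.log_exp, Real.log_pow,
    Real.log_pow] at h3
  have h4 : Real.log ε = -L := by rw [hL, one_div, Real.log_inv]; ring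
  rw [h4] at h3
  have h5 : Real.log c ≤ c := (Real.log_le_sub_one_of_pos hc0).trans (by linarith)
  push_cast at h3
  have h6 : (2 : ℝ) ^ k / c < 3 * c + 2 * L := by linarith
  rw [div_lt_iff₀ hc0] at h6
  nlinarith [mul_nonneg (mul_nonneg hL0 hc0.le) (show (0 : ℝ) ≤ 3 * c - 2 by linarith)]

lemma exists_le_two_pow {X : ℝ} (hX : 1 ≤ X) :
    ∃ N : ℕ, 1 ≤ N ∧ X ≤ 2 ^ N ∧ (N : ℝ) ≤ 2 * Real.log X + 2 := by
  have hlog : 0 ≤ Real.log X := Real.log_nonneg hX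
  have h2 : (1 : ℝ) / 2 < Real.log 2 := by linarith [Real.log_two_gt_d9]
  have h20 : 0 < Real.log 2 := by linarith
  refine ⟨⌈Real.log X / Real.log 2⌉₊ + 1, by omega, ?_, ?_⟩
  · have h3 := Nat.le_ceil (Real.log X / Real.log 2)
    rw [div_le_iff₀ h20] at h3
    have h4 : Real.log X ≤ Real.log (2 ^ (⌈Real.log X / Real.log 2⌉₊ + 1)) := by
      rw [Real.log_pow]; push_cast; nlinarith
    exact (Real.log_le_log_iff (by linarith) (by positivity)).1 h4
  · have h3 := Nat.ceil_lt_add_one (div_nonneg hlog h20.le)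
    have h4 : Real.log X / Real.log 2 ≤ 2 * Real.log X := by
      rw [div_le_iff₀ h20]; nlinarith
    push_cast
    linarith

end Conditioning

/-! ### The program for the LQR gain -/

section Registers

variable {n : ℕ}

/-- set the address registers of the first `k` scalars; register `8` holds `3 n²` -/
def setScalarRegs : ℕ → Prog
  | 0 => .skip
  | k + 1 => .seq (setScalarRegs k) (.seq (.idxConst 9 k) (.idxOp .add (10 + 2 * k) 8 9))

/-- set the address registers of the first `k` matrices; register `7` holds `n²` -/
def setMatrixRegs : ℕ → Prog
  | 0 => .skip
  | k + 1 => .seq (setMatrixRegs k) (.seq (.idxConst 9 k) (.seq (.idxOp .mul 9 9 7)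
      (.seq (.idxConst 2 (if k < 3 then 0 else 16)) (.idxOp .add (11 + 2 * k) 9 2))))

/-- set all constant registers, starting from `n` in register `0` -/
def setRegs : Prog :=
  .seq (.idxConst 1 1) (.seq (.idxOp .mul 7 0 0) (.seq (.idxOp .add 8 7 7)
    (.seq (.idxOp .add 8 8 7) (.seq (setScalarRegs 16) (setMatrixRegs 24)))))

lemma exec_idxConst {S : ℕ} (idx : ℕ → ℕ) (mem : ℕ → ℝ) (i c : ℕ) (hc : c ≤ S) :
    Exec S (.idxConst i c) ⟨idx, mem⟩ ⟨Function.update idx i c, mem⟩ 1 :=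
  Exec.idxConst ⟨idx, mem⟩ i c hc

lemma exec_idxOp {S : ℕ} (idx : ℕ → ℕ) (mem : ℕ → ℝ) (op : IdxOp) (i j k : ℕ) {v : ℕ}
    (hv : op.eval (idx j) (idx k) = v) (hc : v ≤ S) :
    Exec S (.idxOp op i j k) ⟨idx, mem⟩ ⟨Function.update idx i v, mem⟩ 1 := by
  subst hv
  exact Exec.idxOp ⟨idx, mem⟩ op i j k hc

lemma Exec.of_time_eq {S : ℕ} {p : Prog} {σ σ' : RamState} {t t' : ℕ} (h : Exec S p σ σ' t)
    (ht : t = t') : Exec S p σ σ' t' := ht ▸ h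

lemma exec_setScalarRegs (mem : ℕ → ℝ) (k : ℕ) (hk : k ≤ 16) (idx : ℕ → ℕ)
    (h8 : idx 8 = 3 * n ^ 2) :
    ∃ idx', Exec (spaceBound n) (setScalarRegs k) ⟨idx, mem⟩ ⟨idx', mem⟩ (1 + 2 * k) ∧
      (∀ j < k, idx' (10 + 2 * j) = 3 * n ^ 2 + j) ∧ ∀ r < 9, idx' r = idx r := by
  induction k with
  | zero => exact ⟨idx, Exec.skip _, fun j hj => absurd hj (Nat.not_lt_zero _), fun _ _ => rfl⟩
  | succ k ih =>
    obtain ⟨idx', h1, h2, h3⟩ := ih (by omega)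
    have e1 := exec_idxConst (S := spaceBound n) idx' mem 9 k (by unfold spaceBound; omega)
    have e2 := exec_idxOp (S := spaceBound n) (Function.update idx' 9 k) mem .add (10 + 2 * k) 8 9
      (v := 3 * n ^ 2 + k) (by simp [IdxOp.eval, h3 8 (by norm_num), h8])
      (by unfold spaceBound; omega)
    refine ⟨_, (Exec.seq h1 (Exec.seq e1 e2)).of_time_eq (by ring), fun j hj => ?_, fun r hr => ?_⟩
    · by_cases hjk : j = k
      · subst hjk; simp
      · rw [Function.update_of_ne (by omega), Function.update_of_ne (by omega)]
        exact h2 j (by omega)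
    · rw [Function.update_of_ne (by omega), Function.update_of_ne (by omega)]
      exact h3 r hr

lemma exec_setMatrixRegs (mem : ℕ → ℝ) (k : ℕ) (hk : k ≤ 24) (idx : ℕ → ℕ)
    (h7 : idx 7 = n ^ 2) :
    ∃ idx', Exec (spaceBound n) (setMatrixRegs k) ⟨idx, mem⟩ ⟨idx', mem⟩ (1 + 4 * k) ∧
      (∀ j < k, idx' (11 + 2 * j) = baseAddr n j) ∧
      ∀ r, r ≠ 2 → r ≠ 9 → (∀ j, r ≠ 11 + 2 * j) → idx' r = idx r := by
  induction k with
  | zero =>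
    exact ⟨idx, Exec.skip _, fun j hj => absurd hj (Nat.not_lt_zero _), fun _ _ _ _ => rfl⟩
  | succ k ih =>
    obtain ⟨idx', h1, h2, h3⟩ := ih (by omega)
    have hle : k * n ^ 2 ≤ 24 * n ^ 2 := Nat.mul_le_mul_right _ (by omega)
    have h16 : (if k < 3 then 0 else 16) ≤ 16 := by split_ifs <;> omega
    have e1 := exec_idxConst (S := spaceBound n) idx' mem 9 k (by unfold spaceBound; omega)
    have e2 := exec_idxOp (S := spaceBound n) (Function.update idx' 9 k) mem .mul 9 9 7
      (v := k * n ^ 2)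
      (by simp [IdxOp.eval, h3 7 (by norm_num) (by norm_num) (by omega), h7])
      (by unfold spaceBound; omega)
    have e3 := exec_idxConst (S := spaceBound n)
      (Function.update (Function.update idx' 9 k) 9 (k * n ^ 2)) mem 2 (if k < 3 then 0 else 16)
      (by unfold spaceBound; omega)
    have e4 := exec_idxOp (S := spaceBound n) (Function.update (Function.update
      (Function.update idx' 9 k) 9 (k * n ^ 2)) 2 (if k < 3 then 0 else 16)) mem .add
      (11 + 2 * k) 9 2 (v := baseAddr n k) (by simp [IdxOp.eval, baseAddr])
      (by unfold spaceBound baseAddr; omega)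
    refine ⟨_, (Exec.seq h1 (Exec.seq e1 (Exec.seq e2 (Exec.seq e3 e4)))).of_time_eq (by ring),
      fun j hj => ?_, fun r h2r h9r hr => ?_⟩
    · by_cases hjk : j = k
      · subst hjk; simp
      · rw [Function.update_of_ne (by omega), Function.update_of_ne (by omega),
          Function.update_of_ne (by omega), Function.update_of_ne (by omega)]
        exact h2 j (by omega)
    · rw [Function.update_of_ne (hr k), Function.update_of_ne h2r, Function.update_of_ne h9r,
        Function.update_of_ne h9r]
      exact h3 r h2r h9r hr

lemma exec_setRegs {A Q Sw : Matrix (Fin n) (Fin n) ℝ} {δ ε : ℝ} {σ : RamState}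
    (h : IsInput σ A Q Sw δ ε) :
    ∃ (σ' : RamState) (t : ℕ) (a : AState n), Exec (spaceBound n) setRegs σ σ' t ∧ t ≤ 134 ∧
      Rep σ' a ∧ a.m 0 = A ∧ a.m 1 = Q ∧ a.m 2 = Sw ∧ a.s 0 = δ ∧ a.s 1 = ε := by
  obtain ⟨h0, hA, hQ, hS, hδ, hε⟩ := h
  obtain ⟨idx, mem⟩ := σ
  simp only at h0 hδ hε
  have e1 := exec_idxConst (S := spaceBound n) idx mem 1 1 (by unfold spaceBound; omega)
  set i1 := Function.update idx 1 1 with hi1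
  have e2 := exec_idxOp (S := spaceBound n) i1 mem .mul 7 0 0 (v := n ^ 2)
    (by simp [IdxOp.eval, hi1, h0, sq]) (by unfold spaceBound; omega)
  set i2 := Function.update i1 7 (n ^ 2) with hi2
  have e3 := exec_idxOp (S := spaceBound n) i2 mem .add 8 7 7 (v := n ^ 2 + n ^ 2)
    (by simp [IdxOp.eval, hi2]) (by unfold spaceBound; omega)
  set i3 := Function.update i2 8 (n ^ 2 + n ^ 2) with hi3
  have e4 := exec_idxOp (S := spaceBound n) i3 mem .add 8 8 7 (v := 3 * n ^ 2)
    (by simp [IdxOp.eval, hi3, hi2]; ring) (by unfold spaceBound; omega)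
  set i4 := Function.update i3 8 (3 * n ^ 2) with hi4
  obtain ⟨i5, e5, f5, g5⟩ := exec_setScalarRegs (n := n) mem 16 le_rfl i4 (by simp [hi4])
  have h57 : i5 7 = n ^ 2 := by rw [g5 7 (by norm_num)]; simp [hi4, hi3, hi2]
  obtain ⟨i6, e6, f6, g6⟩ := exec_setMatrixRegs (n := n) mem 24 le_rfl i5 h57
  refine ⟨⟨i6, mem⟩, _, ⟨i6, fun b => Matrix.of fun i j => mem (baseAddr n b + i.val * n + j.val),
    fun k => mem (3 * n ^ 2 + k)⟩, Exec.seq e1 (Exec.seq e2 (Exec.seq e3 (Exec.seq e4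
      (Exec.seq e5 e6)))), by norm_num, ⟨?_, ?_, fun _ _ _ => rfl, ?_, f6, fun _ _ => rfl,
      fun _ _ _ _ => rfl⟩, ?_, ?_, ?_, hδ, hε⟩
  · simp only
    rw [g6 0 (by norm_num) (by norm_num) (by omega), g5 0 (by norm_num)]
    simp [hi4, hi3, hi2, hi1, h0]
  · simp only
    rw [g6 1 (by norm_num) (by norm_num) (by omega), g5 1 (by norm_num)]
    simp [hi4, hi3, hi2, hi1]
  · intro k hk
    simp only
    rw [g6 _ (by omega) (by omega) (by omega), f5 k hk]
  · ext i j
    simpa [baseAddr] using hA i j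
  · ext i j
    simpa [baseAddr] using hQ i j
  · ext i j
    simpa [baseAddr] using hS i j

end Registers

section Steps

variable {n : ℕ} {a a' a'' : AState n} {Q : AState n → Prop} {M : Matrix (Fin n) (Fin n) ℝ}

/-- The state `a'` arises from `a` by storing `M` in the matrix `d`; the matrix `5` and the scalars
below `6` are scratch space. -/
structure Upd (d : ℕ) (M : Matrix (Fin n) (Fin n) ℝ) (a a' : AState n) : Prop where
  val : a'.m d = M
  ne : ∀ b, b ≠ 5 → b ≠ d → a'.m b = a.m b
  s_eq : ∀ k, 6 ≤ k → a'.s k = a.s k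

lemma Stored.upd {d : ℕ} (h : Stored d M a a') : Upd d M a a' where
  val := by rw [h.m_eq, Function.update_self]
  ne := fun b _ hb => by rw [h.m_eq, Function.update_of_ne hb]
  s_eq := fun k hk => h.s_eq k (by omega)

/-- The constants used by the program. -/
structure Consts (a : AState n) : Prop where
  zero : a.m 3 = 0
  one : a.m 4 = 1
  neg : a.m 17 = -1
  s_zero : a.s 6 = 0
  s_one : a.s 7 = 1

lemma Upd.consts {d : ℕ} (h : Upd d M a a') (hc : Consts a) (h3 : d ≠ 3) (h4 : d ≠ 4)
    (h17 : d ≠ 17) : Consts a' where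
  zero := by rw [h.ne 3 (by norm_num) h3.symm, hc.zero]
  one := by rw [h.ne 4 (by norm_num) h4.symm, hc.one]
  neg := by rw [h.ne 17 (by norm_num) h17.symm, hc.neg]
  s_zero := by rw [h.s_eq 6 le_rfl, hc.s_zero]
  s_one := by rw [h.s_eq 7 (by norm_num), hc.s_one]

/-- matrix `d :=` matrix `e` -/
def copyM (d e : ℕ) : Prog := mac d e 3 false 3 false

/-- matrix `d :=` matrix `x` `*` matrix `y` -/
def mulM (d x y : ℕ) : Prog := mac d 3 x false y false

lemma Run.copyM {d e : ℕ} (hc : Consts a) (hn : 1 ≤ n) (hd : d < 24) (he : e < 24) (hed : e ≠ d)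
    (hd3 : 3 ≠ d) (h : ∀ a', Upd d (a.m e) a a' → Q a') :
    Run (spaceBound n) (copyM d e) (30 * n ^ 3) Q a :=
  Run.mac hn hd he (by norm_num) (by norm_num) hed hd3 hd3 fun a' h' =>
    h a' (by simpa [opT, hc.zero] using h'.upd)

lemma Run.mulM {d x y : ℕ} (hc : Consts a) (hn : 1 ≤ n) (hd : d < 24) (hx : x < 24) (hy : y < 24)
    (hd3 : 3 ≠ d) (hxd : x ≠ d) (hyd : y ≠ d) (h : ∀ a', Upd d (a.m x * a.m y) a a' → Q a') :
    Run (spaceBound n) (mulM d x y) (30 * n ^ 3) Q a :=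
  Run.mac hn hd (by norm_num) hx hy hd3 hxd hyd fun a' h' =>
    h a' (by simpa [opT, hc.zero] using h'.upd)

lemma Run.invertPosDef {w : ℕ} (hc : Consts a) (hn : 1 ≤ n) (hw : w < 24) (hw4 : w ≠ 4)
    (hw5 : w ≠ 5) (hpd : (a.m w).PosDef) (h : ∀ a', Upd w (a.m w)⁻¹ a a' → Q a') :
    Run (spaceBound n) (RevI.invert w) (64 * n ^ 3) Q a :=
  Run.invert hn hw hw4 hw5 hc.one hc.s_zero hpd.symm' fun a' h1 h2 h3 _ =>
    h a' ⟨(h3 hpd).2, h1, h2⟩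

lemma Run.skip : Q a → Run (spaceBound n) .skip 1 Q a := fun h σ hσ =>
  ⟨σ, 1, a, Exec.skip σ, le_rfl, hσ, h⟩

end Steps

section Setup

variable {n : ℕ} {a : AState n} {P : AState n → Prop} {A Q Sw R : Matrix (Fin n) (Fin n) ℝ}
  {δ ε : ℝ}

/-- compute the scalar constants; the input values `δ` and `ε` are the scalars `0` and `1` -/
def setScalars : Prog :=
  .seq (sop .add 8 0 0) (.seq (sop .mul 9 1 1) (.seq (sconst 6 0) (.seq (sconst 7 1)
    (.seq (sconst 14 (-1)) (sconst 10 1)))))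

/-- compute the constant matrices, `G = 2 δ S_w`, its inverse `R`, the deadbeat value matrix
`V = Q + Aᵀ R A`, and the initial data of the doubling iteration.

The matrices `0`, `1`, `2` are the input data `A`, `Q`, `S_w`, and at the end `0` and `1` hold the
output. The matrices `3`, `4`, `17` hold `0`, `1`, `-1`, the matrices `6` and `7` hold `R` and the
deadbeat value matrix, `9`, `10`, `11` the data `(a, G, H)` of the doubling iteration, and `18` is
a multiple of the identity; the others are buffers. The scalar `4` holds pivots, `5` the answer of
the definiteness test, `6`, `7`, `14` the constants `0`, `1`, `-1`, `8` and `9` the numbers `2 δ`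
and `ε²`, `10` the test parameter `c`, `11` the rate `r`, and `12`, `13` the numbers `c³ r` and
`c³`. -/
def setMatrices : Prog :=
  .seq (diag 3 6) (.seq (diag 4 7) (.seq (diag 17 14) (.seq (diag 18 8) (.seq (mulM 10 18 2)
    (.seq (copyM 6 10) (.seq (invert 6) (.seq (mulM 8 6 0) (.seq (mac 7 1 0 true 8 false)
      (.seq (copyM 9 0) (.seq (copyM 11 1) (sconst 5 0)))))))))))

/-- The matrices `A`, `Q`, `R` and the value matrix of the deadbeat controller are available, and
so are the constants. -/
structure Ready (A R Q : Matrix (Fin n) (Fin n) ℝ) (ε : ℝ) (a : AState n) : Prop where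
  consts : Consts a
  m_zero : a.m 0 = A
  m_one : a.m 1 = Q
  m_six : a.m 6 = R
  m_seven : a.m 7 = deadbeat A R Q
  s_nine : a.s 9 = ε ^ 2

lemma Run.setScalars (h0 : a.s 0 = δ) (h1 : a.s 1 = ε)
    (h : ∀ a', a'.m = a.m → a'.s 6 = 0 → a'.s 7 = 1 → a'.s 8 = 2 * δ → a'.s 9 = ε ^ 2 →
      a'.s 10 = 1 → a'.s 14 = -1 → P a') :
    Run (spaceBound n) setScalars 6 P a := by
  refine Run.seq (T := 1) (T' := 5) (Run.sop (by norm_num) (by norm_num) (by norm_num)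
    (by simp) ?_)
  refine Run.seq (T := 1) (T' := 4) (Run.sop (by norm_num) (by norm_num) (by norm_num)
    (by simp) ?_)
  refine Run.seq (T := 1) (T' := 3) (Run.sconst (by norm_num) _ ?_)
  refine Run.seq (T := 1) (T' := 2) (Run.sconst (by norm_num) _ ?_)
  refine Run.seq (T := 1) (T' := 1) (Run.sconst (by norm_num) _ ?_)
  refine Run.sconst (by norm_num) _ (h _ rfl ?_ ?_ ?_ ?_ ?_ ?_)
  all_goals simp [RealOp.eval, h0, h1]
  all_goals ring

lemma Run.setMatrices (hn : 1 ≤ n) (hG : ((2 * δ) • Sw).PosDef) (m0 : a.m 0 = A) (m1 : a.m 1 = Q)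
    (m2 : a.m 2 = Sw) (s6 : a.s 6 = 0) (s7 : a.s 7 = 1) (s8 : a.s 8 = 2 * δ) (s9 : a.s 9 = ε ^ 2)
    (s10 : a.s 10 = 1) (s14 : a.s 14 = -1)
    (h : ∀ a', Ready A ((2 * δ) • Sw)⁻¹ Q ε a' → a'.m 9 = A → a'.m 10 = (2 * δ) • Sw →
      a'.m 11 = Q → a'.s 5 = 0 → a'.s 10 = 1 → P a') :
    Run (spaceBound n) setMatrices (400 * n ^ 3) P a := by
  refine Run.mono (T := 20 * n ^ 3 + (20 * n ^ 3 + (20 * n ^ 3 + (20 * n ^ 3 + (30 * n ^ 3 +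
    (30 * n ^ 3 + (64 * n ^ 3 + (30 * n ^ 3 + (30 * n ^ 3 + (30 * n ^ 3 + (30 * n ^ 3 + 1)))))))))))
    ?_ (by nlinarith [Nat.one_le_pow 3 n hn]) fun _ h => h
  refine Run.seq (Run.diag hn (by norm_num) (by norm_num) fun a1 u1 => ?_)
  replace u1 := u1.upd
  refine Run.seq (Run.diag hn (by norm_num) (by norm_num) fun a2 u2 => ?_)
  replace u2 := u2.upd
  refine Run.seq (Run.diag hn (by norm_num) (by norm_num) fun a3 u3 => ?_)
  replace u3 := u3.upd
  have hc : Consts a3 :=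
    { zero := by simp [u3.ne, u2.ne, u1.val, s6]
      one := by simp [u3.ne, u2.val, u1.s_eq, s7]
      neg := by simp [u3.val, u2.s_eq, u1.s_eq, s14]
      s_zero := by simp [u3.s_eq, u2.s_eq, u1.s_eq, s6]
      s_one := by simp [u3.s_eq, u2.s_eq, u1.s_eq, s7] }
  refine Run.seq (Run.diag hn (by norm_num) (by norm_num) fun a4 u4 => ?_)
  replace u4 := u4.upd
  have hc4 := u4.consts hc (by norm_num) (by norm_num) (by norm_num)
  refine Run.seq (Run.mulM hc4 hn (by norm_num) (by norm_num) (by norm_num) (by norm_num)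
    (by norm_num) (by norm_num) fun a5 u5 => ?_)
  have hc5 := u5.consts hc4 (by norm_num) (by norm_num) (by norm_num)
  have v5 : a5.m 10 = (2 * δ) • Sw := by
    simp [u5.val, u4.val, u4.ne, u3.ne, u2.ne, u1.ne, u3.s_eq, u2.s_eq, u1.s_eq, s8, m2]
  refine Run.seq (Run.copyM hc5 hn (by norm_num) (by norm_num) (by norm_num) (by norm_num)
    fun a6 u6 => ?_)
  have hc6 := u6.consts hc5 (by norm_num) (by norm_num) (by norm_num)
  have v6 : a6.m 6 = (2 * δ) • Sw := by rw [u6.val, v5]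
  refine Run.seq (Run.invertPosDef hc6 hn (by norm_num) (by norm_num) (by norm_num) (v6 ▸ hG)
    fun a7 u7 => ?_)
  have hc7 := u7.consts hc6 (by norm_num) (by norm_num) (by norm_num)
  refine Run.seq (Run.mulM hc7 hn (by norm_num) (by norm_num) (by norm_num) (by norm_num)
    (by norm_num) (by norm_num) fun a8 u8 => ?_)
  have hc8 := u8.consts hc7 (by norm_num) (by norm_num) (by norm_num)
  refine Run.seq (Run.mac hn (by norm_num) (by norm_num) (by norm_num) (by norm_num)
    (by norm_num) (by norm_num) (by norm_num) fun a9 u9 => ?_)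
  replace u9 := u9.upd
  have hc9 := u9.consts hc8 (by norm_num) (by norm_num) (by norm_num)
  refine Run.seq (Run.copyM hc9 hn (by norm_num) (by norm_num) (by norm_num) (by norm_num)
    fun a10 u10 => ?_)
  have hc10 := u10.consts hc9 (by norm_num) (by norm_num) (by norm_num)
  refine Run.seq (Run.copyM hc10 hn (by norm_num) (by norm_num) (by norm_num) (by norm_num)
    fun a11 u11 => ?_)
  have hc11 := u11.consts hc10 (by norm_num) (by norm_num) (by norm_num)
  refine Run.sconst (by norm_num) 0 (h _ ⟨⟨hc11.zero, hc11.one, hc11.neg, ?_, ?_⟩, ?_, ?_, ?_, ?_,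
    ?_⟩ ?_ ?_ ?_ ?_ ?_)
  · simpa using hc11.s_zero
  · simpa using hc11.s_one
  all_goals simp [u11.val, u11.ne, u11.s_eq, u10.val, u10.ne, u10.s_eq, u9.val, u9.ne, u9.s_eq,
    u8.val, u8.ne, u8.s_eq, u7.val, u7.ne, u7.s_eq, v6, u6.ne, u6.s_eq, v5, u5.ne, u5.s_eq,
    u4.ne, u4.s_eq, u3.ne, u3.s_eq, u2.ne, u2.s_eq, u1.ne, u1.s_eq, m0, m1, s9, s10, opT,
    deadbeat, Matrix.mul_assoc]

end Setup

/-! ### Search for the constant of the error bound -/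

section Search

variable {n : ℕ} {a a' a'' : AState n} {P : AState n → Prop} {A Q R : Matrix (Fin n) (Fin n) ℝ}
  {ε : ℝ}

/-- Two states agree except for scratch data and the test parameter, scalar `10`. -/
structure SameData (a a' : AState n) : Prop where
  m_eq : ∀ b, b ≠ 5 → b ≠ 15 → b ≠ 18 → b ≠ 19 → a'.m b = a.m b
  s_eq : ∀ k, 6 ≤ k → k ≠ 10 → a'.s k = a.s k

lemma SameData.trans (h : SameData a a') (h' : SameData a' a'') : SameData a a'' where
  m_eq := fun b h1 h2 h3 h4 => (h'.m_eq b h1 h2 h3 h4).trans (h.m_eq b h1 h2 h3 h4)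
  s_eq := fun k h1 h2 => (h'.s_eq k h1 h2).trans (h.s_eq k h1 h2)

lemma SameData.consts (h : SameData a a') (hc : Consts a) : Consts a' where
  zero := by rw [h.m_eq] <;> first | exact hc.zero | norm_num
  one := by rw [h.m_eq] <;> first | exact hc.one | norm_num
  neg := by rw [h.m_eq] <;> first | exact hc.neg | norm_num
  s_zero := by rw [h.s_eq] <;> first | exact hc.s_zero | norm_num
  s_one := by rw [h.s_eq] <;> first | exact hc.s_one | norm_num

lemma SameData.ready (h : SameData a a') (hr : Ready A R Q ε a) : Ready A R Q ε a' where
  consts := h.consts hr.consts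
  m_zero := by rw [h.m_eq] <;> first | exact hr.m_zero | norm_num
  m_one := by rw [h.m_eq] <;> first | exact hr.m_one | norm_num
  m_six := by rw [h.m_eq] <;> first | exact hr.m_six | norm_num
  m_seven := by rw [h.m_eq] <;> first | exact hr.m_seven | norm_num
  s_nine := by rw [h.s_eq] <;> first | exact hr.s_nine | norm_num

/-- test whether `c N - M ≻ 0`, for the matrices `N` and `M` number `x` and `y`, where the matrix
`18` is `c` times the identity; the answer is stored in scalar `5` -/
def testPosDef (x y : ℕ) : Prog :=
  .seq (mulM 15 18 x) (.seq (mac 19 15 17 false y false) (invert 19))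

lemma Run.testPosDef {x y : ℕ} {c : ℝ} (hc : Consts a) (hn : 1 ≤ n) (hx : x < 15) (hy : y < 15)
    (hy5 : y ≠ 5) (h18 : a.m 18 = c • (1 : Matrix (Fin n) (Fin n) ℝ))
    (hxs : (a.m x).IsSymm) (hys : (a.m y).IsSymm)
    (h : ∀ a', SameData a a' → a'.s 10 = a.s 10 → a'.m 18 = a.m 18 →
      ((c • a.m x - a.m y).PosDef → a'.s 5 = 1) → (¬ (c • a.m x - a.m y).PosDef → a'.s 5 = 0) →
      P a') :
    Run (spaceBound n) (testPosDef x y) (124 * n ^ 3) P a := by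
  refine Run.mono (T := 30 * n ^ 3 + (30 * n ^ 3 + 64 * n ^ 3)) ?_ (by omega) fun _ h => h
  refine Run.seq (Run.mulM hc hn (by norm_num) (by norm_num) (by omega) (by norm_num)
    (by norm_num) (by omega) fun a1 u1 => ?_)
  refine Run.seq (Run.mac hn (by norm_num) (by norm_num) (by norm_num) (by omega)
    (by norm_num) (by norm_num) (by omega) fun a2 u2 => ?_)
  replace u2 := u2.upd
  have hc1 := u1.consts hc (by norm_num) (by norm_num) (by norm_num)
  have hc2 := u2.consts hc1 (by norm_num) (by norm_num) (by norm_num)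
  have v : a2.m 19 = c • a.m x - a.m y := by
    rw [u2.val, u1.val, hc1.neg, u1.ne y hy5 (by omega), h18]
    simp [opT, sub_eq_add_neg]
  refine Run.invert hn (by norm_num) (by norm_num) (by norm_num) hc2.one hc2.s_zero
    (v ▸ (hxs.smul c).sub hys) fun a3 f3 g3 p3 q3 => ?_
  rw [v] at p3 q3
  refine h a3 ⟨fun b h5 h15 _ h19 => ?_, fun k hk _ => ?_⟩ ?_ ?_ (fun hp => (p3 hp).1) q3
  · rw [f3 b h5 h19, u2.ne b h5 h19, u1.ne b h5 h15]
  · rw [g3 k hk, u2.s_eq k hk, u1.s_eq k hk]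
  · rw [g3 _ (by norm_num), u2.s_eq _ (by norm_num), u1.s_eq _ (by norm_num)]
  · rw [f3 _ (by norm_num) (by norm_num), u2.ne _ (by norm_num) (by norm_num),
      u1.ne _ (by norm_num) (by norm_num)]

/-- The test parameter `c` certifies the error bound of the iteration. -/
def Certified (A R Q : Matrix (Fin n) (Fin n) ℝ) (c : ℝ) : Prop :=
  (c • (1 : Matrix (Fin n) (Fin n) ℝ) - deadbeat A R Q).PosDef ∧ (c • R - 1).PosDef ∧
    (c • Q - deadbeat A R Q).PosDef

/-- double the test parameter until it is certified -/
def search : Prog :=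
  whileS 5 7 (.seq (sop .add 10 10 10) (.seq (diag 18 10) (.seq (testPosDef 4 7)
    (ifS 5 7 .skip (.seq (testPosDef 6 4)
      (ifS 5 7 .skip (testPosDef 1 7)))))))

lemma Run.search {B : ℝ} {N : ℕ} (hr : Ready A R Q ε a) (hn : 1 ≤ n) (hR : R.PosDef)
    (hQ : Q.PosDef) (hflag : a.s 5 = 0) (hs : a.s 10 = 1) (hB : 1 ≤ B)
    (hcert : ∀ c, B ≤ c → Certified A R Q c) (hN1 : 1 ≤ N) (hN : B ≤ 2 ^ N)
    (h : ∀ a', SameData a a' → 1 ≤ a'.s 10 → a'.s 10 ≤ 2 * B → Certified A R Q (a'.s 10) → P a') :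
    Run (spaceBound n) search (N * (400 * n ^ 3 + 1) + 1) P a := by
  have hVs : (deadbeat A R Q).IsSymm := hQ.symm'.add (IsSymm_conj hR.symm' A)
  refine Run.whileS (by norm_num) (by norm_num) (fun i a' => SameData a a' ∧ a'.s 10 = 2 ^ i ∧
    (2 : ℝ) ^ i ≤ 2 * B ∧ ((a'.s 5 = 1 ∧ Certified A R Q (2 ^ i)) ∨
      (a'.s 5 = 0 ∧ (i = 0 ∨ ¬ Certified A R Q (2 ^ i))))) ?_ ?_ ?_
  · exact ⟨⟨fun _ _ _ _ _ => rfl, fun _ _ _ => rfl⟩, by simpa using hs, by simp; linarith,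
      Or.inr ⟨hflag, Or.inl rfl⟩⟩
  · rintro i a1 ⟨hsd, hc, hle, hI⟩ hlt
    have hr1 := hsd.ready hr
    rw [hr1.consts.s_one] at hlt
    have hi : i = 0 ∨ ¬ Certified A R Q (2 ^ i) := by
      rcases hI with ⟨h1, -⟩ | ⟨-, h2⟩
      · rw [h1] at hlt; exact absurd hlt (lt_irrefl _)
      · exact h2
    have hltB : i = 0 ∨ (2 : ℝ) ^ i < B := hi.imp_right fun h => by
      by_contra h'
      exact h (hcert _ (not_lt.1 h'))
    have hle' : (2 : ℝ) ^ (i + 1) ≤ 2 * B := by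
      rw [pow_succ]
      rcases hltB with rfl | h'
      · simp; linarith
      · linarith
    refine ⟨?_, ?_⟩
    · rcases hltB with rfl | h'
      · omega
      · exact (pow_lt_pow_iff_right₀ (one_lt_two (α := ℝ))).1 (h'.trans_le hN)
    refine Run.mono (T := 1 + (20 * n ^ 3 + (124 * n ^ 3 + (124 * n ^ 3 + (124 * n ^ 3 + 1) + 1))))
      ?_ (by nlinarith [Nat.one_le_pow 3 n hn]) fun _ h => h
    set c : ℝ := 2 ^ (i + 1) with hcdef
    refine Run.seq (Run.sop (by norm_num) (by norm_num) (by norm_num) (by simp) ?_)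
    refine Run.seq (Run.diag hn (by norm_num) (by norm_num) fun a2 u2 => ?_)
    replace u2 := u2.upd
    have hsd2 : SameData a1 a2 := by
      refine ⟨fun b h5 _ h18 _ => u2.ne b h5 h18, fun k hk hk' => ?_⟩
      rw [u2.s_eq k hk]
      simp [hk']
    have s2 : a2.s 10 = c := by
      rw [u2.s_eq _ (by norm_num)]
      simp [RealOp.eval, hc, hcdef]
      ring
    have v2 : a2.m 18 = c • (1 : Matrix (Fin n) (Fin n) ℝ) := by
      rw [← s2, u2.s_eq _ (by norm_num), u2.val]
    have hr2 := hsd2.ready hr1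
    -- the postcondition holds as soon as the flag has been set to the right value
    have post : ∀ a', SameData a2 a' → a'.s 10 = a2.s 10 →
        ((a'.s 5 = 1 ∧ Certified A R Q c) ∨ (a'.s 5 = 0 ∧ ¬ Certified A R Q c)) →
        SameData a a' ∧ a'.s 10 = 2 ^ (i + 1) ∧ (2 : ℝ) ^ (i + 1) ≤ 2 * B ∧
          ((a'.s 5 = 1 ∧ Certified A R Q (2 ^ (i + 1))) ∨
            (a'.s 5 = 0 ∧ (i + 1 = 0 ∨ ¬ Certified A R Q (2 ^ (i + 1))))) :=
      fun a' h1 h2 h3 => ⟨hsd.trans (hsd2.trans h1), h2.trans s2, hle',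
        h3.imp_right fun h => ⟨h.1, Or.inr h.2⟩⟩
    refine Run.seq (Run.testPosDef (c := c) hr2.consts hn (by norm_num) (by norm_num) (by norm_num)
      v2 ?_ ?_ fun a3 d3 s3 m3 p3 q3 => ?_)
    · rw [hr2.consts.one]; exact isSymm_one
    · rw [hr2.m_seven]; exact hVs
    rw [hr2.consts.one, hr2.m_seven] at p3 q3
    have hr3 := d3.ready hr2
    refine Run.ifS (by norm_num) (by norm_num) (fun hl => ?_) fun hl => ?_
    · refine Run.mono (Run.skip (post a3 d3 s3 (Or.inr ?_))) (by omega) fun _ h => h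
      have hnp : ¬ (c • (1 : Matrix (Fin n) (Fin n) ℝ) - deadbeat A R Q).PosDef := fun hp => by
        rw [p3 hp, hr3.consts.s_one] at hl; exact lt_irrefl _ hl
      exact ⟨q3 hnp, fun hcc => hnp hcc.1⟩
    have t1 : (c • (1 : Matrix (Fin n) (Fin n) ℝ) - deadbeat A R Q).PosDef := by
      by_contra hp
      rw [q3 hp, hr3.consts.s_one] at hl; exact hl one_pos
    refine Run.seq (Run.testPosDef (c := c) hr3.consts hn (by norm_num) (by norm_num) (by norm_num)
      (m3.trans v2) ?_ ?_ fun a4 d4 s4 m4 p4 q4 => ?_)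
    · rw [hr3.m_six]; exact hR.symm'
    · rw [hr3.consts.one]; exact isSymm_one
    rw [hr3.consts.one, hr3.m_six] at p4 q4
    have hr4 := d4.ready hr3
    refine Run.ifS (by norm_num) (by norm_num) (fun hl => ?_) fun hl => ?_
    · refine Run.mono (Run.skip (post a4 (d3.trans d4) (s4.trans s3) (Or.inr ?_)))
        (by nlinarith [Nat.one_le_pow 3 n hn]) fun _ h => h
      have hnp : ¬ (c • R - 1).PosDef := fun hp => by
        rw [p4 hp, hr4.consts.s_one] at hl; exact lt_irrefl _ hl
      exact ⟨q4 hnp, fun hcc => hnp hcc.2.1⟩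
    have t2 : (c • R - 1).PosDef := by
      by_contra hp
      rw [q4 hp, hr4.consts.s_one] at hl; exact hl one_pos
    refine Run.testPosDef (c := c) hr4.consts hn (by norm_num) (by norm_num) (by norm_num)
      (m4.trans (m3.trans v2)) ?_ ?_ fun a5 d5 s5 m5 p5 q5 =>
        post a5 (d3.trans (d4.trans d5)) (s5.trans (s4.trans s3)) ?_
    · rw [hr4.m_one]; exact hQ.symm'
    · rw [hr4.m_seven]; exact hVs
    rw [hr4.m_one, hr4.m_seven] at p5 q5
    by_cases hp : (c • Q - deadbeat A R Q).PosDef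
    · exact Or.inl ⟨p5 hp, t1, t2, hp⟩
    · exact Or.inr ⟨q5 hp, fun hcc => hp hcc.2.2⟩
  · rintro i a1 ⟨hsd, hc, hle, hI⟩ hlt
    have hr1 := hsd.ready hr
    rw [hr1.consts.s_one] at hlt
    rcases hI with ⟨-, h2⟩ | ⟨h1, -⟩
    · exact h a1 hsd (hc ▸ one_le_pow₀ one_le_two) (hc ▸ hle) (hc ▸ h2)
    · rw [h1] at hlt; exact absurd one_pos hlt

end Search

/-! ### The doubling loop -/

section Iterate

variable {n : ℕ} {a : AState n} {P : AState n → Prop} {A Q R : Matrix (Fin n) (Fin n) ℝ}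
  {ε c : ℝ}

/-- one doubling step for the data `(a, G, H)` in the matrices `9`, `10`, `11` -/
def doublingStep : Prog :=
  .seq (copyM 12 10) (.seq (invert 12) (.seq (mac 13 12 4 false 11 false) (.seq (invert 13)
    (.seq (mulM 14 12 9) (.seq (mulM 15 13 14) (.seq (mulM 16 9 13)
    (.seq (mac 19 10 16 false 9 true) (.seq (copyM 10 19) (.seq (mulM 16 11 15)
    (.seq (mac 19 11 9 true 16 false) (.seq (copyM 11 19) (.seq (mulM 19 9 15)
      (copyM 9 19)))))))))))))

lemma Run.doublingStep {k : ℕ} (hr : Ready A R Q ε a) (hn : 1 ≤ n)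
    (hd : Doubled A R Q k (a.m 9) (a.m 10) (a.m 11))
    (h : ∀ a', Ready A R Q ε a' → Doubled A R Q (k + 1) (a'.m 9) (a'.m 10) (a'.m 11) →
      (∀ k, 6 ≤ k → a'.s k = a.s k) → P a') :
    Run (spaceBound n) doublingStep (488 * n ^ 3) P a := by
  have hc := hr.consts
  refine Run.mono (T := 30 * n ^ 3 + (64 * n ^ 3 + (30 * n ^ 3 + (64 * n ^ 3 + (30 * n ^ 3 +
    (30 * n ^ 3 + (30 * n ^ 3 + (30 * n ^ 3 + (30 * n ^ 3 + (30 * n ^ 3 + (30 * n ^ 3 +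
    (30 * n ^ 3 + (30 * n ^ 3 + 30 * n ^ 3)))))))))))))
    ?_ (by omega) fun _ h => h
  refine Run.seq (Run.copyM hc hn (by norm_num) (by norm_num) (by norm_num) (by norm_num)
    fun a1 u1 => ?_)
  have hc1 := u1.consts hc (by norm_num) (by norm_num) (by norm_num)
  refine Run.seq (Run.invertPosDef hc1 hn (by norm_num) (by norm_num) (by norm_num)
    (by rw [u1.val]; exact hd.posDef) fun a2 u2 => ?_)
  have hc2 := u2.consts hc1 (by norm_num) (by norm_num) (by norm_num)
  refine Run.seq (Run.mac hn (by norm_num) (by norm_num) (by norm_num) (by norm_num)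
    (by norm_num) (by norm_num) (by norm_num) fun a3 u3 => ?_)
  replace u3 := u3.upd
  have hc3 := u3.consts hc2 (by norm_num) (by norm_num) (by norm_num)
  have v3 : a3.m 13 = (a.m 10)⁻¹ + a.m 11 := by
    simp [u3.val, u2.val, u2.ne, u1.val, u1.ne, hc.one, opT]
  refine Run.seq (Run.invertPosDef hc3 hn (by norm_num) (by norm_num) (by norm_num)
    (by rw [v3]; exact hd.posDef.inv.add_posSemidef hd.posSemidef) fun a4 u4 => ?_)
  have hc4 := u4.consts hc3 (by norm_num) (by norm_num) (by norm_num)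
  rw [v3] at u4
  refine Run.seq (Run.mulM hc4 hn (by norm_num) (by norm_num) (by norm_num) (by norm_num)
    (by norm_num) (by norm_num) fun a5 u5 => ?_)
  have hc5 := u5.consts hc4 (by norm_num) (by norm_num) (by norm_num)
  refine Run.seq (Run.mulM hc5 hn (by norm_num) (by norm_num) (by norm_num) (by norm_num)
    (by norm_num) (by norm_num) fun a6 u6 => ?_)
  have hc6 := u6.consts hc5 (by norm_num) (by norm_num) (by norm_num)
  refine Run.seq (Run.mulM hc6 hn (by norm_num) (by norm_num) (by norm_num) (by norm_num)
    (by norm_num) (by norm_num) fun a7 u7 => ?_)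
  have hc7 := u7.consts hc6 (by norm_num) (by norm_num) (by norm_num)
  refine Run.seq (Run.mac hn (by norm_num) (by norm_num) (by norm_num) (by norm_num)
    (by norm_num) (by norm_num) (by norm_num) fun a8 u8 => ?_)
  replace u8 := u8.upd
  have hc8 := u8.consts hc7 (by norm_num) (by norm_num) (by norm_num)
  refine Run.seq (Run.copyM hc8 hn (by norm_num) (by norm_num) (by norm_num) (by norm_num)
    fun a9 u9 => ?_)
  have hc9 := u9.consts hc8 (by norm_num) (by norm_num) (by norm_num)
  refine Run.seq (Run.mulM hc9 hn (by norm_num) (by norm_num) (by norm_num) (by norm_num)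
    (by norm_num) (by norm_num) fun a10 u10 => ?_)
  have hc10 := u10.consts hc9 (by norm_num) (by norm_num) (by norm_num)
  refine Run.seq (Run.mac hn (by norm_num) (by norm_num) (by norm_num) (by norm_num)
    (by norm_num) (by norm_num) (by norm_num) fun a11 u11 => ?_)
  replace u11 := u11.upd
  have hc11 := u11.consts hc10 (by norm_num) (by norm_num) (by norm_num)
  refine Run.seq (Run.copyM hc11 hn (by norm_num) (by norm_num) (by norm_num) (by norm_num)
    fun a12 u12 => ?_)
  have hc12 := u12.consts hc11 (by norm_num) (by norm_num) (by norm_num)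
  refine Run.seq (Run.mulM hc12 hn (by norm_num) (by norm_num) (by norm_num) (by norm_num)
    (by norm_num) (by norm_num) fun a13 u13 => ?_)
  have hc13 := u13.consts hc12 (by norm_num) (by norm_num) (by norm_num)
  refine Run.copyM hc13 hn (by norm_num) (by norm_num) (by norm_num) (by norm_num)
    fun a14 u14 => ?_
  have hc14 := u14.consts hc13 (by norm_num) (by norm_num) (by norm_num)
  have hs : ∀ k, 6 ≤ k → a14.s k = a.s k := fun k hk => by
    rw [u14.s_eq k hk, u13.s_eq k hk, u12.s_eq k hk, u11.s_eq k hk, u10.s_eq k hk, u9.s_eq k hk,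
      u8.s_eq k hk, u7.s_eq k hk, u6.s_eq k hk, u5.s_eq k hk, u4.s_eq k hk, u3.s_eq k hk,
      u2.s_eq k hk, u1.s_eq k hk]
  -- the values of the intermediate matrices
  have w12 : a2.m 12 = (a.m 10)⁻¹ := by rw [u2.val, u1.val]
  have w14 : a5.m 14 = (a.m 10)⁻¹ * a.m 9 := by
    simp [u5.val, u4.ne, u3.ne, w12, u2.ne, u1.ne]
  have w15 : a6.m 15 = ((a.m 10)⁻¹ + a.m 11)⁻¹ * ((a.m 10)⁻¹ * a.m 9) := by
    simp [u6.val, w14, u5.ne, u4.val]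
  have w16 : a7.m 16 = a.m 9 * ((a.m 10)⁻¹ + a.m 11)⁻¹ := by
    simp [u7.val, u6.ne, u5.ne, u4.val, u4.ne, u3.ne, u2.ne, u1.ne]
  have w10 : a9.m 10 = a.m 10 + a.m 9 * ((a.m 10)⁻¹ + a.m 11)⁻¹ * (a.m 9)ᵀ := by
    simp [u9.val, u8.val, w16, u7.ne, u6.ne, u5.ne, u4.ne, u3.ne, u2.ne, u1.ne, opT]
  have w15' : a9.m 15 = ((a.m 10)⁻¹ + a.m 11)⁻¹ * ((a.m 10)⁻¹ * a.m 9) := by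
    rw [← w15]
    simp [u9.ne, u8.ne, u7.ne]
  have w9 : a9.m 9 = a.m 9 := by
    simp [u9.ne, u8.ne, u7.ne, u6.ne, u5.ne, u4.ne, u3.ne, u2.ne, u1.ne]
  have w11 : a9.m 11 = a.m 11 := by
    simp [u9.ne, u8.ne, u7.ne, u6.ne, u5.ne, u4.ne, u3.ne, u2.ne, u1.ne]
  refine h a14 ⟨hc14, ?_, ?_, ?_, ?_, ?_⟩ ?_ hs
  · rw [← hr.m_zero]
    simp [u14.ne, u13.ne, u12.ne, u11.ne, u10.ne, u9.ne, u8.ne, u7.ne, u6.ne, u5.ne, u4.ne, u3.ne,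
      u2.ne, u1.ne]
  · rw [← hr.m_one]
    simp [u14.ne, u13.ne, u12.ne, u11.ne, u10.ne, u9.ne, u8.ne, u7.ne, u6.ne, u5.ne, u4.ne, u3.ne,
      u2.ne, u1.ne]
  · rw [← hr.m_six]
    simp [u14.ne, u13.ne, u12.ne, u11.ne, u10.ne, u9.ne, u8.ne, u7.ne, u6.ne, u5.ne, u4.ne, u3.ne,
      u2.ne, u1.ne]
  · rw [← hr.m_seven]
    simp [u14.ne, u13.ne, u12.ne, u11.ne, u10.ne, u9.ne, u8.ne, u7.ne, u6.ne, u5.ne, u4.ne, u3.ne,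
      u2.ne, u1.ne]
  · rw [hs 9 (by norm_num), hr.s_nine]
  · have e9 : a14.m 9 = a.m 9 * (((a.m 10)⁻¹ + a.m 11)⁻¹ * ((a.m 10)⁻¹ * a.m 9)) := by
      simp [u14.val, u13.val, u12.ne, u11.ne, u10.ne, w9, w15']
    have e10 : a14.m 10 = a.m 10 + a.m 9 * ((a.m 10)⁻¹ + a.m 11)⁻¹ * (a.m 9)ᵀ := by
      simp [u14.ne, u13.ne, u12.ne, u11.ne, u10.ne, w10]
    have e11 : a14.m 11 = a.m 11 +
        (a.m 9)ᵀ * (a.m 11 * (((a.m 10)⁻¹ + a.m 11)⁻¹ * ((a.m 10)⁻¹ * a.m 9))) := by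
      simp [u14.ne, u13.ne, u12.val, u11.val, u10.val, u10.ne, w9, w11, w15', opT]
    rw [e9, e10, e11]
    exact hd.succ

/-- compute `r = 1 - 1 / c` in scalar `11`, `c³` in scalar `13` and `c³ r` in scalar `12` -/
def setRate : Prog :=
  .seq (sop .div 11 7 10) (.seq (sop .sub 11 7 11) (.seq (sop .mul 13 10 10)
    (.seq (sop .mul 13 13 10) (sop .mul 12 13 11))))

/-- double until `c³ r ≤ ε²`, where `r` is squared in every step -/
def iterate : Prog :=
  whileS 9 12 (.seq doublingStep (.seq (sop .mul 11 11 11) (sop .mul 12 13 11)))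

/-- from the approximation `H` of the value matrix, in matrix `11`, compute the closed loop in
matrix `1` and the gain in matrix `0` -/
def extractGain : Prog :=
  .seq (mac 13 6 4 false 11 false) (.seq (invert 13) (.seq (mulM 14 6 0) (.seq (mulM 1 13 14)
    (.seq (mac 15 1 17 false 0 false) (copyM 0 15)))))

lemma Ready.of_eq {a' : AState n} (hr : Ready A R Q ε a) (hm : a'.m = a.m)
    (hs : ∀ k, 6 ≤ k → k < 10 → a'.s k = a.s k) : Ready A R Q ε a' where
  consts :=
    { zero := by rw [hm, hr.consts.zero]
      one := by rw [hm, hr.consts.one]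
      neg := by rw [hm, hr.consts.neg]
      s_zero := by rw [hs _ (by norm_num) (by norm_num), hr.consts.s_zero]
      s_one := by rw [hs _ (by norm_num) (by norm_num), hr.consts.s_one] }
  m_zero := by rw [hm, hr.m_zero]
  m_one := by rw [hm, hr.m_one]
  m_six := by rw [hm, hr.m_six]
  m_seven := by rw [hm, hr.m_seven]
  s_nine := by rw [hs _ (by norm_num) (by norm_num), hr.s_nine]

lemma Run.setRate (hr : Ready A R Q ε a) (hs : a.s 10 = c) (hc : 1 ≤ c)
    (h : ∀ a', Ready A R Q ε a' → a'.m = a.m → a'.s 11 = 1 - 1 / c → a'.s 13 = c ^ 3 →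
      a'.s 12 = c ^ 3 * (1 - 1 / c) → P a') :
    Run (spaceBound n) setRate 5 P a := by
  have h7 := hr.consts.s_one
  refine Run.seq (T := 1) (T' := 4) (Run.sop (by norm_num) (by norm_num) (by norm_num)
    (fun _ => by rw [hs]; linarith) ?_)
  refine Run.seq (T := 1) (T' := 3) (Run.sop (by norm_num) (by norm_num) (by norm_num)
    (by simp) ?_)
  refine Run.seq (T := 1) (T' := 2) (Run.sop (by norm_num) (by norm_num) (by norm_num)
    (by simp) ?_)
  refine Run.seq (T := 1) (T' := 1) (Run.sop (by norm_num) (by norm_num) (by norm_num)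
    (by simp) ?_)
  refine Run.sop (by norm_num) (by norm_num) (by norm_num) (by simp)
    (h _ (hr.of_eq rfl fun k hk hk' => ?_) rfl ?_ ?_ ?_)
  · simp [Function.update_of_ne (show k ≠ 11 by omega),
      Function.update_of_ne (show k ≠ 12 by omega), Function.update_of_ne (show k ≠ 13 by omega)]
  · simp [RealOp.eval, h7, hs]
  · simp [RealOp.eval, hs]; ring
  · simp [RealOp.eval, h7, hs]; left; ring

lemma Run.iterate {N : ℕ} (hr : Ready A R Q ε a) (hn : 1 ≤ n)
    (hd : Doubled A R Q 0 (a.m 9) (a.m 10) (a.m 11)) (s11 : a.s 11 = 1 - 1 / c)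
    (s13 : a.s 13 = c ^ 3) (s12 : a.s 12 = c ^ 3 * (1 - 1 / c))
    (hN : ∀ k, ε ^ 2 < c ^ 3 * (1 - 1 / c) ^ 2 ^ k → k < N)
    (h : ∀ k a', Ready A R Q ε a' → Doubled A R Q k (a'.m 9) (a'.m 10) (a'.m 11) →
      c ^ 3 * (1 - 1 / c) ^ 2 ^ k ≤ ε ^ 2 → P a') :
    Run (spaceBound n) iterate (N * (490 * n ^ 3 + 1) + 1) P a := by
  refine Run.whileS (by norm_num) (by norm_num) (fun k a' => Ready A R Q ε a' ∧
    Doubled A R Q k (a'.m 9) (a'.m 10) (a'.m 11) ∧ a'.s 11 = (1 - 1 / c) ^ 2 ^ k ∧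
    a'.s 13 = c ^ 3 ∧ a'.s 12 = c ^ 3 * (1 - 1 / c) ^ 2 ^ k) ?_ ?_ ?_
  · exact ⟨hr, hd, by simp [s11], s13, by simp [s12]⟩
  · rintro k a1 ⟨hr1, hd1, e11, e13, e12⟩ hlt
    rw [hr1.s_nine, e12] at hlt
    refine ⟨hN k hlt, Run.mono (T := 488 * n ^ 3 + (1 + 1)) ?_
      (by nlinarith [Nat.one_le_pow 3 n hn]) fun _ h => h⟩
    refine Run.seq (Run.doublingStep hr1 hn hd1 fun a2 hr2 hd2 hs2 => ?_)
    refine Run.seq (Run.sop (by norm_num) (by norm_num) (by norm_num) (by simp) ?_)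
    refine Run.sop (by norm_num) (by norm_num) (by norm_num) (by simp)
      ⟨hr2.of_eq rfl fun k hk hk' => ?_, hd2, ?_, ?_, ?_⟩
    · simp [Function.update_of_ne (show k ≠ 11 by omega),
        Function.update_of_ne (show k ≠ 12 by omega)]
    · simp [RealOp.eval, hs2, e11]; ring
    · simp [hs2, e13]
    · simp [RealOp.eval, hs2, e11, e13]; left; ring
  · rintro k a1 ⟨hr1, hd1, -, -, e12⟩ hlt
    rw [hr1.s_nine, e12] at hlt
    exact h k a1 hr1 hd1 (not_lt.1 hlt)

lemma Run.extractGain (hr : Ready A R Q ε a) (hn : 1 ≤ n) (hR : R.PosDef)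
    (hH : (a.m 11).PosSemidef)
    (h : ∀ a', a'.m 0 = closedLoop A R (a.m 11) - A → a'.m 1 = closedLoop A R (a.m 11) → P a') :
    Run (spaceBound n) extractGain (214 * n ^ 3) P a := by
  have hc := hr.consts
  refine Run.mono (T := 30 * n ^ 3 + (64 * n ^ 3 + (30 * n ^ 3 + (30 * n ^ 3 + (30 * n ^ 3 +
    30 * n ^ 3))))) ?_ (by omega) fun _ h => h
  refine Run.seq (Run.mac hn (by norm_num) (by norm_num) (by norm_num) (by norm_num)
    (by norm_num) (by norm_num) (by norm_num) fun a1 u1 => ?_)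
  replace u1 := u1.upd
  have hc1 := u1.consts hc (by norm_num) (by norm_num) (by norm_num)
  have v1 : a1.m 13 = R + a.m 11 := by simp [u1.val, hc.one, hr.m_six, opT]
  refine Run.seq (Run.invertPosDef hc1 hn (by norm_num) (by norm_num) (by norm_num)
    (by rw [v1]; exact hR.add_posSemidef hH) fun a2 u2 => ?_)
  have hc2 := u2.consts hc1 (by norm_num) (by norm_num) (by norm_num)
  rw [v1] at u2
  refine Run.seq (Run.mulM hc2 hn (by norm_num) (by norm_num) (by norm_num) (by norm_num)
    (by norm_num) (by norm_num) fun a3 u3 => ?_)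
  have hc3 := u3.consts hc2 (by norm_num) (by norm_num) (by norm_num)
  refine Run.seq (Run.mulM hc3 hn (by norm_num) (by norm_num) (by norm_num) (by norm_num)
    (by norm_num) (by norm_num) fun a4 u4 => ?_)
  have hc4 := u4.consts hc3 (by norm_num) (by norm_num) (by norm_num)
  have v4 : a4.m 1 = closedLoop A R (a.m 11) := by
    simp [u4.val, u3.val, u3.ne, u2.val, u2.ne, u1.ne, hr.m_six, hr.m_zero, closedLoop]
  refine Run.seq (Run.mac hn (by norm_num) (by norm_num) (by norm_num) (by norm_num)
    (by norm_num) (by norm_num) (by norm_num) fun a5 u5 => ?_)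
  replace u5 := u5.upd
  have hc5 := u5.consts hc4 (by norm_num) (by norm_num) (by norm_num)
  refine Run.copyM hc5 hn (by norm_num) (by norm_num) (by norm_num) (by norm_num)
    fun a6 u6 => h a6 ?_ ?_
  · simp [u6.val, u5.val, v4, hc4.neg, u4.ne, u3.ne, u2.ne, u1.ne, hr.m_zero, opT, sub_eq_add_neg]
  · rw [← v4]
    simp [u6.ne, u5.ne]

end Iterate

/-! ### Correctness and running time -/

section Main

variable {n : ℕ}

/-- The program computing the LQR gain `dlqr(A, I, Q, (2 δ S_w)⁻¹)` and the matrix `θ*_δ`. -/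
def gainProgram : Prog :=
  .seq setRegs (.seq setScalars (.seq setMatrices (.seq search (.seq setRate (.seq iterate
    extractGain)))))

lemma exec_gainProgram {A Q Sw : Matrix (Fin n) (Fin n) ℝ} {δ ε κ : ℝ} (hn : 1 ≤ n)
    (hSw : Sw.PosDef) (hQ : Q.PosDef) (hδ : 0 < δ) (hε : 0 < ε) (hε1 : ε ≤ 1)
    (hκ : CondBound κ A Q Sw δ) {σ : RamState} (hσ : IsInput σ A Q Sw δ ε) {N : ℕ} (hN1 : 1 ≤ N)
    (hN : 108 * κ ^ 10 * (1 + Real.log (1 / ε)) ≤ 2 ^ N) :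
    ∃ (σ' : RamState) (t : ℕ) (K : Matrix (Fin n) (Fin n) ℝ),
      Exec (spaceBound n) gainProgram σ σ' t ∧ t ≤ 900 * n ^ 3 * (1 + N) ∧
      Stores σ' 0 K ∧ Stores σ' (n ^ 2) (A + K) ∧
      specNorm (A + K - thetaStar Sw Q A δ) ≤ ε := by
  have hκ1 := hκ.one_le hδ
  have hG : ((2 * δ) • Sw).PosDef := posDef_smul hSw (by positivity)
  have hR := posDef_weight hSw hδ
  have hL : 0 ≤ Real.log (1 / ε) := Real.log_nonneg (by rw [le_div_iff₀ hε]; linarith)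
  have h5 : 1 ≤ κ ^ 5 := one_le_pow₀ hκ1
  have h10 : κ ^ 5 ≤ κ ^ 10 := pow_le_pow_right₀ hκ1 (by norm_num)
  have hBN : 3 * κ ^ 5 ≤ 2 ^ N := by
    refine le_trans ?_ hN
    nlinarith [mul_nonneg (show (0 : ℝ) ≤ κ ^ 10 by positivity) hL]
  obtain ⟨σ₁, t₁, a, e1, ht1, hrep, m0, m1, m2, s0, s1⟩ := exec_setRegs hσ
  have hrun : Run (spaceBound n) (.seq setScalars (.seq setMatrices (.seq search (.seq setRate
      (.seq iterate extractGain))))) (6 + (400 * n ^ 3 + ((N * (400 * n ^ 3 + 1) + 1) + (5 +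
        ((N * (490 * n ^ 3 + 1) + 1) + 214 * n ^ 3))))) (fun a' =>
        a'.m 1 = A + a'.m 0 ∧ specNorm (a'.m 1 - thetaStar Sw Q A δ) ≤ ε) a := by
    refine Run.seq (Run.setScalars s0 s1 fun b1 hm b6 b7 b8 b9 b10 b14 => ?_)
    refine Run.seq (Run.setMatrices hn hG (hm ▸ m0) (hm ▸ m1) (hm ▸ m2) b6 b7 b8 b9 b10 b14
      fun b2 hr2 v9 v10 v11 w5 w10 => ?_)
    refine Run.seq (Run.search hr2 hn hR hQ w5 w10 (B := 3 * κ ^ 5) (by linarith)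
      (fun c hc => hκ.tests hSw hQ hδ hc) hN1 hBN fun b3 hsd hc1 hc2 hcert => ?_)
    refine Run.seq (Run.setRate (hsd.ready hr2) rfl hc1 fun b4 hr4 hm4 s11 s13 s12 => ?_)
    refine Run.seq (Run.iterate (N := N) hr4 hn ?_ s11 s13 s12 (fun k hk => ?_)
      fun k b5 hr5 hd5 hk => ?_)
    · rw [hm4, hsd.m_eq 9 (by norm_num) (by norm_num) (by norm_num) (by norm_num),
        hsd.m_eq 10 (by norm_num) (by norm_num) (by norm_num) (by norm_num),
        hsd.m_eq 11 (by norm_num) (by norm_num) (by norm_num) (by norm_num), v9, v10, v11]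
      exact Doubled.zero hG hQ.posSemidef
    · -- the test parameter is at most `6 κ⁵`, whence the constant `108 = 3 * 6 ^ 2`
      have h1 := two_pow_lt_of_lt hc1 hε hε1 rfl hk
      refine (pow_lt_pow_iff_right₀ (one_lt_two (α := ℝ))).1 (h1.trans_le (le_trans ?_ hN))
      refine mul_le_mul_of_nonneg_right ?_ (by linarith)
      have : b3.s 10 ^ 2 ≤ (2 * (3 * κ ^ 5)) ^ 2 := pow_le_pow_left₀ (by linarith) hc2 2
      calc 3 * b3.s 10 ^ 2 ≤ 3 * (2 * (3 * κ ^ 5)) ^ 2 := by linarith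
        _ = 108 * κ ^ 10 := by ring
    · refine Run.extractGain hr5 hn hR hd5.posSemidef fun b6 h0 h1 => ⟨by rw [h0, h1]; abel, ?_⟩
      obtain ⟨hP, hfix⟩ := riccatiSolution_spec hSw hQ hδ A
      rw [h1, hd5.eq_valueIter, thetaStar_eq hSw hδ]
      exact specNorm_closedLoop_sub_le hR hQ.posSemidef hP hfix hc1 hε.le hcert.1 hcert.2.1
        hcert.2.2 k hk
  obtain ⟨σ₂, t₂, a₂, e2, ht2, hrep2, hK, hspec⟩ := hrun σ₁ hrep
  refine ⟨σ₂, t₁ + t₂, a₂.m 0, Exec.seq e1 e2, ?_, ?_, ?_, hK ▸ hspec⟩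
  · have hn3 := Nat.one_le_pow 3 n hn
    nlinarith [Nat.mul_le_mul_left N hn3]
  · simpa [baseAddr] using hrep2.bmem 0 (by norm_num)
  · rw [← hK]
    simpa [baseAddr] using hrep2.bmem 1 (by norm_num)

/-- The logarithmic number of loop iterations that suffices. -/
lemma exists_iteration_bound {κ L : ℝ} (hκ : 1 ≤ κ) (hL : 0 ≤ L) :
    ∃ N : ℕ, 1 ≤ N ∧ 108 * κ ^ 10 * (1 + L) ≤ 2 ^ N ∧
      1 + (N : ℝ) ≤ 217 * (1 + Real.log κ + Real.log (1 + L)) := by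
  have h10 : 1 ≤ κ ^ 10 := one_le_pow₀ hκ
  obtain ⟨N, h1, h2, h3⟩ := exists_le_two_pow (X := 108 * κ ^ 10 * (1 + L)) (by nlinarith)
  refine ⟨N, h1, h2, ?_⟩
  rw [Real.log_mul (by positivity) (by positivity), Real.log_mul (by norm_num) (by positivity),
    Real.log_pow] at h3
  have h4 : Real.log 108 ≤ 107 := by
    have := Real.log_le_sub_one_of_pos (show (0 : ℝ) < 108 by norm_num)
    linarith
  have h5 := Real.log_nonneg hκ
  have h6 := Real.log_nonneg (show (1 : ℝ) ≤ 1 + L by linarith)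
  push_cast at h3
  linarith

end Main

end RevI

end

theorem mainTheorem5 :
    (∀ (n : ℕ) (Sw Q θ' : Matrix (Fin n) (Fin n) ℝ)
      (noise : Matrix (Fin n) (Fin n) ℝ → MeasureTheory.Measure (Fin n → ℝ)),
      Sw.PosDef → Q.PosDef → (∀ θ ∈ RevI.stableSet n, RevI.IsNoiseLaw Sw (noise θ)) →
      θ' ∉ RevI.stableSet n →
      -- the reverse `I`-projection exists and is unique unless `θ'` has a unimodular eigenvalue
      ((∀ z ∈ spectrum ℂ (θ'.map (algebraMap ℝ ℂ)), ‖z‖ ≠ 1) →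
        ∃! P, RevI.IsReverseIProjection Sw noise θ' P) ∧
      -- `θ*_δ` is well defined
      (∀ δ : ℝ, 0 < δ → ∃! P, RevI.IsRiccatiSolution Sw Q θ' δ P) ∧
      -- stability and rate
      (∃ p : ℝ, 1 ≤ p ∧
        (∀ δ : ℝ, 0 < δ → RevI.thetaStar Sw Q θ' δ ∈ RevI.stableSet n) ∧
        ∀ P, RevI.IsReverseIProjection Sw noise θ' P →
          ∃ C : ℝ, ∀ δ : ℝ, 0 < δ →
            RevI.specNorm (P - RevI.thetaStar Sw Q θ' δ) ≤ C * δ ^ p) ∧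
      -- the LQR formula
      (∀ δ : ℝ, 0 < δ →
        (∃! K, RevI.IsOptimalGain θ' (1 : Matrix (Fin n) (Fin n) ℝ) Q ((2 * δ) • Sw)⁻¹ K) ∧
        RevI.thetaStar Sw Q θ' δ =
          θ' + RevI.dlqr θ' (1 : Matrix (Fin n) (Fin n) ℝ) Q ((2 * δ) • Sw)⁻¹)) ∧
    -- cubic time and quadratic memory, on a real random access machine
    (∃ (prog : RevI.Prog) (C : ℝ), ∀ (n : ℕ), 1 ≤ n →
      ∀ (θ' Q Sw : Matrix (Fin n) (Fin n) ℝ) (δ ε κ : ℝ),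
      Sw.PosDef → Q.PosDef → 0 < δ → 0 < ε → ε ≤ 1 → RevI.CondBound κ θ' Q Sw δ →
      ∀ σ : RevI.RamState, RevI.IsInput σ θ' Q Sw δ ε →
      ∃ (σ' : RevI.RamState) (t S : ℕ) (K : Matrix (Fin n) (Fin n) ℝ),
        RevI.Exec S prog σ σ' t ∧
        (t : ℝ) ≤ C * (n : ℝ) ^ 3 *
          (1 + Real.log κ + Real.log (1 + Real.log (1 / ε))) ∧
        (S : ℝ) ≤ C * (n : ℝ) ^ 2 ∧
        RevI.Stores σ' 0 K ∧ RevI.Stores σ' (n ^ 2) (θ' + K) ∧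
        RevI.specNorm
          (K - RevI.dlqr θ' (1 : Matrix (Fin n) (Fin n) ℝ) Q ((2 * δ) • Sw)⁻¹) ≤ ε ∧
        RevI.specNorm (θ' + K - RevI.thetaStar Sw Q θ' δ) ≤ ε) := by
  -- the factor `900` bounds the work per loop iteration in units of `n³`, and `217` the number of
  -- iterations in units of the logarithmic factor
  refine ⟨fun n Sw Q θ' noise hSw hQ hnoise _ => ?_, RevI.gainProgram, 900 * 217, ?_⟩
  · obtain ⟨h1, h2⟩ := RevI.reverseIProjection_theory hSw hQ hnoise θ'
    refine ⟨h1, fun δ hδ => RevI.existsUnique_riccatiSolution hSw hQ hδ θ', ⟨1, le_rfl,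
      fun δ hδ => RevI.thetaStar_mem_stableSet hSw hQ hδ θ', fun P hP => ?_⟩, fun δ hδ =>
      ⟨RevI.existsUnique_isOptimalGain hSw hQ hδ θ', ?_⟩⟩
    · simpa only [Real.rpow_one] using h2 P hP
    · rw [RevI.dlqr_eq hSw hQ hδ θ']; abel
  · intro n hn θ' Q Sw δ ε κ hSw hQ hδ hε hε1 hκ σ hσ
    have hL : 0 ≤ Real.log (1 / ε) := Real.log_nonneg (by rw [le_div_iff₀ hε]; linarith)
    obtain ⟨N, hN1, hN, hN2⟩ := RevI.exists_iteration_bound (hκ.one_le hδ) hL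
    obtain ⟨σ', t, K, h1, h2, h3, h4, h5⟩ :=
      RevI.exec_gainProgram hn hSw hQ hδ hε hε1 hκ hσ hN1 hN
    refine ⟨σ', t, RevI.spaceBound n, K, h1, ?_, ?_, h3, h4, ?_, h5⟩
    · have h6 : (t : ℝ) ≤ 900 * (n : ℝ) ^ 3 * (1 + N) := by exact_mod_cast h2
      have h7 : 900 * (n : ℝ) ^ 3 * (1 + N) ≤ 900 * (n : ℝ) ^ 3 *
          (217 * (1 + Real.log κ + Real.log (1 + Real.log (1 / ε)))) :=
        mul_le_mul_of_nonneg_left hN2 (by positivity)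
      calc (t : ℝ) ≤ _ := h6.trans h7
        _ = _ := by ring
    · have h6 : (1 : ℝ) ≤ (n : ℝ) ^ 2 := one_le_pow₀ (by exact_mod_cast hn)
      simp only [RevI.spaceBound]
      push_cast
      linarith
    · rw [RevI.dlqr_eq hSw hQ hδ θ', show K - (RevI.thetaStar Sw Q θ' δ - θ') =
        θ' + K - RevI.thetaStar Sw Q θ' δ by abel]
      exact h5
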